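/- Let $k$ be a field of characteristic zero, $L$ a finite-dimensional Lie algebra over $k$ with bracket $l$, and $h=\langle\cdot,\cdot\rangle$ an invariant inner product on $L$ (a nondegenerate symmetric bilinear form with $\langle [x,y],z\rangle=-\langle y,[x,z]\rangle$). Let $n\ge 1$ and let $\varphi:\Lambda^n L\to L$ be a cyclic cocycle of exterior degree $n$: $\langle\varphi(v_1,\dots,v_n),v_{n+1}\rangle=(-1)^n\langle v_1,\varphi(v_2,\dots,v_{n+1})\rangle$, and $\varphi$ is closed for the Chevalley–Eilenberg differential with coefficients in the adjoint module. *Graph complex.* An oriented graph is a finite graph (loops and multiple edges allowed, every vertex of valence at least $3$) with an ordering of its vertices and an arrow on every edge. The ordinary graph complex over $k$ is spanned by the oriented graphs; an isomorphism $\Gamma\to\Gamma'$ of the underlying graphs gives the relation $\Gamma'=\pm\Gamma$, where the sign is the sign of the permutation of the vertices times $(-1)^{\#\text{reversed arrows}}$. The boundary $\partial\Gamma$ is the sum over all non-loop edges of the graph obtained by contracting the edge; its orientation is fixed by the rule that, when the arrow of the edge points to the last vertex, that vertex disappears. *The function $Z$.* Let $e_a$ be a basis of $L$ and $(h^{ab})$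 the inverse of the Gram matrix of $h$. Let $t$ be a parameter of the parity of $n$ with $t^2=0$, and regard $L$ as a space of even elements, so that the vectors of its parity reversion are odd. For an oriented graph $\Gamma$, place at each $N$-valent vertex the tensor $\langle c_{N-1}(v_1,\dots,v_{N-1}),v_N\rangle$ of the family $c=l+t\varphi$ (with $c_m=0$ if $m\notin\{2,n\}$), multiply these in the order of the vertices, place $h^{ab}$ on each edge in the order of its arrow, and contract along the graph, with the Koszul signs for odd vectors and the odd parameter $t$ (up to an overall sign depending only on $n$ and the numbers of vertices and edges). Let $Z(\Gamma)\in k$ be the coefficient of $t$. Then: 1. $l+t\varphi$ is an infinitesimal ($t^2=0$) deformation of $L$ into an $L_\infty$ algebra for which the inner product is invariant, i.e. all its structure maps are cyclic. 2. $Z(\Gamma)$ does not depend on the basis, and $Z(\Gamma')=\pm Z(\Gamma)$ for every isomorphism of the underlying graphs, with the sign as in the relations above. 3. In each bidegree (number of vertices, number of edges), hence for every Euler characteristic, the chain $$Z=\sum_{\Gamma}\frac{Z(\Gamma)}{|\mathrm{Aut}\,\Gamma|}\,\Gamma ,$$ over the isomorphism classes of graphs, is a cycle: $\partial Z=0$.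 The same holds for its part on connected graphs. 4. If $Z(\Gamma)\ne0$, then $\Gamma$ has a vertex of valence $n+1$ and all its other vertices are trivalent. -/

import Mathlib

open scoped BigOperators

noncomputable section

/-! ### Cochains of a Lie algebra, `L∞` relations and infinitesimal deformations -/

section Algebra

variable {k : Type*} [Field k] {L : Type*} [LieRing L] [LieAlgebra k L]

/-- Cyclicity of a cochain `φ ∈ Hom(Λⁿ L, L)` with respect to a bilinear form `h`
(all elements of `L` are even):
`⟨φ(v₁,…,vₙ), vₙ₊₁⟩ = (-1)ⁿ ⟨v₁, φ(v₂,…,vₙ₊₁)⟩`. -/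
def IsCyclicCochain (h : LinearMap.BilinForm k L) {n : ℕ} (φ : L [⋀^Fin n]→ₗ[k] L) : Prop :=
  ∀ v : Fin (n + 1) → L,
    h (φ fun i => v i.castSucc) (v (Fin.last n)) = (-1) ^ n * h (v 0) (φ fun i => v i.succ)

/-- The Chevalley–Eilenberg coboundary of a cochain with values in the adjoint module:
`∑ᵢ (-1)ⁱ [vᵢ, φ(…v̂ᵢ…)] + ∑_{i<j} (-1)^{i+j} φ([vᵢ,vⱼ], …v̂ᵢ…v̂ⱼ…)`.
In the double sum `i` ranges over the indices smaller than `j`. -/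
def lieCoboundary : {n : ℕ} → (L [⋀^Fin n]→ₗ[k] L) → (Fin (n + 1) → L) → L
  | 0, φ => fun v => ⁅v 0, φ ![]⁆
  | m + 1, φ => fun v =>
      (∑ i : Fin (m + 2), (-1 : k) ^ (i : ℕ) • ⁅v i, φ (i.removeNth v)⁆) +
      ∑ j : Fin (m + 2), ∑ i : Fin (m + 1),
        if i.castSucc < j then
          (-1 : k) ^ ((i : ℕ) + (j : ℕ)) •
            φ (Fin.cons ⁅v i.castSucc, v j⁆ (i.removeNth (j.removeNth v)))
        else 0

/-- `φ` is a cocycle of the Lie algebra `L` with coefficients in the adjoint module. -/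
def IsLieCocycle {n : ℕ} (φ : L [⋀^Fin n]→ₗ[k] L) : Prop :=
  ∀ v : Fin (n + 1) → L, lieCoboundary φ v = 0

/-- A family of cochains `cₘ ∈ Hom(Λᵐ L, L)`. -/
abbrev CochainFamily (k L : Type*) [Field k] [LieRing L] [LieAlgebra k L] : Type _ :=
  ∀ m : ℕ, L [⋀^Fin m]→ₗ[k] L

/-- The unshuffles of type `(q, p)`. -/
def unshuffles (q p : ℕ) : Finset (Equiv.Perm (Fin (q + p))) :=
  Finset.univ.filter fun σ =>
    (∀ i j : Fin q, i < j → σ (Fin.castAdd p i) < σ (Fin.castAdd p j)) ∧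
    (∀ i j : Fin p, i < j → σ (Fin.natAdd q i) < σ (Fin.natAdd q j))

/-- The composition
`∑_σ sgn(σ) f(g(v_{σ(1)},…,v_{σ(q)}), v_{σ(q+1)},…,v_{σ(q+p)})`, over the unshuffles `σ` of
type `(q, p)`. -/
def unshuffleComp {p q : ℕ} (f : L [⋀^Fin (p + 1)]→ₗ[k] L) (g : L [⋀^Fin q]→ₗ[k] L)
    (v : Fin (q + p) → L) : L :=
  ∑ σ ∈ unshuffles q p, ((Equiv.Perm.sign σ : ℤ) : k) •
    f (Fin.cons (g fun i => v (σ (Fin.castAdd p i))) fun j => v (σ (Fin.natAdd q j)))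

/-- The left hand side of the `N`-th `L∞` relation, polarized in the two cochains involved:
`∑_{q+l=N+1} (-1)^{(q-1)l} ∑_σ sgn(σ) c_l(c'_q(v_{σ(1)},…,v_{σ(q)}), v_{σ(q+1)},…,v_{σ(N)})`,
with `l = p + 1` and `q + p = N`. Only the first `N` entries of `v` are used. -/
def lInftyExpr (c c' : CochainFamily k L) (N : ℕ) (v : ℕ → L) : L :=
  ∑ x ∈ Finset.HasAntidiagonal.antidiagonal N,
    (-1 : k) ^ ((x.1 + 1) * (x.2 + 1)) • unshuffleComp (c (x.2 + 1)) (c' x.1) fun i => v i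

/-- `c` is an `L∞` algebra structure on `L` (placed in even degree): the cochain `c_m`, of
parity `m`, vanishes when `m` is odd, and the `L∞` relations hold. -/
structure IsLInfty (c : CochainFamily k L) : Prop where
  zero : c 0 = 0
  parity : ∀ m, Odd m → c m = 0
  relation : ∀ N v, lInftyExpr c c N v = 0

/-- `c + t c'` is an infinitesimal deformation of the `L∞` structure `c` with a parameter `t` of
parity `n`, `t² = 0`: `c + t c'` has the parities and satisfies the relations of an `L∞` structure
modulo `t²`. (Since `c` is concentrated in even degrees, moving `t` to the left in the relations
never produces a sign.) -/
structure IsInfinitesimalDeformation (n : ℕ) (c c' : CochainFamily k L) : Prop where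
  base : IsLInfty c
  zero : c' 0 = 0
  parity : ∀ m, Odd (m + n) → c' m = 0
  relation : ∀ N v, lInftyExpr c c' N v + lInftyExpr c' c N v = 0

/-- The Lie bracket as an alternating map. -/
def lieBracketCochain (k L : Type*) [Field k] [LieRing L] [LieAlgebra k L] :
    L [⋀^Fin 2]→ₗ[k] L where
  toFun v := ⁅v 0, v 1⁆
  map_update_add' v i x y := by
    fin_cases i <;> simp [Function.update]
  map_update_smul' v i r x := by
    fin_cases i <;> simp [Function.update]
  map_eq_zero_of_eq' v i j hv hij := by
    fin_cases i <;> fin_cases j <;> simp_all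

/-- The Lie algebra `L` regarded as a family of cochains, concentrated in degree `2`. -/
def lieFamily (k L : Type*) [Field k] [LieRing L] [LieAlgebra k L] : CochainFamily k L :=
  Pi.single 2 (lieBracketCochain k L)

end Algebra

/-! ### The complex of ordinary graphs -/

/-- The half-edges of a graph with edges indexed by `Fin e`, ordered lexicographically. The arrow
of the edge `j` runs from the half-edge `(j, false)` to the half-edge `(j, true)`. -/
abbrev HalfEdge (e : ℕ) : Type := Fin e ×ₗ Bool

/-- The half-edges at the vertex `y`, where `ends j s` is the vertex of the half-edge `(j, s)`. -/
def endsAt {v e : ℕ} (ends : Fin e → Bool → Fin v) (y : Fin v) : Finset (HalfEdge e) :=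
  Finset.univ.filter fun p => ends (ofLex p).1 (ofLex p).2 = y

theorem card_endsAt {v e : ℕ} (ends : Fin e → Bool → Fin v) (y : Fin v) :
    (endsAt ends y).card = ∑ j, ∑ s, if ends j s = y then 1 else 0 := by
  rw [endsAt, Finset.card_filter, ← Fintype.sum_prod_type']
  exact Fintype.sum_equiv ofLex _ _ fun _ => rfl

/-- An oriented graph with `v` vertices and `e` edges (loops and multiple edges are allowed), every
vertex being at least trivalent. The orientation is the order of the vertices together with the
arrow on each edge `j`, from `ends j false` to `ends j true`. The numbering of the edges is
auxiliary. -/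
@[ext]
structure OrGraph (v e : ℕ) where
  ends : Fin e → Bool → Fin v
  three_le : ∀ y, 3 ≤ (endsAt ends y).card

namespace OrGraph

variable {v e : ℕ}

/-- The valence of a vertex: the number of half-edges at it. A loop counts twice. -/
def valence (Γ : OrGraph v e) (y : Fin v) : ℕ := (endsAt Γ.ends y).card

instance : Finite (OrGraph v e) :=
  Finite.of_injective (fun Γ : OrGraph v e => Γ.ends) fun _ _ h => OrGraph.ext h

/-- An isomorphism of the underlying graphs, as a bijection on vertices, a bijection on edges, and
for every edge the information whether its arrow is reversed. -/
@[ext]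
structure Iso (Γ Γ' : OrGraph v e) where
  vertex : Equiv.Perm (Fin v)
  edge : Equiv.Perm (Fin e)
  flip : Fin e → Bool
  ends_eq : ∀ j s, Γ'.ends (edge j) (xor (flip j) s) = vertex (Γ.ends j s)

/-- `1` if the isomorphism carries one orientation to the other, `-1` if it carries it to the
opposite: the sign of the vertex permutation times the parity of the number of reversed arrows. -/
def Iso.sign {Γ Γ' : OrGraph v e} (f : Iso Γ Γ') : ℤˣ :=
  Equiv.Perm.sign f.vertex * ∏ j, if f.flip j then -1 else 1

/-- The order of the automorphism group of the underlying graph (acting on half-edges). -/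
def autCard (Γ : OrGraph v e) : ℕ := Nat.card (Iso Γ Γ)

/-- Isomorphism of the underlying graphs; opposite orientations give the same class. -/
instance isoSetoid (v e : ℕ) : Setoid (OrGraph v e) where
  r Γ Γ' := Nonempty (Iso Γ Γ')
  iseqv :=
    { refl := fun Γ => ⟨⟨1, 1, fun _ => false, by simp⟩⟩
      symm := by
        rintro Γ Γ' ⟨f⟩
        refine ⟨⟨f.vertex.symm, f.edge.symm, fun j => f.flip (f.edge.symm j), fun j s => ?_⟩⟩
        have h := f.ends_eq (f.edge.symm j) (xor (f.flip (f.edge.symm j)) s)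
        rw [Equiv.apply_symm_apply, ← Bool.xor_assoc, Bool.xor_self, Bool.false_xor] at h
        rw [h, Equiv.symm_apply_apply]
      trans := by
        rintro Γ₁ Γ₂ Γ₃ ⟨f⟩ ⟨g⟩
        refine ⟨⟨f.vertex.trans g.vertex, f.edge.trans g.edge,
          fun j => xor (g.flip (f.edge j)) (f.flip j), fun j s => ?_⟩⟩
        simp only [Equiv.trans_apply]
        rw [Bool.xor_assoc, g.ends_eq, f.ends_eq] }

/-- The isomorphism classes of graphs with `v` vertices and `e` edges. -/
abbrev IsoClass (v e : ℕ) : Type := Quotient (isoSetoid v e)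

instance : Fintype (IsoClass v e) := Fintype.ofFinite _

/-- Connectedness of the graph. -/
def Connected (Γ : OrGraph v e) : Prop :=
  (SimpleGraph.fromRel fun x y => ∃ j, Γ.ends j false = x ∧ Γ.ends j true = y).Connected

/-- The vertex map of the contraction of an edge from `s` to `t`: the vertex `t` disappears,
being merged with `s`, and the other vertices keep their order. -/
def collapse (s t : Fin (v + 1)) (hst : s ≠ t) (x : Fin (v + 1)) : Fin v :=
  if hx : x = t then (finSuccAboveEquiv t).symm ⟨s, hst⟩ else (finSuccAboveEquiv t).symm ⟨x, hx⟩

theorem succAbove_collapse (s t : Fin (v + 1)) (hst : s ≠ t) (x : Fin (v + 1)) :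
    t.succAbove (collapse s t hst x) = if x = t then s else x := by
  have key : ∀ z : {z : Fin (v + 1) // z ≠ t},
      t.succAbove ((finSuccAboveEquiv t).symm z) = z := fun z => by
    have := (finSuccAboveEquiv t).apply_symm_apply z
    rw [finSuccAboveEquiv_apply] at this
    exact congrArg Subtype.val this
  unfold collapse
  split_ifs with hx
  · rw [key]
  · rw [key]

theorem collapse_eq_iff (s t : Fin (v + 1)) (hst : s ≠ t) (x : Fin (v + 1)) (y : Fin v) :
    collapse s t hst x = y ↔ (if x = t then s else x) = t.succAbove y := by
  rw [← succAbove_collapse s t hst x]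
  exact (Fin.succAbove_right_injective.eq_iff).symm

/-- Contraction of the edge `i`, which is not a loop. -/
def contract (Γ : OrGraph (v + 1) (e + 1)) (i : Fin (e + 1))
    (hi : Γ.ends i false ≠ Γ.ends i true) : OrGraph v e where
  ends j s := collapse (Γ.ends i false) (Γ.ends i true) hi (Γ.ends (i.succAbove j) s)
  three_le y := by
    have hY : ∀ Y, 3 ≤ ∑ j, ∑ s, if Γ.ends j s = Y then 1 else 0 := fun Y => by
      rw [← card_endsAt]
      exact Γ.three_le Y
    rw [card_endsAt]
    simp only [collapse_eq_iff]
    have ht : Γ.ends i true ≠ (Γ.ends i true).succAbove y := (Fin.succAbove_ne _ _).symm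
    generalize (Γ.ends i true).succAbove y = Y at ht ⊢
    by_cases hs : Y = Γ.ends i false
    · have h1 := hY (Γ.ends i false)
      have h2 := hY (Γ.ends i true)
      rw [Fin.sum_univ_succAbove _ i] at h1 h2
      have e1 : (∑ s, if Γ.ends i s = Γ.ends i false then 1 else 0) = 1 := by
        rw [Fintype.sum_bool]
        simp [hi.symm]
      have e2 : (∑ s, if Γ.ends i s = Γ.ends i true then 1 else 0) = 1 := by
        rw [Fintype.sum_bool]
        simp [hi]
      rw [e1] at h1
      rw [e2] at h2
      have : (∑ j : Fin e, ∑ s, if (if Γ.ends (i.succAbove j) s = Γ.ends i true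
            then Γ.ends i false else Γ.ends (i.succAbove j) s) = Y then 1 else 0) =
          (∑ j : Fin e, ∑ s, if Γ.ends (i.succAbove j) s = Γ.ends i false then 1 else 0) +
          ∑ j : Fin e, ∑ s, if Γ.ends (i.succAbove j) s = Γ.ends i true then 1 else 0 := by
        rw [← Finset.sum_add_distrib]
        refine Finset.sum_congr rfl fun j _ => ?_
        rw [← Finset.sum_add_distrib]
        refine Finset.sum_congr rfl fun s _ => ?_
        by_cases hx : Γ.ends (i.succAbove j) s = Γ.ends i true
        · simp [hx, hs, hi.symm]
        · simp [hx, hs]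
      omega
    · have h1 := hY Y
      rw [Fin.sum_univ_succAbove _ i] at h1
      have e1 : (∑ s, if Γ.ends i s = Y then 1 else 0) = 0 := by
        simp [ht, Ne.symm hs]
      rw [e1, zero_add] at h1
      refine h1.trans (le_of_eq (Finset.sum_congr rfl fun j _ => Finset.sum_congr rfl fun s _ => ?_))
      by_cases hx : Γ.ends (i.succAbove j) s = Γ.ends i true
      · simp [hx, ht, Ne.symm hs]
      · simp [hx]

/-- The sign of the contraction of the edge `i`: moving its target to the last position in the
order of the `v + 1` vertices takes `v - t` transpositions, if the target has position
`t ∈ {0,…,v}`. -/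
def contractSign (Γ : OrGraph (v + 1) (e + 1)) (i : Fin (e + 1)) : ℤˣ :=
  (-1) ^ (v - (Γ.ends i true : ℕ))

/-- The permutation induced on the remaining elements when `a` and its image are removed. -/
def removePerm (ρ : Equiv.Perm (Fin (v + 1))) (a : Fin (v + 1)) : Equiv.Perm (Fin v) :=
  (finSuccAboveEquiv a).trans <|
    (ρ.subtypeEquiv fun x => by simp).trans (finSuccAboveEquiv (ρ a)).symm

theorem succAbove_removePerm (ρ : Equiv.Perm (Fin (v + 1))) (a : Fin (v + 1)) (y : Fin v) :
    (ρ a).succAbove (removePerm ρ a y) = ρ (a.succAbove y) := by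
  have := (finSuccAboveEquiv (ρ a)).apply_symm_apply
    ((ρ.subtypeEquiv fun x => by simp : {x // x ≠ a} ≃ {x // x ≠ ρ a}) (finSuccAboveEquiv a y))
  rw [finSuccAboveEquiv_apply] at this
  exact congrArg Subtype.val this

theorem sign_removePerm (ρ : Equiv.Perm (Fin (v + 1))) (a : Fin (v + 1)) :
    Equiv.Perm.sign (removePerm ρ a) =
      Equiv.Perm.sign ρ * (-1) ^ (a : ℕ) * (-1) ^ (ρ a : ℕ) := by
  have h : Equiv.Perm.decomposeFin.symm (0, removePerm ρ a) =
      (ρ a).cycleRange * ρ * a.cycleRange⁻¹ := by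
    rw [eq_mul_inv_iff_mul_eq]
    ext1 x
    rcases eq_or_ne x a with rfl | hx
    · simp [Fin.cycleRange_self]
    · obtain ⟨y, rfl⟩ := Fin.exists_succAbove_eq hx
      simp only [Equiv.Perm.mul_apply, Fin.cycleRange_succAbove,
        Equiv.Perm.decomposeFin_symm_apply_succ, Equiv.swap_self, Equiv.refl_apply]
      rw [← succAbove_removePerm, Fin.cycleRange_succAbove]
  have h' := congrArg Equiv.Perm.sign h
  rw [Equiv.Perm.decomposeFin.symm_sign, if_pos rfl, one_mul, map_mul, map_mul, map_inv,
    Fin.sign_cycleRange, Fin.sign_cycleRange] at h'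
  rw [h', Int.units_inv_eq_self]
  ac_rfl

theorem Iso.loop_iff {Γ Γ' : OrGraph v e} (f : Iso Γ Γ') (i : Fin e) :
    Γ'.ends (f.edge i) false ≠ Γ'.ends (f.edge i) true ↔ Γ.ends i false ≠ Γ.ends i true := by
  have h0 := f.ends_eq i false
  have h1 := f.ends_eq i true
  cases hf : f.flip i <;> simp only [hf, Bool.xor_false, Bool.xor_true, Bool.not_true,
    Bool.not_false] at h0 h1 <;> rw [h0, h1]
  · simp
  · simp [eq_comm]

/-- Contraction is compatible with isomorphisms and orientations. -/
theorem Iso.exists_contract {Γ Γ' : OrGraph (v + 1) (e + 1)} (f : Iso Γ Γ') (i : Fin (e + 1))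
    (hi : Γ.ends i false ≠ Γ.ends i true)
    (hi' : Γ'.ends (f.edge i) false ≠ Γ'.ends (f.edge i) true) :
    ∃ g : Iso (Γ.contract i hi) (Γ'.contract (f.edge i) hi'),
      g.sign = f.sign * Γ.contractSign i * Γ'.contractSign (f.edge i) := by
  obtain ⟨ρ, hs, ht, hρ, hsign⟩ : ∃ ρ : Equiv.Perm (Fin (v + 1)),
      ρ (Γ.ends i false) = Γ'.ends (f.edge i) false ∧
      ρ (Γ.ends i true) = Γ'.ends (f.edge i) true ∧
      (∀ x, x ≠ Γ.ends i false → x ≠ Γ.ends i true → ρ x = f.vertex x) ∧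
      Equiv.Perm.sign ρ = Equiv.Perm.sign f.vertex * if f.flip i then -1 else 1 := by
    have h0 := f.ends_eq i false
    have h1 := f.ends_eq i true
    cases hf : f.flip i <;> simp only [hf, Bool.xor_false, Bool.xor_true, Bool.not_true,
      Bool.not_false] at h0 h1
    · exact ⟨f.vertex, h0.symm, h1.symm, fun _ _ _ => rfl, by simp⟩
    · refine ⟨f.vertex * Equiv.swap (Γ.ends i false) (Γ.ends i true), ?_, ?_, fun x hx hx' => ?_, ?_⟩
      · simp [h1]
      · simp [h0]
      · simp [Equiv.swap_apply_of_ne_of_ne hx hx']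
      · simp [Equiv.Perm.sign_swap hi]
  refine ⟨⟨removePerm ρ (Γ.ends i true), removePerm f.edge i, fun j => f.flip (i.succAbove j),
    fun j s => ?_⟩, ?_⟩
  · change collapse _ _ _ _ = removePerm ρ _ (collapse _ _ _ _)
    rw [succAbove_removePerm, f.ends_eq, collapse_eq_iff, ← ht, succAbove_removePerm,
      succAbove_collapse, ht]
    generalize Γ.ends (i.succAbove j) s = x
    have h0 := f.ends_eq i false
    have h1 := f.ends_eq i true
    by_cases hxt : x = Γ.ends i true
    · rw [if_pos hxt, hs]
      subst hxt
      cases hf : f.flip i <;> simp only [hf, Bool.xor_false, Bool.xor_true, Bool.not_true,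
        Bool.not_false] at h0 h1
      · simp [h1]
      · simp [← h1]
    · rw [if_neg hxt]
      by_cases hxs : x = Γ.ends i false
      · subst hxs
        rw [hs]
        cases hf : f.flip i <;> simp only [hf, Bool.xor_false, Bool.xor_true, Bool.not_true,
          Bool.not_false] at h0 h1
        · simp [← h0]
        · simp [h0]
      · rw [hρ x hxs hxt, if_neg]
        rw [← hρ x hxs hxt, ← ht]
        exact fun h => hxt (ρ.injective h)
  · have hp : ∀ a b : Fin (v + 1), ((-1 : ℤˣ) ^ (v - (a : ℕ))) * (-1) ^ (v - (b : ℕ)) =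
        (-1) ^ (a : ℕ) * (-1) ^ (b : ℕ) := fun a b => by
      rw [← pow_add, ← pow_add, neg_one_pow_congr]
      have := a.is_le
      have := b.is_le
      simp only [Nat.even_iff]
      omega
    change Equiv.Perm.sign (removePerm ρ (Γ.ends i true)) *
        (∏ j : Fin e, if f.flip (i.succAbove j) then -1 else 1) =
      Equiv.Perm.sign f.vertex * (∏ j, if f.flip j then -1 else 1) *
        (-1) ^ (v - (Γ.ends i true : ℕ)) * (-1) ^ (v - (Γ'.ends (f.edge i) true : ℕ))
    rw [← ht, sign_removePerm, hsign, Fin.prod_univ_succAbove _ i,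
      mul_assoc _ _ ((-1) ^ _), mul_assoc _ ((-1) ^ (v - _)), hp]
    ac_rfl

end OrGraph

section Complex

variable (k : Type*) [Field k]

/-- The relations of the graph complex: an oriented graph is identified with any isomorphic one if
the orientations agree under the isomorphism, and with its negative if they are opposite. -/
def graphRelations (v e : ℕ) : Submodule k (OrGraph v e →₀ k) :=
  Submodule.span k {x | ∃ (Γ Γ' : OrGraph v e) (f : OrGraph.Iso Γ Γ'),
    x = Finsupp.single Γ' 1 - ((f.sign : ℤ) : k) • Finsupp.single Γ 1}

/-- The part of the graph complex spanned by the graphs with `v` vertices and `e` edges. The graph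
complex of Euler characteristic `χ` is the sum of these spaces over `v - e = χ`. -/
abbrev GraphComplex (v e : ℕ) : Type _ := (OrGraph v e →₀ k) ⧸ graphRelations k v e

variable {k}

/-- The class of an oriented graph in the graph complex. -/
def graphClass {v e : ℕ} (Γ : OrGraph v e) : GraphComplex k v e :=
  (graphRelations k v e).mkQ (Finsupp.single Γ 1)

theorem graphClass_eq {v e : ℕ} {Γ Γ' : OrGraph v e} (f : OrGraph.Iso Γ Γ') :
    (graphClass Γ' : GraphComplex k v e) = ((f.sign : ℤ) : k) • graphClass Γ := by
  rw [graphClass, graphClass, ← map_smul, ← sub_eq_zero, ← map_sub, Submodule.mkQ_apply,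
    Submodule.Quotient.mk_eq_zero]
  exact Submodule.subset_span ⟨Γ, Γ', f, rfl⟩

variable (k)

/-- The boundary of an oriented graph: the sum over the contractible edges (those that are not
loops) of the contracted graph with its induced orientation. The orientation is induced by the rule
that the arrow of the contracted edge points to the last vertex, which disappears. -/
def graphBoundaryGen {v e : ℕ} (Γ : OrGraph (v + 1) (e + 1)) : GraphComplex k v e :=
  ∑ i, if hi : Γ.ends i false ≠ Γ.ends i true then
    ((Γ.contractSign i : ℤ) : k) • graphClass (Γ.contract i hi) else 0

theorem graphBoundaryGen_eq {v e : ℕ} {Γ Γ' : OrGraph (v + 1) (e + 1)} (f : OrGraph.Iso Γ Γ') :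
    graphBoundaryGen k Γ' = ((f.sign : ℤ) : k) • graphBoundaryGen k Γ := by
  unfold graphBoundaryGen
  rw [Finset.smul_sum, ← Equiv.sum_comp f.edge]
  refine Finset.sum_congr rfl fun i _ => ?_
  by_cases hi : Γ.ends i false ≠ Γ.ends i true
  · have hi' := (f.loop_iff i).2 hi
    obtain ⟨g, hg⟩ := f.exists_contract i hi hi'
    rw [dif_pos hi, dif_pos hi', graphClass_eq g, smul_smul, smul_smul, hg]
    congr 1
    rw [← Int.cast_mul, ← Int.cast_mul, ← Units.val_mul, ← Units.val_mul]
    congr 2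
    rw [mul_comm, mul_assoc, Int.units_mul_self, mul_one]
  · rw [dif_neg hi, dif_neg (mt (f.loop_iff i).1 hi), smul_zero]

/-- The boundary operator of the graph complex. -/
def graphBoundary (v e : ℕ) : GraphComplex k (v + 1) (e + 1) →ₗ[k] GraphComplex k v e :=
  (graphRelations k (v + 1) (e + 1)).liftQ (Finsupp.linearCombination k (graphBoundaryGen k)) <| by
    rw [graphRelations, Submodule.span_le]
    rintro x ⟨Γ, Γ', f, rfl⟩
    simp [graphBoundaryGen_eq k f]

theorem graphBoundary_graphClass {v e : ℕ} (Γ : OrGraph (v + 1) (e + 1)) :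
    graphBoundary k v e (graphClass Γ) = graphBoundaryGen k Γ := by
  simp [graphBoundary, graphClass]

variable {k}

/-- The chain `∑_Γ F(Γ)/|Aut Γ| · Γ`, over one representative `Γ` of every isomorphism class of
graphs with `v` vertices and `e` edges. If `F` changes sign with the orientation, then it does not
depend on the representatives. -/
def graphChain {v e : ℕ} (F : OrGraph v e → k) : GraphComplex k v e :=
  ∑ c : OrGraph.IsoClass v e, (F c.out / (c.out.autCard : k)) • graphClass c.out

end Complex

/-! ### The chain given by an `L∞` algebra with an invariant inner product -/

section Amplitude

variable {k : Type*} [Field k] {L : Type*} [LieRing L] [LieAlgebra k L]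
variable {ι : Type*} [Fintype ι] [DecidableEq ι]

/-- The tensor with `N` legs placed at an `N`-valent vertex:
`(v₁,…,v_N) ↦ ⟨c_{N-1}(v₁,…,v_{N-1}), v_N⟩`. -/
def vertexTensor (h : LinearMap.BilinForm k L) (c : CochainFamily k L) :
    (N : ℕ) → (Fin N → L) → k
  | 0, _ => 0
  | m + 1, v => h (c m fun i => v i.castSucc) (v (Fin.last m))

/-- The sign of the graded contraction of the odd vectors sitting on the half-edges: the sign of the
permutation that takes the order of the half-edges along the edges (and the arrows) to their order
along the vertices; at every vertex the half-edges keep their relative order. It is computed by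
counting inversions. -/
def contractionSign {v e : ℕ} (Γ : OrGraph v e) : ℤˣ :=
  (-1) ^ (Finset.univ.filter fun p : HalfEdge e × HalfEdge e => p.1 < p.2 ∧
    Γ.ends (ofLex p.2).1 (ofLex p.2).2 < Γ.ends (ofLex p.1).1 (ofLex p.1).2).card

/-- The graded contraction, along the graph `Γ`, of the vertex tensors given by the families `T y`
at the vertices `y`, and of the inverse `h^{ab}` of the Gram matrix of `h` in the basis `b` at the
edges: the sum over all labellings `a` of the half-edges by basis indices. -/
def graphContraction (h : LinearMap.BilinForm k L) (b : Module.Basis ι k L) {v e : ℕ}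
    (Γ : OrGraph v e) (T : Fin v → CochainFamily k L) : k :=
  ((contractionSign Γ : ℤ) : k) * ∑ a : HalfEdge e → ι,
    (∏ y, vertexTensor h (T y) (Γ.valence y)
      fun i => b (a ((endsAt Γ.ends y).orderEmbOfFin rfl i))) *
    ∏ j : Fin e, (LinearMap.BilinForm.toMatrix b h)⁻¹ (a (toLex (j, false))) (a (toLex (j, true)))

/-- The coefficient of `t` in `Z(Γ)` for the infinitesimal deformation `c + t c'`, where `t` has
parity `n`: the vertex tensors are multiplied in the order of the vertices, the term `t c'` is
chosen at the vertex `x` and `c` at all the others, and `t` is moved to the left past the odd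
tensors of the vertices preceding `x`. -/
def deformationAmplitude (n : ℕ) (c c' : CochainFamily k L) (h : LinearMap.BilinForm k L)
    (b : Module.Basis ι k L) {v e : ℕ} (Γ : OrGraph v e) : k :=
  ∑ x : Fin v, (-1) ^ (n * (x : ℕ)) *
    graphContraction h b Γ (Function.update (fun _ => c) x c')

/-- The function `Z` on oriented graphs determined by the infinitesimal deformation `l + t φ` of a
Lie algebra with bracket `l` by a cochain `φ` of exterior degree `n`. -/
def cocycleAmplitude {n : ℕ} (φ : L [⋀^Fin n]→ₗ[k] L) (h : LinearMap.BilinForm k L)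
    (b : Module.Basis ι k L) {v e : ℕ} (Γ : OrGraph v e) : k :=
  deformationAmplitude n (lieFamily k L) (Pi.single n φ) h b Γ

open Classical in
/-- The part of a function on oriented graphs that is supported on connected graphs. -/
def connectedPart {v e : ℕ} (F : OrGraph v e → k) (Γ : OrGraph v e) : k :=
  if Γ.Connected then F Γ else 0

end Amplitude

end

/-! The cycle property is the cyclic form of the quadratic `L∞` relations, read along graphs. Fix a
graph `Δ` and its last vertex, with set `S` of half-edges. The graphs in which the last edge
contracts to this vertex correspond to the splittings `S = A ⊔ B` into parts with at least two
elements. In the amplitude of such a graph the inverse Gram matrix on the new edge glues the two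
vertex tensors, `∑ h(u, bᵢ) h(u', bⱼ) hⁱʲ = h(u, u')`. So the amplitudes of all expansions add up to
the contraction along `Δ` of `∑ ± h(c(A), c'(B))`, with the shuffle sign of `(A, B)` times
`(-1)^|B|`. At first order in `t` the pair `(c, c')` is `(φ, l)`, `(l, φ)` or `(l, l)`. For a cyclic
cocycle the sum is the cocycle condition paired with one more vector (`IsLieCocycle.sum_splitTerm`),
and the Jacobi identity is the special case in which the cocycle is the bracket. Hence the
coefficient of every `Δ` vanishes (`sum_cocycleAmplitude_expansions`).

Automorphisms are handled by counting. By orbit counting, the chain times the number of relabelings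
is the sum of `F(Γ) Γ` over all numbered graphs (`smul_graphChain`). By symmetry only the
contraction of the last edge matters, and its ends may be taken to be the last two vertices, where
the contraction carries no sign (`graphBoundary_graphChain_eq_zero`). Expansion does not change
connectedness, so the connected part is a cycle for the same reason.

The change of sign with the orientation comes from cyclicity, which makes the vertex tensors
antisymmetric in all legs. An isomorphism changes the contraction sign by the reversed arrows, by
inversions inside the vertices, which antisymmetry compensates, and by the interchange of whole
vertices (`Iso.contractionSign_eq`). The last factor is the sign of the vertex permutation, because
all vertices are trivalent except for one of valence `n + 1`; the deviation at that vertex is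
absorbed by the sign of moving `t` to the left. The basis drops out because the inverse Gram matrix
is a contravariant tensor.

For the deformation statement, the only relation that is not trivially satisfied is the one with `n
+ 1` arguments, where the polarized expression is `(-1)^(n-1)` times the Chevalley–Eilenberg
coboundary of `φ`. -/

/-! ### Signs, inversions and alternating tensors on linearly ordered sets -/

section Inversions

variable {E F M : Type*} [Fintype E] [LinearOrder E] [Fintype F] [LinearOrder F] [CommMonoid M]

/-- The pairs `p < q` of elements of a finite linear order. -/
def ltPairs (E : Type*) [Fintype E] [LinearOrder E] : Finset (E × E) :=
  Finset.univ.filter fun p => p.1 < p.2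

@[simp] theorem mem_ltPairs {p : E × E} : p ∈ ltPairs E ↔ p.1 < p.2 := by simp [ltPairs]

/-- The product of a symmetric function over the pairs `p < q` is invariant under bijections. -/
theorem prod_ltPairs_comp (σ : E ≃ F) (g : F → F → M) (hg : ∀ p q, g p q = g q p) :
    ∏ p ∈ ltPairs E, g (σ p.1) (σ p.2) = ∏ p ∈ ltPairs F, g p.1 p.2 := by
  -- The image of a pair is rearranged in increasing order, which the symmetry of `g` permits.
  refine Finset.prod_bij'
    (fun p _ => if σ p.1 < σ p.2 then (σ p.1, σ p.2) else (σ p.2, σ p.1))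
    (fun p _ => if σ.symm p.1 < σ.symm p.2 then (σ.symm p.1, σ.symm p.2)
      else (σ.symm p.2, σ.symm p.1)) ?_ ?_ ?_ ?_ ?_
  · rintro ⟨p, q⟩ h
    have hne : σ p ≠ σ q := fun H => (mem_ltPairs.1 h).ne (σ.injective H)
    dsimp only
    split_ifs with h1
    · simpa using h1
    · simpa using lt_of_le_of_ne (not_lt.1 h1) hne.symm
  · rintro ⟨p, q⟩ h
    have hne : σ.symm p ≠ σ.symm q := fun H => (mem_ltPairs.1 h).ne (σ.symm.injective H)
    dsimp only
    split_ifs with h1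
    · simpa using h1
    · simpa using lt_of_le_of_ne (not_lt.1 h1) hne.symm
  · rintro ⟨p, q⟩ h
    have h' : p < q := by simpa using h
    dsimp only
    split_ifs with h1 h2 h3 <;> simp_all [le_of_lt]
    exact absurd h3 (not_lt.2 h'.le)
  · rintro ⟨p, q⟩ h
    have h' : p < q := by simpa using h
    dsimp only
    split_ifs with h1 h2 h3 <;> simp_all [le_of_lt]
    exact absurd h3 (not_lt.2 h'.le)
  · rintro ⟨p, q⟩ h
    dsimp only
    split_ifs
    · rfl
    · exact hg _ _

theorem Equiv.Perm.sign_eq_prod_ltPairs_fin {n : ℕ} (σ : Equiv.Perm (Fin n)) :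
    σ.sign = ∏ p ∈ ltPairs (Fin n), if σ p.1 < σ p.2 then 1 else -1 := by
  rw [σ.sign_eq_prod_prod_Ioi, ltPairs, Finset.prod_filter, Fintype.prod_prod_type]
  refine Finset.prod_congr rfl fun i _ => ?_
  rw [← Finset.prod_filter]
  refine Finset.prod_congr ?_ fun _ _ => rfl
  ext; simp

/-- The sign of a permutation of a finite linear order counts its inversions. -/
theorem Equiv.Perm.sign_eq_prod_ltPairs (σ : Equiv.Perm E) :
    σ.sign = ∏ p ∈ ltPairs E, if σ p.1 < σ p.2 then 1 else -1 := by
  set o : Fin (Fintype.card E) ≃o E := Fintype.orderIsoFinOfCardEq E rfl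
  have h : σ.sign = (o.symm.toEquiv.permCongr σ).sign := by simp
  rw [h, Equiv.Perm.sign_eq_prod_ltPairs_fin]
  refine Finset.prod_nbij' (fun p => (o p.1, o p.2)) (fun p => (o.symm p.1, o.symm p.2))
    ?_ ?_ ?_ ?_ ?_ <;> simp [Equiv.permCongr_apply]

/-- Applied to half-edges and their vertices, this separates inversions inside a vertex from those
between two vertices. -/
theorem prod_ltPairs_eq_fiberwise (f : E → F) (g : E → E → M) :
    ∏ p ∈ ltPairs E, g p.1 p.2 =
      (∏ y, ∏ p ∈ ltPairs E with f p.1 = y ∧ f p.2 = y, g p.1 p.2) *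
        ∏ p ∈ ltPairs E with f p.1 ≠ f p.2, g p.1 p.2 := by
  rw [← Finset.prod_filter_mul_prod_filter_not (ltPairs E) fun p => f p.1 = f p.2]
  congr 1
  rw [← Finset.prod_fiberwise_of_maps_to (t := Finset.univ) (g := fun p : E × E => f p.1)
    fun _ _ => Finset.mem_univ _]
  refine Finset.prod_congr rfl fun y _ => Finset.prod_congr ?_ fun _ _ => rfl
  ext p
  simp only [Finset.mem_filter]
  constructor
  · rintro ⟨⟨h1, h2⟩, h3⟩
    exact ⟨h1, h3, h2 ▸ h3⟩
  · rintro ⟨h1, h2, h3⟩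
    exact ⟨⟨h1, h2.trans h3.symm⟩, h2⟩

/-- Since `r` is symmetric and sees only the fibers, each pair can be ordered by its values under
`f` instead of the order of `E`. Then every pair of fibers contributes as often as the product of
their cardinalities. -/
theorem prod_ltPairs_ne_fibers (f : E → F) (r : F → F → M) (hr : ∀ y z, r y z = r z y) :
    ∏ p ∈ ltPairs E with f p.1 ≠ f p.2, r (f p.1) (f p.2) =
      ∏ y ∈ ltPairs F, r y.1 y.2 ^
        ((Finset.univ.filter fun p => f p = y.1).card *
          (Finset.univ.filter fun p => f p = y.2).card) := by
  have key : ∏ p ∈ ltPairs E with f p.1 ≠ f p.2, r (f p.1) (f p.2) =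
      ∏ p : E × E with f p.1 < f p.2, r (f p.1) (f p.2) := by
    refine Finset.prod_bij'
      (fun p _ => if f p.1 < f p.2 then p else p.swap)
      (fun p _ => if p.1 < p.2 then p else p.swap) ?_ ?_ ?_ ?_ ?_
    · rintro ⟨p, q⟩ h
      simp only [Finset.mem_filter, mem_ltPairs] at h
      dsimp only
      split_ifs with h1
      · simpa using h1
      · simpa using lt_of_le_of_ne (not_lt.1 h1) h.2.symm
    · rintro ⟨p, q⟩ h
      simp only [Finset.mem_filter, Finset.mem_univ, true_and] at h
      have hpq : p ≠ q := by rintro rfl; exact lt_irrefl _ h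
      dsimp only
      split_ifs with h1
      · simpa [h1] using h.ne
      · simpa [lt_of_le_of_ne (not_lt.1 h1) hpq.symm] using h.ne'
    · rintro ⟨p, q⟩ h
      simp only [Finset.mem_filter, mem_ltPairs] at h
      dsimp only
      split_ifs with h1 h2 h3 <;> simp_all
      exact absurd h3 (not_lt.2 h.1.le)
    · rintro ⟨p, q⟩ h
      simp only [Finset.mem_filter, Finset.mem_univ, true_and] at h
      dsimp only
      split_ifs with h1 h2 <;> simp_all
      exact absurd h2 (not_lt.2 h.le)
    · rintro ⟨p, q⟩ h
      dsimp only
      split_ifs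
      · rfl
      · exact hr _ _
  rw [key, ← Finset.prod_fiberwise_of_maps_to (t := ltPairs F)
    (g := fun p : E × E => (f p.1, f p.2)) (by simp)]
  refine Finset.prod_congr rfl fun y hy => ?_
  rw [mem_ltPairs] at hy
  rw [Finset.prod_congr rfl (g := fun _ => r y.1 y.2), Finset.prod_const, ← Finset.card_product]
  · congr 2
    ext ⟨p, q⟩
    simp only [Finset.mem_filter, Finset.mem_univ, true_and, Finset.mem_product, Prod.ext_iff]
    constructor
    · exact fun h => h.2
    · exact fun h => ⟨by rw [h.1, h.2]; exact hy, h⟩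
  · rintro ⟨p, q⟩ h
    simp only [Finset.mem_filter, Finset.mem_univ, true_and, Prod.ext_iff] at h
    simp only [h.2]

end Inversions

section SortedTuple

variable {E F L k : Type*} [LinearOrder E] [LinearOrder F]

/-- The restriction of a labelling to a finite set, as a tuple in increasing order. -/
def sortedTuple (S : Finset E) (x : E → L) : Fin S.card → L := fun i => x (S.orderEmbOfFin rfl i)

theorem eval_sortedTuple_eq (T : (N : ℕ) → (Fin N → L) → k) (S : Finset E) (x : E → L) {N : ℕ}
    (hN : S.card = N) : T S.card (sortedTuple S x) = T N fun i => x (S.orderEmbOfFin hN i) := by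
  subst hN; rfl

/-- The increasing enumeration of a finite set is unique, so any explicit one may be used. This also
disposes of the dependence of the arity on `S.card`. -/
theorem eval_sortedTuple_eq_of_strictMono (T : (N : ℕ) → (Fin N → L) → k) (S : Finset E)
    (x : E → L) {N : ℕ} (hN : S.card = N) (f : Fin N → E) (hf : StrictMono f)
    (hfS : ∀ i, f i ∈ S) : T S.card (sortedTuple S x) = T N fun i => x (f i) := by
  rw [eval_sortedTuple_eq T S x hN, ← Finset.orderEmbOfFin_unique hN hfS hf]

theorem eval_sortedTuple_congr (T : (N : ℕ) → (Fin N → L) → k) (S : Finset E) {x x' : E → L}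
    (h : ∀ p ∈ S, x p = x' p) : T S.card (sortedTuple S x) = T S.card (sortedTuple S x') := by
  congr 1
  funext i
  exact h _ (Finset.orderEmbOfFin_mem _ _ _)

/-- Tensors whose arguments anticommute. -/
def TensorAntisymm [CommRing k] (T : (N : ℕ) → (Fin N → L) → k) : Prop :=
  ∀ (N : ℕ) (π : Equiv.Perm (Fin N)) (v : Fin N → L),
    T N (fun i => v (π i)) = ((Equiv.Perm.sign π : ℤ) : k) * T N v

/-- A bijection changes an antisymmetric tensor, evaluated along a finite set, by the parity of the
number of inversions inside of this set. -/
theorem TensorAntisymm.eval_sortedTuple [Fintype E] [CommRing k] {T : (N : ℕ) → (Fin N → L) → k}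
    (hT : TensorAntisymm T) (σ : E ≃ F) (S : Finset E) (S' : Finset F) (hS : ∀ p, σ p ∈ S' ↔ p ∈ S)
    (x : F → L) :
    T S'.card (sortedTuple S' x) =
      (((∏ p ∈ ltPairs E with p.1 ∈ S ∧ p.2 ∈ S, if σ p.1 < σ p.2 then 1 else -1 : ℤˣ) : ℤ) : k) *
        T S.card (sortedTuple S (x ∘ σ)) := by
  have hc : S'.card = S.card := by
    have : S' = S.map σ.toEmbedding := by
      ext q
      obtain ⟨p, rfl⟩ := σ.surjective q
      rw [hS]
      simp
    rw [this, Finset.card_map]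
  -- `π` compares the image under `σ` of the increasing enumeration of `S` with the increasing
  -- enumeration of `S'`; its inversions are those of `σ` inside `S`.
  let π : Equiv.Perm (Fin S.card) := (S.orderIsoOfFin rfl).toEquiv.trans
    ((σ.subtypeEquiv fun p => (hS p).symm).trans (S'.orderIsoOfFin hc).symm.toEquiv)
  have hπ : ∀ i, S'.orderEmbOfFin hc (π i) = σ (S.orderEmbOfFin rfl i) := fun i => by
    rw [← Finset.coe_orderIsoOfFin_apply]
    simp [π]
  have hsgn : π.sign = ∏ p ∈ ltPairs E with p.1 ∈ S ∧ p.2 ∈ S, if σ p.1 < σ p.2 then 1 else -1 := by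
    rw [Equiv.Perm.sign_eq_prod_ltPairs]
    refine Finset.prod_bij (fun p _ => (S.orderEmbOfFin rfl p.1, S.orderEmbOfFin rfl p.2))
      ?_ ?_ ?_ ?_
    · rintro ⟨i, j⟩ h
      simpa [Finset.orderEmbOfFin_mem] using h
    · rintro ⟨i, j⟩ _ ⟨i', j'⟩ _ h
      simpa using h
    · rintro ⟨p, q⟩ h
      simp only [Finset.mem_filter, mem_ltPairs] at h
      have hp : p ∈ Set.range (S.orderEmbOfFin rfl) := by
        rw [Finset.range_orderEmbOfFin]; exact h.2.1
      have hq : q ∈ Set.range (S.orderEmbOfFin rfl) := by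
        rw [Finset.range_orderEmbOfFin]; exact h.2.2
      obtain ⟨i, rfl⟩ := hp
      obtain ⟨j, rfl⟩ := hq
      exact ⟨(i, j), by simpa using h.1, rfl⟩
    · rintro ⟨i, j⟩ h
      simp only [← hπ, OrderEmbedding.lt_iff_lt]
  rw [eval_sortedTuple_eq T S' x hc, ← hsgn]
  have h1 := hT S.card π fun i => x (S'.orderEmbOfFin hc i)
  have h2 : (fun i => x (S'.orderEmbOfFin hc (π i))) = sortedTuple S (x ∘ σ) := by
    funext i
    rw [hπ]; rfl
  rw [h2] at h1
  rw [h1, ← mul_assoc, ← Int.cast_mul, ← Units.val_mul, Int.units_mul_self]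
  simp

end SortedTuple

/-! ### Cyclic cochains: antisymmetry in all legs, and the cocycle condition as a symmetric
quadratic relation -/

section CyclicCochains

variable {k : Type*} [Field k] {L : Type*} [LieRing L] [LieAlgebra k L]

theorem isCyclicCochain_zero (h : LinearMap.BilinForm k L) (n : ℕ) :
    IsCyclicCochain h (0 : L [⋀^Fin n]→ₗ[k] L) := fun v => by simp

theorem isCyclicCochain_lieFamily {h : LinearMap.BilinForm k L} (hinv : h.lieInvariant L)
    (m : ℕ) : IsCyclicCochain h (lieFamily k L m) := by
  rcases eq_or_ne m 2 with rfl | hm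
  · intro v
    have h1 := hinv (v 1) (v 0) (v 2)
    rw [← lie_skew (v 1) (v 0)] at h1
    simp only [map_neg, LinearMap.neg_apply, neg_inj] at h1
    simp only [lieFamily, Pi.single_eq_same, lieBracketCochain]
    simpa [Fin.last] using h1
  · rw [lieFamily, Pi.single_eq_of_ne hm]
    exact isCyclicCochain_zero h m

theorem isCyclicCochain_single {h : LinearMap.BilinForm k L} {n : ℕ} {φ : L [⋀^Fin n]→ₗ[k] L}
    (hcyc : IsCyclicCochain h φ) (m : ℕ) :
    IsCyclicCochain h ((Pi.single n φ : CochainFamily k L) m) := by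
  rcases eq_or_ne m n with rfl | hm
  · rwa [Pi.single_eq_same]
  · rw [Pi.single_eq_of_ne hm]
    exact isCyclicCochain_zero h m

/-- Two neighbouring legs inside `f` anticommute because `f` is alternating. Only the pair
containing the outer leg needs cyclicity, which rotates it into `f`. -/
theorem IsCyclicCochain.map_swap_castSucc_succ {h : LinearMap.BilinForm k L} (hsymm : h.IsSymm)
    {m : ℕ} {f : L [⋀^Fin m]→ₗ[k] L} (hf : IsCyclicCochain h f) (i : Fin m) (v : Fin (m + 1) → L) :
    h (f fun t => v (Equiv.swap i.castSucc i.succ t.castSucc))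
        (v (Equiv.swap i.castSucc i.succ (Fin.last m))) =
      -h (f fun t => v t.castSucc) (v (Fin.last m)) := by
  by_cases hi : i.succ = Fin.last m
  -- For `m = 1` a rotation cannot bring both legs inside `f`. Here cyclicity reads `h (f v₀) v₁ =
  -- -h v₀ (f v₁)`, and the symmetry of `h` finishes.
  · by_cases h0 : (i : ℕ) = 0
    · obtain rfl : m = 1 := by
        have := congrArg Fin.val hi
        simp only [Fin.val_succ, Fin.val_last] at this
        omega
      obtain rfl : i = 0 := Subsingleton.elim _ _
      have h1 := hf v
      simp only [Fin.isValue, pow_one, neg_mul, one_mul] at h1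
      rw [h1, neg_neg, hsymm.eq (v 0)]
      congr 2
      refine congrArg f (funext fun t => ?_)
      rw [Subsingleton.elim t 0]
      simp
    -- With the predecessor `j` of `i`, rotation turns the legs `i.castSucc` and `i.succ` into the
    -- arguments `j` and `i` of `f`, and leg `0` becomes the outer one.
    · obtain ⟨j, hj⟩ : ∃ j : Fin m, j.succ = i.castSucc :=
        ⟨⟨i - 1, by omega⟩, by ext; simp; omega⟩
      have hne : j ≠ i := by
        rintro rfl
        have := congrArg Fin.val hj
        simp at this
      rw [← hj, hf fun t => v (Equiv.swap j.succ i.succ t), hf v]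
      have e1 : (fun t : Fin m => v (Equiv.swap j.succ i.succ t.succ)) =
          (fun t : Fin m => v t.succ) ∘ Equiv.swap j i := by
        funext t
        simp only [Function.comp]
        rw [(Fin.succ_injective m).swap_apply]
      rw [e1, f.map_swap _ hne, Equiv.swap_apply_of_ne_of_ne (Fin.succ_ne_zero j).symm
        (Fin.succ_ne_zero i).symm]
      simp
  · obtain ⟨j, hj⟩ := Fin.exists_castSucc_eq.2 hi
    have hne : i ≠ j := by
      rintro rfl
      have := congrArg Fin.val hj
      simp at this
    rw [← hj]
    have e1 : (fun t : Fin m => v (Equiv.swap i.castSucc j.castSucc t.castSucc)) =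
        (fun t : Fin m => v t.castSucc) ∘ Equiv.swap i j := by
      funext t
      simp only [Function.comp]
      rw [(Fin.castSucc_injective m).swap_apply]
    rw [e1, f.map_swap _ hne, Equiv.swap_apply_of_ne_of_ne (Fin.castSucc_lt_last i).ne'
      (Fin.castSucc_lt_last j).ne']
    simp

/-- The vertex tensors of cyclic cochains are antisymmetric in all of their legs. -/
theorem tensorAntisymm_vertexTensor {h : LinearMap.BilinForm k L} (hsymm : h.IsSymm)
    {c : CochainFamily k L} (hc : ∀ m, IsCyclicCochain h (c m)) :
    TensorAntisymm (vertexTensor h c) := by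
  intro N π
  cases N with
  | zero => intro v; simp [vertexTensor]
  | succ m =>
    have hπ : π ∈ Submonoid.closure
        (Set.range fun i : Fin m => Equiv.swap i.castSucc i.succ) := by
      rw [Equiv.Perm.mclosure_swap_castSucc_succ]; trivial
    induction hπ using Submonoid.closure_induction with
    | mem σ hσ =>
      obtain ⟨i, rfl⟩ := hσ
      intro v
      rw [Equiv.Perm.sign_swap (Fin.castSucc_lt_succ).ne]
      simpa [vertexTensor] using (hc m).map_swap_castSucc_succ hsymm i v
    | one => intro v; simp
    | mul σ τ _ _ hσ hτ =>
      intro v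
      have h1 := hτ fun i => v (σ i)
      simp only [Equiv.Perm.mul_apply, Equiv.Perm.sign_mul, Units.val_mul, Int.cast_mul]
      rw [h1, hσ v]
      ring

/-- The Lie bracket is a cocycle with coefficients in the adjoint module. -/
theorem isLieCocycle_lieBracketCochain : IsLieCocycle (lieBracketCochain k L) := by
  intro v
  change (∑ i : Fin 3, (-1 : k) ^ (i : ℕ) • ⁅v i, ⁅v (i.succAbove 0), v (i.succAbove 1)⁆⁆) +
    (∑ j : Fin 3, ∑ i : Fin 2, if i.castSucc < j then (-1 : k) ^ ((i : ℕ) + (j : ℕ)) •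
      ⁅⁅v i.castSucc, v j⁆, v (j.succAbove (i.succAbove 0))⁆ else 0) = 0
  simp only [Fin.sum_univ_three, Fin.sum_univ_two,
    show (0 : Fin 3).succAbove 0 = 1 from rfl, show (0 : Fin 3).succAbove 1 = 2 from rfl,
    show (1 : Fin 3).succAbove 0 = 0 from rfl, show (1 : Fin 3).succAbove 1 = 2 from rfl,
    show (2 : Fin 3).succAbove 0 = 0 from rfl, show (2 : Fin 3).succAbove 1 = 1 from rfl,
    show (0 : Fin 2).succAbove 0 = 1 from rfl, show (1 : Fin 2).succAbove 0 = 0 from rfl]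
  simp +decide [-lie_skew]
  rw [← lie_skew (v 2) (v 1), ← lie_skew (v 1) (v 0), ← lie_skew (v 2) (v 0)]
  have h1 := lie_jacobi (v 0) (v 1) (v 2)
  rw [← lie_skew (v 2) (v 0), lie_neg] at h1
  simp only [lie_neg]
  rw [← neg_eq_zero, ← h1]
  abel

/-- The cocycle condition for a cyclic cochain `f`, paired with a further vector: a quadratic
relation between `f` and the bracket that is symmetric in all arguments. -/
theorem IsLieCocycle.sum_pairs_eq_zero {h : LinearMap.BilinForm k L} (hsymm : h.IsSymm)
    (hinv : h.lieInvariant L) {m : ℕ} {f : L [⋀^Fin (m + 1)]→ₗ[k] L} (hcyc : IsCyclicCochain h f)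
    (hcoc : IsLieCocycle f) (x : Fin (m + 3) → L) :
    ∑ j : Fin (m + 3), ∑ i : Fin (m + 2), (if i.castSucc < j then
      (-1 : k) ^ ((i : ℕ) + (j : ℕ)) *
        h (f (i.removeNth (j.removeNth x))) ⁅x i.castSucc, x j⁆ else 0) = 0 := by
  set z := x (Fin.last _) with hz
  set v : Fin (m + 2) → L := fun t => x t.castSucc with hv
  -- The cocycle condition is paired with the last vector `z`; the factor `(-1) ^ (m + 1)` is the
  -- sign of cyclicity. Pairs with `j` last come from the terms `[vᵢ, f(…)]` by invariance of `h`,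
  -- the remaining pairs from the terms `f([vᵢ, vⱼ], …)` by cyclicity.
  have h0 : (-1 : k) ^ (m + 1) * h (lieCoboundary f v) z = 0 := by simp [hcoc v]
  refine Eq.trans ?_ h0
  simp only [lieCoboundary, map_add, LinearMap.add_apply, map_sum, LinearMap.coe_sum,
    Finset.sum_apply, map_smul, LinearMap.smul_apply, smul_eq_mul, mul_add]
  rw [Fin.sum_univ_castSucc, add_comm, Finset.mul_sum, Finset.mul_sum]
  have hlast : (Fin.last (m + 2)).removeNth x = v := by
    funext t; simp [Fin.removeNth, hv]
  congr 1
  · refine Finset.sum_congr rfl fun i _ => ?_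
    rw [if_pos (Fin.castSucc_lt_last i), hlast, ← hz, Fin.val_last]
    have h1 : h ⁅v i, f (i.removeNth v)⁆ z = -h (f (i.removeNth v)) ⁅v i, z⁆ := hinv _ _ _
    rw [h1]
    ring
  · refine Finset.sum_congr rfl fun j _ => ?_
    rw [Fin.sum_univ_castSucc, if_neg (by simp [Fin.le_last]), add_zero, Finset.mul_sum]
    refine Finset.sum_congr rfl fun i _ => ?_
    by_cases hij : i.castSucc < j
    · rw [if_pos (Fin.castSucc_lt_castSucc_iff.2 hij), if_pos hij, map_smul, LinearMap.smul_apply, smul_eq_mul]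
      have h1 := hcyc (Fin.cons ⁅v i.castSucc, v j⁆ (Fin.snoc (i.removeNth (j.removeNth v)) z))
      have e1 : (fun t : Fin (m + 1) => (Fin.cons ⁅v i.castSucc, v j⁆
          (Fin.snoc (i.removeNth (j.removeNth v)) z : Fin (m + 1) → L) : Fin (m + 2) → L)
            t.castSucc) = Fin.cons ⁅v i.castSucc, v j⁆ (i.removeNth (j.removeNth v)) := by
        funext t
        refine Fin.cases ?_ (fun t => ?_) t
        · simp
        · rw [← Fin.succ_castSucc, Fin.cons_succ, Fin.cons_succ, Fin.snoc_castSucc]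
      have e2 : (Fin.snoc (i.removeNth (j.removeNth v)) z : Fin (m + 1) → L) =
          i.castSucc.removeNth (j.castSucc.removeNth x) := by
        funext t
        refine Fin.lastCases ?_ (fun t => ?_) t
        · rw [Fin.snoc_last]
          simp [Fin.removeNth, hz]
        · rw [Fin.snoc_castSucc]
          simp [Fin.removeNth, hv]
      rw [e1] at h1
      simp only [Fin.cons_zero, Fin.cons_succ, ← Fin.succ_last] at h1
      rw [Fin.snoc_last, e2] at h1
      rw [h1, hsymm.eq, Fin.val_castSucc, Fin.val_castSucc]
      have h2 : (-1 : k) ^ (m + 1) * (-1) ^ (m + 1) = 1 := by rw [← mul_pow]; simp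
      change _ * h ⁅v i.castSucc, v j⁆ _ = _
      linear_combination (-(-1 : k) ^ ((i : ℕ) + (j : ℕ)) *
        h ⁅v i.castSucc, v j⁆ (f (i.castSucc.removeNth (j.castSucc.removeNth x)))) * h2
    · rw [if_neg (mt Fin.castSucc_lt_castSucc_iff.1 hij), if_neg hij]
      simp


end CyclicCochains

/-! ### Shuffle signs of splittings of a finite ordered set -/

section Splittings

variable {E F M : Type*} [LinearOrder E] [LinearOrder F]

/-- The sign of the shuffle that lists a set as `A` followed by `B`. -/
def splitSign (A B : Finset E) : ℤˣ := ∏ a ∈ A, ∏ b ∈ B, if b < a then -1 else 1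

/-- Every pair in `A × B` is an inversion for exactly one of the two listings. -/
theorem splitSign_comm (A B : Finset E) (hAB : Disjoint A B) :
    splitSign B A = splitSign A B * (-1) ^ (A.card * B.card) := by
  rw [splitSign, Finset.prod_comm, splitSign]
  have h1 : ∀ a ∈ A, ∏ b ∈ B, (if a < b then -1 else 1 : ℤˣ) =
      (∏ b ∈ B, if b < a then -1 else 1) * (-1) ^ B.card := fun a ha => by
    rw [← Finset.prod_const, ← Finset.prod_mul_distrib]
    refine Finset.prod_congr rfl fun b hb => ?_
    have hne : a ≠ b := fun h => Finset.disjoint_left.1 hAB ha (h ▸ hb)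
    rcases lt_or_gt_of_ne hne with h | h
    · simp [h, h.not_gt]
    · simp [h, h.not_gt]
  rw [Finset.prod_congr rfl h1, Finset.prod_mul_distrib, Finset.prod_const, ← pow_mul,
    mul_comm B.card]

theorem splitSign_map (o : E ↪o F) (A B : Finset E) :
    splitSign (A.map o.toEmbedding) (B.map o.toEmbedding) = splitSign A B := by
  simp [splitSign, Finset.prod_map]

theorem prod_ite_lt_fin {m : ℕ} (b : Fin (m + 1)) :
    ∏ a : Fin (m + 1), (if b < a then -1 else 1 : ℤˣ) = (-1) ^ (m + (b : ℕ)) := by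
  rw [← Finset.prod_filter, Finset.prod_const]
  have : (Finset.univ.filter fun a => b < a) = Finset.Ioi b := by ext; simp
  rw [this, Fin.card_Ioi, neg_one_pow_congr]
  have := b.is_le
  simp only [Nat.even_iff]
  omega

theorem splitSign_compl_singleton {m : ℕ} (i : Fin (m + 1)) :
    splitSign {i}ᶜ {i} = (-1) ^ (m + (i : ℕ)) := by
  rw [← prod_ite_lt_fin, splitSign]
  refine (Finset.prod_subset (Finset.subset_univ _) ?_).trans ?_
  · intro a _ ha
    obtain rfl : a = i := by simpa using ha
    simp
  · simp

/-- Letting the first entry run over all indices gives `(-1)^(m+i) (-1)^(m+j)`. The surplus is the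
single inversion inside `{i, j}`, which accounts for the minus sign. -/
theorem splitSign_compl_pair {m : ℕ} {i j : Fin (m + 1)} (hij : i < j) :
    splitSign {i, j}ᶜ {i, j} = -(-1) ^ ((i : ℕ) + (j : ℕ)) := by
  have h1 : splitSign {i, j}ᶜ {i, j} * splitSign {i, j} {i, j} =
      ∏ a : Fin (m + 1), ∏ b ∈ ({i, j} : Finset (Fin (m + 1))), (if b < a then -1 else 1 : ℤˣ) := by
    rw [splitSign, splitSign, mul_comm, Finset.prod_mul_prod_compl]
  have h2 : splitSign {i, j} {i, j} = -1 := by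
    simp [splitSign, Finset.prod_pair hij.ne, hij, hij.not_gt]
  rw [h2, Finset.prod_comm, Finset.prod_pair hij.ne, prod_ite_lt_fin, prod_ite_lt_fin] at h1
  rw [mul_neg_one, neg_eq_iff_eq_neg, ← pow_add] at h1
  rw [h1, neg_inj, neg_one_pow_congr]
  simp only [Nat.even_iff]
  omega

theorem sum_powersetCard_two [AddCommMonoid M] {m : ℕ} (G : Finset (Fin (m + 1)) → M) :
    ∑ B ∈ Finset.powersetCard 2 Finset.univ, G B =
      ∑ j : Fin (m + 1), ∑ i : Fin m, if i.castSucc < j then G {i.castSucc, j} else 0 := by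
  rw [← Fintype.sum_prod_type' (f := fun (j : Fin (m + 1)) (i : Fin m) =>
    if i.castSucc < j then G {i.castSucc, j} else 0), ← Finset.sum_filter]
  symm
  refine Finset.sum_bij (fun x _ => {x.2.castSucc, x.1}) ?_ ?_ ?_ ?_
  · rintro ⟨j, i⟩ h
    simp only [Finset.mem_filter, Finset.mem_univ, true_and] at h
    simp [Finset.card_pair h.ne]
  · rintro ⟨j, i⟩ h ⟨j', i'⟩ h' H
    simp only [Finset.mem_filter, Finset.mem_univ, true_and] at h h'
    have h1 : i.castSucc ∈ ({i'.castSucc, j'} : Finset _) := H ▸ by simp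
    have h2 : j ∈ ({i'.castSucc, j'} : Finset _) := H ▸ by simp
    have h3 : j' ∈ ({i.castSucc, j} : Finset _) := H ▸ by simp
    simp only [Finset.mem_insert, Finset.mem_singleton, Fin.ext_iff] at h1 h2 h3
    simp only [Fin.lt_def] at h h'
    simp only [Prod.mk.injEq, Fin.ext_iff]
    simp only [Fin.val_castSucc] at *
    omega
  · intro B hB
    obtain ⟨a, b, hab, rfl⟩ := Finset.card_eq_two.1 (Finset.mem_powersetCard.1 hB).2
    rcases lt_or_gt_of_ne hab with h | h
    · obtain ⟨i, rfl⟩ := Fin.exists_castSucc_eq.2 (h.trans_le (Fin.le_last _)).ne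
      exact ⟨(b, i), by simpa using h, rfl⟩
    · obtain ⟨i, rfl⟩ := Fin.exists_castSucc_eq.2 (h.trans_le (Fin.le_last _)).ne
      exact ⟨(a, i), by simpa using h, Finset.pair_comm _ _⟩
  · intros; rfl

theorem strictMono_succAbove_succAbove {m : ℕ} (i : Fin (m + 1)) (j : Fin (m + 2)) :
    StrictMono fun t : Fin m => j.succAbove (i.succAbove t) :=
  (Fin.strictMono_succAbove j).comp (Fin.strictMono_succAbove i)

theorem succAbove_succAbove_mem_compl {m : ℕ} {i : Fin (m + 1)} {j : Fin (m + 2)}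
    (hij : i.castSucc < j) (t : Fin m) :
    j.succAbove (i.succAbove t) ∈ ({i.castSucc, j}ᶜ : Finset (Fin (m + 2))) := by
  simp only [Finset.mem_compl, Finset.mem_insert, Finset.mem_singleton, not_or]
  refine ⟨fun h => ?_, Fin.succAbove_ne _ _⟩
  rw [← Fin.succAbove_of_castSucc_lt j i hij] at h
  exact Fin.succAbove_ne _ _ (Fin.succAbove_right_injective h)

end Splittings

/-! ### The quadratic relation as a sum over splittings -/

section SplittingRelation

variable {k : Type*} [Field k] {L : Type*} [LieRing L] [LieAlgebra k L]
variable {E F : Type*} [LinearOrder E] [LinearOrder F]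

theorem lieFamily_apply_of_ne {N : ℕ} (hN : N ≠ 2) : lieFamily k L N = 0 :=
  Pi.single_eq_of_ne hN _

theorem lieFamily_two (v : Fin 2 → L) : lieFamily k L 2 v = ⁅v 0, v 1⁆ := by
  simp [lieFamily, lieBracketCochain]

theorem single_apply_of_ne {n N : ℕ} (φ : L [⋀^Fin n]→ₗ[k] L) (hN : N ≠ n) :
    (Pi.single n φ : CochainFamily k L) N = 0 :=
  Pi.single_eq_of_ne hN _

theorem lieFamily_sortedTuple_pair {N : ℕ} {i j : Fin N} (hij : i < j) (x : Fin N → L) :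
    lieFamily k L _ (sortedTuple {i, j} x) = ⁅x i, x j⁆ := by
  have hf : StrictMono ![i, j] := by
    intro a b hab
    fin_cases a <;> fin_cases b <;> simp_all
  rw [eval_sortedTuple_eq_of_strictMono (fun N v => lieFamily k L N v) _ x
    (Finset.card_pair hij.ne) ![i, j] hf (by intro a; fin_cases a <;> simp)]
  exact lieFamily_two _

theorem sortedTuple_map (c : CochainFamily k L) (o : E ↪o F) (S : Finset E) (x : F → L) :
    c _ (sortedTuple (S.map o.toEmbedding) x) = c _ (sortedTuple S (x ∘ o)) :=
  eval_sortedTuple_eq_of_strictMono (fun N v => c N v) _ x (Finset.card_map _)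
    (fun i => o (S.orderEmbOfFin rfl i)) (o.strictMono.comp (OrderEmbedding.strictMono _))
    fun i => by simp [Finset.orderEmbOfFin_mem]

/-- The term of the quadratic relation for a pair of cochains that is given by the splitting
`S = (S \ B) ⊔ B`. -/
def splitTerm (h : LinearMap.BilinForm k L) (c c' : CochainFamily k L) (x : E → L)
    (A B : Finset E) : k :=
  ((splitSign A B : ℤ) : k) * h (c _ (sortedTuple A x)) (c' _ (sortedTuple B x))

theorem splitTerm_swap {h : LinearMap.BilinForm k L} (hsymm : h.IsSymm) (c c' : CochainFamily k L)
    (x : E → L) (A B : Finset E) (hAB : Disjoint A B) :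
    splitTerm h c c' x B A = (-1) ^ (A.card * B.card) * splitTerm h c' c x A B := by
  rw [splitTerm, splitTerm, splitSign_comm A B hAB, hsymm.eq]
  push_cast
  ring

/-- Both families live in a single degree, so sums over all subsets may be enlarged or cut down
freely. -/
theorem card_of_splitTerm_ne_zero {h : LinearMap.BilinForm k L} {n : ℕ} {φ : L [⋀^Fin n]→ₗ[k] L}
    {x : E → L} {A B : Finset E} (hne : splitTerm h (Pi.single n φ) (lieFamily k L) x A B ≠ 0) :
    A.card = n ∧ B.card = 2 := by
  constructor
  · by_contra hA
    exact hne (by simp [splitTerm, single_apply_of_ne φ hA])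
  · by_contra hB
    exact hne (by simp [splitTerm, lieFamily_apply_of_ne hB])

theorem IsLieCocycle.sum_splitTerm_fin {h : LinearMap.BilinForm k L} (hsymm : h.IsSymm)
    (hinv : h.lieInvariant L) {m : ℕ} {φ : L [⋀^Fin (m + 1)]→ₗ[k] L} (hcyc : IsCyclicCochain h φ)
    (hcoc : IsLieCocycle φ) (x : Fin (m + 3) → L) :
    ∑ B ∈ Finset.powersetCard 2 Finset.univ,
      splitTerm h (Pi.single (m + 1) φ) (lieFamily k L) x Bᶜ B = 0 := by
  rw [sum_powersetCard_two, ← neg_eq_zero, ← Finset.sum_neg_distrib]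
  refine Eq.trans ?_ (hcoc.sum_pairs_eq_zero hsymm hinv hcyc x)
  refine Finset.sum_congr rfl fun j _ => ?_
  rw [← Finset.sum_neg_distrib]
  refine Finset.sum_congr rfl fun i _ => ?_
  split_ifs with hij
  · have hcard : ({i.castSucc, j}ᶜ : Finset (Fin (m + 3))).card = m + 1 := by
      rw [Finset.card_compl, Finset.card_pair hij.ne, Fintype.card_fin]
      omega
    rw [splitTerm, lieFamily_sortedTuple_pair hij, splitSign_compl_pair hij,
      eval_sortedTuple_eq_of_strictMono
        (fun N v => (Pi.single (m + 1) φ : CochainFamily k L) N v) _ x hcard _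
        (strictMono_succAbove_succAbove i j) (succAbove_succAbove_mem_compl hij)]
    simp only [Pi.single_eq_same]
    push_cast
    rw [neg_mul, neg_neg]
    rfl
  · simp

/-- The quadratic relation between a cyclic cocycle and the bracket, as a sum over all splittings of
a finite set of arguments. -/
theorem IsLieCocycle.sum_splitTerm {h : LinearMap.BilinForm k L} (hsymm : h.IsSymm)
    (hinv : h.lieInvariant L) {n : ℕ} (hn : 1 ≤ n) {φ : L [⋀^Fin n]→ₗ[k] L}
    (hcyc : IsCyclicCochain h φ) (hcoc : IsLieCocycle φ) (S : Finset E) (x : E → L) :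
    ∑ B ∈ S.powerset, splitTerm h (Pi.single n φ) (lieFamily k L) x (S \ B) B = 0 := by
  obtain ⟨m, rfl⟩ : ∃ m, n = m + 1 := ⟨n - 1, by omega⟩
  by_cases hS : S.card = m + 3
  · have h1 : ∑ B ∈ Finset.powersetCard 2 S,
        splitTerm h (Pi.single (m + 1) φ) (lieFamily k L) x (S \ B) B = 0 := by
      -- The increasing enumeration transports the relation from `Fin (m + 3)` to `S` without
      -- changing shuffle signs.
      have hmap : S = Finset.univ.map (S.orderEmbOfFin hS).toEmbedding := by
        rw [Finset.map_orderEmbOfFin_univ]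
      conv_lhs => rw [hmap, Finset.powersetCard_map, Finset.sum_map]
      rw [← hcoc.sum_splitTerm_fin hsymm hinv hcyc (x ∘ S.orderEmbOfFin hS)]
      refine Finset.sum_congr rfl fun B _ => ?_
      rw [RelEmbedding.coe_toEmbedding, Finset.mapEmbedding_apply, ← Finset.map_sdiff,
        ← Finset.compl_eq_univ_sdiff, splitTerm, splitTerm, splitSign_map, sortedTuple_map,
        sortedTuple_map]
    rw [← h1]
    symm
    refine Finset.sum_subset (fun B hB => ?_) fun B hB hB' => ?_
    · exact Finset.mem_powerset.2 (Finset.mem_powersetCard.1 hB).1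
    · by_contra hne
      exact hB' (Finset.mem_powersetCard.2
        ⟨Finset.mem_powerset.1 hB, (card_of_splitTerm_ne_zero hne).2⟩)
  · refine Finset.sum_eq_zero fun B hB => ?_
    by_contra hne
    have h1 := card_of_splitTerm_ne_zero hne
    have h2 := Finset.card_sdiff_add_card_eq_card (Finset.mem_powerset.1 hB)
    omega

end SplittingRelation

/-! ### The `L∞` relations of `l + t φ` -/

section InfinitesimalDeformation

variable {k : Type*} [Field k] {L : Type*} [LieRing L] [LieAlgebra k L]

theorem prod_orderEmbOfFin {E M : Type*} [LinearOrder E] [CommMonoid M] {A : Finset E} {q : ℕ}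
    (hA : A.card = q) (f : E → M) : ∏ i, f (A.orderEmbOfFin hA i) = ∏ a ∈ A, f a := by
  conv_rhs => rw [← Finset.map_orderEmbOfFin_univ A hA]
  rw [Finset.prod_map]
  rfl

/-- The permutation increases on each of the two blocks, so all its inversions are between the
blocks. -/
theorem sign_finSumEquivOfFinset {q p : ℕ} {A : Finset (Fin (q + p))} (hA : A.card = q)
    (hA' : Aᶜ.card = p) :
    Equiv.Perm.sign (finSumFinEquiv.symm.trans (finSumEquivOfFinset hA hA')) = splitSign A Aᶜ := by
  set σ : Equiv.Perm (Fin (q + p)) := finSumFinEquiv.symm.trans (finSumEquivOfFinset hA hA') with hσ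
  have hl : ∀ i : Fin q, σ (Fin.castAdd p i) = A.orderEmbOfFin hA i := fun i => by simp [hσ]
  have hr : ∀ i : Fin p, σ (Fin.natAdd q i) = Aᶜ.orderEmbOfFin hA' i := fun i => by simp [hσ]
  rw [Equiv.Perm.sign_eq_prod_ltPairs_fin, ltPairs, Finset.prod_filter, Fintype.prod_prod_type,
    Fin.prod_univ_add]
  have h1 : ∀ i j : Fin q, Fin.castAdd p i < Fin.castAdd p j ↔ i < j := fun i j => Iff.rfl
  have h2 : ∀ (i : Fin q) (j : Fin p), Fin.castAdd p i < Fin.natAdd q j := fun i j => by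
    simp only [Fin.lt_def, Fin.val_castAdd, Fin.val_natAdd]; omega
  have h3 : ∀ i j : Fin p, Fin.natAdd q i < Fin.natAdd q j ↔ i < j := fun i j => by
    simp only [Fin.lt_def, Fin.val_natAdd]; omega
  have h4 : ∀ (n : ℕ) (i j : Fin n), (if i < j then if i < j then 1 else -1 else 1 : ℤˣ) = 1 :=
    fun n i j => by split_ifs <;> rfl
  simp only [Fin.prod_univ_add, hl, hr, h1, h2, h3, (h2 _ _).not_gt, OrderEmbedding.lt_iff_lt, h4,
    if_true, if_false, Finset.prod_const_one, one_mul, mul_one]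
  rw [splitSign, ← prod_orderEmbOfFin hA]
  refine Finset.prod_congr rfl fun i _ => ?_
  rw [← prod_orderEmbOfFin hA']
  refine Finset.prod_congr rfl fun j _ => ?_
  have hne : A.orderEmbOfFin hA i ≠ Aᶜ.orderEmbOfFin hA' j := fun h =>
    (Finset.mem_compl.1 (Finset.orderEmbOfFin_mem Aᶜ hA' j))
      (h ▸ Finset.orderEmbOfFin_mem A hA i)
  rcases lt_or_gt_of_ne hne with h | h
  · rw [if_pos h, if_neg h.not_gt]
  · rw [if_pos h, if_neg h.not_gt]

/-- The composition of two members of families of cochains that is given by the shuffle `A`, `B` of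
the arguments. -/
def compTerm {E : Type*} [LinearOrder E] (c c' : CochainFamily k L) (v : E → L) (A B : Finset E) :
    L :=
  ((splitSign A B : ℤ) : k) •
    c (B.card + 1) (Fin.cons (c' A.card (sortedTuple A v)) (sortedTuple B v))

theorem compTerm_eq {E : Type*} [LinearOrder E] (c c' : CochainFamily k L) (v : E → L)
    (A B : Finset E) {q p : ℕ} (hA : A.card = q) (hB : B.card = p) :
    compTerm c c' v A B = ((splitSign A B : ℤ) : k) •
      c (p + 1) (Fin.cons (c' q fun i => v (A.orderEmbOfFin hA i))
        fun i => v (B.orderEmbOfFin hB i)) := by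
  subst hA hB
  rfl

/-- The sum over the unshuffles, as a sum over the subsets of the set of arguments. -/
theorem unshuffleComp_eq_sum_powersetCard (c c' : CochainFamily k L) (q p : ℕ)
    (v : Fin (q + p) → L) :
    unshuffleComp (c (p + 1)) (c' q) v =
      ∑ A ∈ Finset.powersetCard q Finset.univ, compTerm c c' v A Aᶜ := by
  symm
  have hc : ∀ A ∈ Finset.powersetCard q (Finset.univ : Finset (Fin (q + p))),
      A.card = q ∧ Aᶜ.card = p := fun A hA => by
    have h1 := (Finset.mem_powersetCard.1 hA).2
    refine ⟨h1, ?_⟩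
    rw [Finset.card_compl, h1, Fintype.card_fin]
    omega
  have hl : ∀ {A : Finset (Fin (q + p))} (h1 : A.card = q) (h2 : Aᶜ.card = p) (i : Fin q),
      finSumFinEquiv.symm.trans (finSumEquivOfFinset h1 h2) (Fin.castAdd p i) =
        A.orderEmbOfFin h1 i := fun h1 h2 i => by simp
  have hr : ∀ {A : Finset (Fin (q + p))} (h1 : A.card = q) (h2 : Aᶜ.card = p) (i : Fin p),
      finSumFinEquiv.symm.trans (finSumEquivOfFinset h1 h2) (Fin.natAdd q i) =
        Aᶜ.orderEmbOfFin h2 i := fun h1 h2 i => by simp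
  refine Finset.sum_bij (fun A hA => finSumFinEquiv.symm.trans
    (finSumEquivOfFinset (hc A hA).1 (hc A hA).2)) ?_ ?_ ?_ ?_
  · intro A hA
    simp only [unshuffles, Finset.mem_filter, Finset.mem_univ, true_and]
    exact ⟨fun i j hij => by simpa only [hl, OrderEmbedding.lt_iff_lt] using hij,
      fun i j hij => by simpa only [hr, OrderEmbedding.lt_iff_lt] using hij⟩
  · intro A hA B hB h
    rw [← Finset.image_orderEmbOfFin_univ A (hc A hA).1,
      ← Finset.image_orderEmbOfFin_univ B (hc B hB).1]
    refine Finset.image_congr fun i _ => ?_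
    rw [← hl _ (hc A hA).2, h, hl]
  · intro σ hσ
    simp only [unshuffles, Finset.mem_filter, Finset.mem_univ, true_and] at hσ
    -- An unshuffle is recovered from the image of its first block, since it lists that set and its
    -- complement in increasing order.
    set A : Finset (Fin (q + p)) := Finset.univ.image fun i : Fin q => σ (Fin.castAdd p i) with hA
    have hinj : Function.Injective fun i : Fin q => σ (Fin.castAdd p i) :=
      σ.injective.comp (Fin.castAdd_injective q p)
    have hAm : A ∈ Finset.powersetCard q (Finset.univ : Finset (Fin (q + p))) :=
      Finset.mem_powersetCard.2 ⟨Finset.subset_univ _, by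
        rw [hA, Finset.card_image_of_injective _ hinj, Finset.card_fin]⟩
    refine ⟨A, hAm, ?_⟩
    ext1 t
    refine Fin.addCases (fun i => ?_) (fun i => ?_) t
    · rw [hl, ← Finset.orderEmbOfFin_unique (hc A hAm).1
        (f := fun i : Fin q => σ (Fin.castAdd p i)) (fun i => by simp [hA])
        fun i j hij => hσ.1 i j hij]
    · rw [hr, ← Finset.orderEmbOfFin_unique (hc A hAm).2
        (f := fun i : Fin p => σ (Fin.natAdd q i)) (fun i => ?_) fun i j hij => hσ.2 i j hij]
      simp only [hA, Finset.mem_compl, Finset.mem_image, Finset.mem_univ, true_and, not_exists,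
        EmbeddingLike.apply_eq_iff_eq, Fin.ext_iff, Fin.val_castAdd, Fin.val_natAdd]
      intro x hx
      omega
  · intro A hA
    rw [sign_finSumEquivOfFinset, compTerm_eq _ _ _ _ _ (hc A hA).1 (hc A hA).2]
    simp only [hl, hr]

/-- The left hand side of an `L∞` relation, as a sum over all splittings of the arguments. -/
theorem lInftyExpr_eq_sum_compTerm (c c' : CochainFamily k L) (N : ℕ) (v : ℕ → L) :
    lInftyExpr c c' N v = ∑ A : Finset (Fin N), (-1 : k) ^ ((A.card + 1) * (Aᶜ.card + 1)) •
      compTerm c c' (fun i : Fin N => v i) A Aᶜ := by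
  have h1 : ∀ x ∈ Finset.HasAntidiagonal.antidiagonal N,
      (-1 : k) ^ ((x.1 + 1) * (x.2 + 1)) •
        unshuffleComp (c (x.2 + 1)) (c' x.1) (fun i : Fin (x.1 + x.2) => v i) =
      ∑ A ∈ Finset.powersetCard x.1 (Finset.univ : Finset (Fin N)),
        (-1 : k) ^ ((A.card + 1) * (Aᶜ.card + 1)) •
          compTerm c c' (fun i : Fin N => v i) A Aᶜ := by
    rintro ⟨q, p⟩ h
    obtain rfl : q + p = N := by simpa using h
    dsimp only
    rw [unshuffleComp_eq_sum_powersetCard, Finset.smul_sum]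
    refine Finset.sum_congr rfl fun A hA => ?_
    have hA := (Finset.mem_powersetCard.1 hA).2
    rw [Finset.card_compl, hA, Fintype.card_fin, Nat.add_sub_cancel_left]
  rw [lInftyExpr, Finset.sum_congr rfl h1, Finset.Nat.sum_antidiagonal_eq_sum_range_succ
    (fun q _ => ∑ A ∈ Finset.powersetCard q (Finset.univ : Finset (Fin N)),
        (-1 : k) ^ ((A.card + 1) * (Aᶜ.card + 1)) •
          compTerm c c' (fun i : Fin N => v i) A Aᶜ)]
  rw [← Finset.powerset_univ, Finset.sum_powerset, Finset.card_fin]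

/-- A composition of `φ` with the bracket has `n + 1` arguments. In any other arity either a cochain
vanishes for degree reasons or its first argument is zero. -/
theorem lInftyExpr_lieFamily_single_of_ne {n N : ℕ} (hN : N ≠ n + 1) (φ : L [⋀^Fin n]→ₗ[k] L)
    (v : ℕ → L) : lInftyExpr (lieFamily k L) (Pi.single n φ) N v = 0 := by
  rw [lInftyExpr_eq_sum_compTerm]
  refine Finset.sum_eq_zero fun A _ => ?_
  have hA := Finset.card_add_card_compl A
  rw [Fintype.card_fin] at hA
  by_cases h1 : A.card = n
  · rw [compTerm, lieFamily_apply_of_ne (by omega)]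
    simp
  · rw [compTerm, single_apply_of_ne φ h1]
    rw [(lieFamily k L (Aᶜ.card + 1)).map_coord_zero 0 (by simp)]
    simp

theorem lInftyExpr_single_lieFamily_of_ne {n N : ℕ} (hN : N ≠ n + 1) (φ : L [⋀^Fin n]→ₗ[k] L)
    (v : ℕ → L) : lInftyExpr (Pi.single n φ) (lieFamily k L) N v = 0 := by
  rw [lInftyExpr_eq_sum_compTerm]
  refine Finset.sum_eq_zero fun A _ => ?_
  have hA := Finset.card_add_card_compl A
  rw [Fintype.card_fin] at hA
  by_cases h1 : A.card = 2
  · rw [compTerm, single_apply_of_ne φ (by omega)]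
    simp
  · rw [compTerm, lieFamily_apply_of_ne h1]
    rw [((Pi.single n φ : CochainFamily k L) (Aᶜ.card + 1)).map_coord_zero 0 (by simp)]
    simp

/-- Only splittings with a singleton outside `φ` survive. Their shuffle sign is `(-1)^(m+1+i)`, and
writing the singleton first in the bracket costs one more sign. -/
theorem lInftyExpr_lieFamily_single {m : ℕ} (φ : L [⋀^Fin (m + 1)]→ₗ[k] L) (v : ℕ → L) :
    lInftyExpr (lieFamily k L) (Pi.single (m + 1) φ) (m + 2) v =
      (-1 : k) ^ m • ∑ i : Fin (m + 2), (-1 : k) ^ (i : ℕ) •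
        ⁅v i, φ (i.removeNth fun t : Fin (m + 2) => v t)⁆ := by
  rw [lInftyExpr_eq_sum_compTerm,
    ← Equiv.sum_comp (Equiv.ofBijective (fun A : Finset (Fin (m + 2)) => Aᶜ) compl_bijective)]
  simp only [Equiv.ofBijective_apply, compl_compl]
  have h0 : ∀ B : Finset (Fin (m + 2)), B ∉ Finset.powersetCard 1 Finset.univ →
      (-1 : k) ^ ((Bᶜ.card + 1) * (B.card + 1)) • compTerm (lieFamily k L) (Pi.single (m + 1) φ)
        (fun i : Fin (m + 2) => v i) Bᶜ B = 0 := fun B hB => by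
    rw [compTerm, lieFamily_apply_of_ne fun h => hB (by simpa [Finset.mem_powersetCard] using h)]
    simp
  rw [← Finset.sum_subset (Finset.subset_univ _) fun B _ hB => h0 B hB, Finset.powersetCard_one,
    Finset.sum_map, Finset.smul_sum]
  refine Finset.sum_congr rfl fun i _ => ?_
  have hc : ({i}ᶜ : Finset (Fin (m + 2))).card = m + 1 := by
    rw [Finset.card_compl, Finset.card_singleton, Fintype.card_fin]; omega
  have hu : (fun t => v (({i}ᶜ : Finset (Fin (m + 2))).orderEmbOfFin hc t : Fin (m + 2))) =
      i.removeNth fun t : Fin (m + 2) => v t := by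
    funext t
    rw [Finset.orderEmbOfFin_compl_singleton_apply]
    rfl
  change (-1 : k) ^ ((({i}ᶜ : Finset (Fin (m + 2))).card + 1) *
    (({i} : Finset (Fin (m + 2))).card + 1)) • compTerm _ _ _ {i}ᶜ {i} = _
  rw [compTerm_eq _ _ _ _ _ hc (Finset.card_singleton i), splitSign_compl_singleton, hc, hu,
    lieFamily_two, Pi.single_eq_same, Finset.card_singleton, Fin.cons_zero, Fin.cons_one,
    Finset.orderEmbOfFin_singleton, ← lie_skew, smul_neg, smul_neg, smul_smul, smul_smul, ← neg_smul]
  congr 1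
  push_cast
  rw [pow_mul']
  simp only [even_two, Even.neg_pow, one_pow, one_mul]
  ring

/-- Only splittings with a pair inside the bracket survive. The relation's sign `(-1)^(3(m+1))` and
the shuffle sign `-(-1)^(i+j)` combine to the same prefactor `(-1)^m` as for the other half of the
coboundary. -/
theorem lInftyExpr_single_lieFamily {m : ℕ} (φ : L [⋀^Fin (m + 1)]→ₗ[k] L) (v : ℕ → L) :
    lInftyExpr (Pi.single (m + 1) φ) (lieFamily k L) (m + 2) v =
      (-1 : k) ^ m • ∑ j : Fin (m + 2), ∑ i : Fin (m + 1),
        if i.castSucc < j then (-1 : k) ^ ((i : ℕ) + (j : ℕ)) •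
            φ (Fin.cons ⁅v i, v j⁆ (i.removeNth (j.removeNth fun t : Fin (m + 2) => v t)))
        else 0 := by
  rw [lInftyExpr_eq_sum_compTerm]
  have h0 : ∀ B : Finset (Fin (m + 2)), B ∉ Finset.powersetCard 2 Finset.univ →
      (-1 : k) ^ ((B.card + 1) * (Bᶜ.card + 1)) • compTerm (Pi.single (m + 1) φ) (lieFamily k L)
        (fun i : Fin (m + 2) => v i) B Bᶜ = 0 := fun B hB => by
    have hB' : B.card ≠ 2 := fun h => hB (by simpa [Finset.mem_powersetCard] using h)
    rw [compTerm, lieFamily_apply_of_ne hB',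
      ((Pi.single (m + 1) φ : CochainFamily k L) (Bᶜ.card + 1)).map_coord_zero 0 (by simp)]
    simp
  rw [← Finset.sum_subset (Finset.subset_univ _) fun B _ hB => h0 B hB, sum_powersetCard_two,
    Finset.smul_sum]
  refine Finset.sum_congr rfl fun j _ => ?_
  rw [Finset.smul_sum]
  refine Finset.sum_congr rfl fun i _ => ?_
  split_ifs with hij
  · have hB : ({i.castSucc, j} : Finset (Fin (m + 2))).card = 2 := Finset.card_pair hij.ne
    have hc : ({i.castSucc, j}ᶜ : Finset (Fin (m + 2))).card = m := by
      rw [Finset.card_compl, hB, Fintype.card_fin]; omega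
    have hu : (fun t => v (({i.castSucc, j}ᶜ : Finset (Fin (m + 2))).orderEmbOfFin hc t :
        Fin (m + 2))) = i.removeNth (j.removeNth fun t : Fin (m + 2) => v t) := by
      rw [← Finset.orderEmbOfFin_unique hc (succAbove_succAbove_mem_compl hij)
        (strictMono_succAbove_succAbove i j)]
      rfl
    have hv : lieFamily k L 2 (fun t => v (({i.castSucc, j} : Finset (Fin (m + 2))).orderEmbOfFin
        hB t : Fin (m + 2))) = ⁅v i, v j⁆ := by
      rw [← eval_sortedTuple_eq (fun N v => lieFamily k L N v) _ (fun t : Fin (m + 2) => v t) hB,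
        lieFamily_sortedTuple_pair hij]
      rfl
    rw [compTerm_eq _ _ _ _ _ hB hc, hu, hv, hB, hc,
      splitSign_comm ({i.castSucc, j}ᶜ) {i.castSucc, j} disjoint_compl_left,
      splitSign_compl_pair hij, hB, hc, Pi.single_eq_same, smul_smul, smul_smul]
    congr 1
    push_cast
    rw [pow_mul, pow_mul']
    simp only [Fin.val_castSucc, even_two, Even.neg_pow, one_pow]
    ring
  · rw [smul_zero]

/-- A cocycle of a Lie algebra satisfies the `L∞` relations of an infinitesimal deformation. -/
theorem IsLieCocycle.lInftyExpr_add_eq_zero {n : ℕ} (hn : 1 ≤ n) {φ : L [⋀^Fin n]→ₗ[k] L}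
    (hcoc : IsLieCocycle φ) (N : ℕ) (v : ℕ → L) :
    lInftyExpr (lieFamily k L) (Pi.single n φ) N v +
      lInftyExpr (Pi.single n φ) (lieFamily k L) N v = 0 := by
  obtain ⟨m, rfl⟩ : ∃ m, n = m + 1 := ⟨n - 1, by omega⟩
  rcases eq_or_ne N (m + 2) with rfl | hN
  · rw [lInftyExpr_lieFamily_single, lInftyExpr_single_lieFamily, ← smul_add]
    have h1 := hcoc fun t : Fin (m + 2) => v t
    rw [lieCoboundary] at h1
    exact (congrArg _ h1).trans (smul_zero _)
  · rw [lInftyExpr_lieFamily_single_of_ne hN, lInftyExpr_single_lieFamily_of_ne hN, add_zero]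

theorem isLInfty_lieFamily [CharZero k] : IsLInfty (lieFamily k L) where
  zero := lieFamily_apply_of_ne (by norm_num)
  parity m hm := lieFamily_apply_of_ne (by rintro rfl; exact absurd hm (by decide))
  relation N v := by
    have h1 := (isLieCocycle_lieBracketCochain (k := k) (L := L)).lInftyExpr_add_eq_zero
      (by norm_num) N v
    -- For `φ` equal to the bracket the two polarized terms coincide, so twice the relation is zero;
    -- characteristic zero removes the factor.
    change lInftyExpr (lieFamily k L) (lieFamily k L) N v +
      lInftyExpr (lieFamily k L) (lieFamily k L) N v = 0 at h1
    rw [← two_smul k] at h1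
    exact (smul_eq_zero.1 h1).resolve_left two_ne_zero

theorem IsLieCocycle.isInfinitesimalDeformation [CharZero k] {n : ℕ} (hn : 1 ≤ n)
    {φ : L [⋀^Fin n]→ₗ[k] L} (hcoc : IsLieCocycle φ) :
    IsInfinitesimalDeformation n (lieFamily k L) (Pi.single n φ) where
  base := isLInfty_lieFamily
  zero := single_apply_of_ne φ (by omega)
  parity m hm := single_apply_of_ne φ (by
    rintro rfl
    rw [Nat.odd_iff] at hm
    omega)
  relation := hcoc.lInftyExpr_add_eq_zero hn

end InfinitesimalDeformation

/-! ### From isomorphism classes to sums over numbered graphs, and a criterion for cycles -/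

noncomputable section GraphSums

namespace OrGraph

variable {v e : ℕ}

instance : Fintype (OrGraph v e) := Fintype.ofFinite _

/-- The bijection of half-edges given by a permutation of the edges and by reversing arrows. -/
def halfEdgeEquiv (ε : Equiv.Perm (Fin e)) (fl : Fin e → Bool) : HalfEdge e ≃ HalfEdge e where
  toFun p := toLex (ε (ofLex p).1, xor (fl (ofLex p).1) (ofLex p).2)
  invFun p := toLex (ε.symm (ofLex p).1, xor (fl (ε.symm (ofLex p).1)) (ofLex p).2)
  left_inv p := by simp
  right_inv p := by simp

theorem halfEdgeEquiv_apply (ε : Equiv.Perm (Fin e)) (fl : Fin e → Bool) (j : Fin e) (s : Bool) :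
    halfEdgeEquiv ε fl (toLex (j, s)) = toLex (ε j, xor (fl j) s) := rfl

theorem mem_endsAt {ends : Fin e → Bool → Fin v} {y : Fin v} {p : HalfEdge e} :
    p ∈ endsAt ends y ↔ ends (ofLex p).1 (ofLex p).2 = y := by simp [endsAt]

theorem Iso.halfEdgeEquiv_mem {Γ Γ' : OrGraph v e} (f : Iso Γ Γ') (y : Fin v) (p : HalfEdge e) :
    halfEdgeEquiv f.edge f.flip p ∈ endsAt Γ'.ends (f.vertex y) ↔ p ∈ endsAt Γ.ends y := by
  rw [mem_endsAt, mem_endsAt]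
  change Γ'.ends (f.edge _) (xor (f.flip _) _) = _ ↔ _
  rw [f.ends_eq, EmbeddingLike.apply_eq_iff_eq]

/-- Permutations of the vertices and of the edges, together with reversals of arrows. -/
abbrev Relabeling (v e : ℕ) : Type := Equiv.Perm (Fin v) × Equiv.Perm (Fin e) × (Fin e → Bool)

/-- Change of the numberings and of the arrows. -/
def relabel (g : Relabeling v e) (Γ : OrGraph v e) : OrGraph v e where
  ends j s := g.1 (Γ.ends (g.2.1.symm j) (xor (g.2.2 (g.2.1.symm j)) s))
  three_le y := by
    refine (Γ.three_le (g.1.symm y)).trans (le_of_eq ?_)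
    refine Finset.card_equiv (halfEdgeEquiv g.2.1 g.2.2) fun p => ?_
    rw [mem_endsAt, mem_endsAt, Equiv.eq_symm_apply]
    simp [halfEdgeEquiv]

/-- A graph is isomorphic to its relabelings. -/
def relabelIso (g : Relabeling v e) (Γ : OrGraph v e) : Iso Γ (relabel g Γ) :=
  ⟨g.1, g.2.1, g.2.2, fun j s => by simp [relabel]⟩

theorem Iso.eq_relabel {Γ Γ' : OrGraph v e} (f : Iso Γ Γ') :
    relabel (f.vertex, f.edge, f.flip) Γ = Γ' := by
  ext j s : 3
  have h := f.ends_eq (f.edge.symm j) (xor (f.flip (f.edge.symm j)) s)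
  rw [Equiv.apply_symm_apply, ← Bool.xor_assoc, Bool.xor_self, Bool.false_xor] at h
  exact h.symm

theorem relabel_bijective (g : Relabeling v e) : Function.Bijective (relabel g) := by
  refine Function.Injective.bijective_of_finite fun Γ Γ' h => ?_
  ext j s : 3
  have h1 := congrFun (congrFun (congrArg OrGraph.ends h) (g.2.1 j)) (xor (g.2.2 j) s)
  simpa [relabel] using h1

/-- Isomorphisms between two given graphs, as relabelings. -/
def isoEquiv (Γ Γ' : OrGraph v e) : Iso Γ Γ' ≃ {g : Relabeling v e // relabel g Γ = Γ'} where
  toFun f := ⟨(f.vertex, f.edge, f.flip), f.eq_relabel⟩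
  invFun g := ⟨g.1.1, g.1.2.1, g.1.2.2, by
    obtain ⟨g, rfl⟩ := g
    exact (relabelIso g Γ).ends_eq⟩
  left_inv _ := rfl
  right_inv _ := rfl

instance (Γ Γ' : OrGraph v e) : Finite (Iso Γ Γ') := Finite.of_equiv _ (isoEquiv Γ Γ').symm

/-- Composition with `f` is injective; applied to `f` and to an inverse isomorphism, the inequality
becomes an equality. -/
theorem card_iso_le {Γ Γ₁ Γ₂ : OrGraph v e} (f : Iso Γ₁ Γ₂) :
    Nat.card (Iso Γ Γ₁) ≤ Nat.card (Iso Γ Γ₂) := by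
  refine Nat.card_le_card_of_injective (fun g => ⟨g.vertex.trans f.vertex, g.edge.trans f.edge,
    fun j => xor (f.flip (g.edge j)) (g.flip j), fun j s => ?_⟩) fun g g' h => ?_
  · simp only [Equiv.trans_apply]
    rw [Bool.xor_assoc, f.ends_eq, g.ends_eq]
  · rw [Iso.mk.injEq] at h
    have h1 : g.vertex = g'.vertex := by
      ext1 x; simpa using congrArg (fun ρ : Equiv.Perm _ => ρ x) h.1
    have h2 : g.edge = g'.edge := by
      ext1 x; simpa using congrArg (fun ρ : Equiv.Perm _ => ρ x) h.2.1
    refine Iso.ext h1 h2 (funext fun j => ?_)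
    have h3 := congrFun h.2.2 j
    rw [h2] at h3
    simpa using h3

theorem card_iso {Γ Γ' : OrGraph v e} (f : Iso Γ Γ') : Nat.card (Iso Γ Γ') = Γ.autCard := by
  obtain ⟨f'⟩ := (isoSetoid v e).iseqv.symm ⟨f⟩
  exact le_antisymm (card_iso_le f') (card_iso_le f)

open Classical in
/-- Orbit counting for relabelings. -/
theorem card_isoClass_mul_autCard (Γ : OrGraph v e) :
    (Finset.univ.filter fun Γ' : OrGraph v e => Nonempty (Iso Γ Γ')).card * Γ.autCard =
      Fintype.card (Relabeling v e) := by
  rw [← Finset.card_univ (α := Relabeling v e), Finset.card_eq_sum_card_fiberwise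
    (f := fun g => relabel g Γ)
    (t := Finset.univ.filter fun Γ' : OrGraph v e => Nonempty (Iso Γ Γ'))
    (fun g _ => by simpa using ⟨relabelIso g Γ⟩), ← smul_eq_mul, ← Finset.sum_const]
  refine Finset.sum_congr rfl fun Γ' h => ?_
  obtain ⟨f⟩ := (Finset.mem_filter.1 h).2
  rw [← card_iso f, Nat.card_congr (isoEquiv Γ Γ'), Nat.card_eq_fintype_card, Fintype.card_subtype]

theorem autCard_pos (Γ : OrGraph v e) : 0 < Γ.autCard :=
  Nat.card_pos_iff.2 ⟨⟨1, 1, fun _ => false, by simp⟩, inferInstance⟩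

end OrGraph

open OrGraph

variable {k : Type*} [Field k] {v e : ℕ}

/-- Functions on oriented graphs that change sign with the orientation. -/
def IsOrientationEquivariant (F : OrGraph v e → k) : Prop :=
  ∀ (Γ Γ' : OrGraph v e) (f : Iso Γ Γ'), F Γ' = ((f.sign : ℤ) : k) * F Γ

theorem int_units_cast_mul_self (u : ℤˣ) : ((u : ℤ) : k) * ((u : ℤ) : k) = 1 := by
  rw [← Int.cast_mul, ← Units.val_mul, Int.units_mul_self]
  simp

/-- The sum over isomorphism classes, weighted by automorphisms, as a sum over all graphs. -/
theorem smul_graphChain [CharZero k] {F : OrGraph v e → k} (hF : IsOrientationEquivariant F) :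
    (Fintype.card (Relabeling v e) : k) • graphChain F = ∑ Γ, F Γ • graphClass Γ := by
  classical
  rw [graphChain, Finset.smul_sum, ← Finset.sum_fiberwise_of_maps_to
    (t := (Finset.univ : Finset (IsoClass v e))) (g := fun Γ => (Quotient.mk _ Γ : IsoClass v e))
    fun _ _ => Finset.mem_univ _]
  refine Finset.sum_congr rfl fun c _ => ?_
  have h1 : (Finset.univ.filter fun Γ : OrGraph v e => (Quotient.mk _ Γ : IsoClass v e) = c) =
      Finset.univ.filter fun Γ' : OrGraph v e => Nonempty (Iso c.out Γ') := by
    refine Finset.filter_congr fun Γ _ => ?_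
    rw [eq_comm]
    conv_lhs => rw [← Quotient.out_eq c]
    exact Quotient.eq
  -- `F Γ • Γ` is constant on the isomorphism class, because the orientation sign enters once
  -- through `F` and once through the class of `Γ`.
  have h2 : ∀ Γ ∈ Finset.univ.filter fun Γ' : OrGraph v e => Nonempty (Iso c.out Γ'),
      F Γ • (graphClass Γ : GraphComplex k v e) = F c.out • graphClass c.out := fun Γ h => by
    obtain ⟨f⟩ := (Finset.mem_filter.1 h).2
    rw [hF _ _ f, graphClass_eq f, smul_smul, mul_right_comm, int_units_cast_mul_self, one_mul]
  rw [h1, Finset.sum_congr rfl h2, Finset.sum_const, ← Nat.cast_smul_eq_nsmul k, smul_smul,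
    smul_smul, ← card_isoClass_mul_autCard c.out]
  have h3 : (c.out.autCard : k) ≠ 0 := Nat.cast_ne_zero.2 (autCard_pos _).ne'
  congr 1
  push_cast
  field_simp

/-- The term of the boundary of `F Γ • Γ` that is given by an edge. -/
def boundaryTerm (F : OrGraph (v + 1) (e + 1) → k) (Γ : OrGraph (v + 1) (e + 1))
    (i : Fin (e + 1)) : GraphComplex k v e :=
  F Γ • if hi : Γ.ends i false ≠ Γ.ends i true then
    ((Γ.contractSign i : ℤ) : k) • graphClass (Γ.contract i hi) else 0

/-- The sign of `f` appears in `F` and again in the induced isomorphism of the contracted graphs,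
whose sign also converts one contraction sign into the other; all signs cancel in pairs. -/
theorem boundaryTerm_eq {F : OrGraph (v + 1) (e + 1) → k} (hF : IsOrientationEquivariant F)
    {Γ Γ' : OrGraph (v + 1) (e + 1)} (f : Iso Γ Γ') (i : Fin (e + 1)) :
    boundaryTerm F Γ' (f.edge i) = boundaryTerm F Γ i := by
  unfold boundaryTerm
  by_cases hi : Γ.ends i false ≠ Γ.ends i true
  · have hi' := (f.loop_iff i).2 hi
    obtain ⟨g, hg⟩ := f.exists_contract i hi hi'
    rw [dif_pos hi, dif_pos hi', graphClass_eq g, smul_smul, smul_smul, smul_smul, hg, hF _ _ f]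
    congr 1
    push_cast
    linear_combination (F Γ * ((Γ.contractSign i : ℤ) : k)) *
      (((f.sign : ℤ) : k) * ((f.sign : ℤ) : k) *
        int_units_cast_mul_self (k := k) (Γ'.contractSign (f.edge i)) +
        int_units_cast_mul_self (k := k) f.sign)
  · rw [dif_neg hi, dif_neg (mt (f.loop_iff i).1 hi), smul_zero, smul_zero]

/-- In a sum over all numbered graphs the edges are interchangeable: exchanging the numbers of edge
`i` and the last edge permutes the graphs and carries one term to the other. -/
theorem smul_graphBoundary_graphChain [CharZero k] {F : OrGraph (v + 1) (e + 1) → k}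
    (hF : IsOrientationEquivariant F) :
    (Fintype.card (Relabeling (v + 1) (e + 1)) : k) • graphBoundary k v e (graphChain F) =
      (e + 1) • ∑ Γ, boundaryTerm F Γ (Fin.last e) := by
  rw [← map_smul, smul_graphChain hF, map_sum]
  simp only [map_smul, graphBoundary_graphClass, graphBoundaryGen, Finset.smul_sum]
  rw [Finset.sum_comm]
  have h1 : ∀ i, ∑ Γ, boundaryTerm F Γ i = ∑ Γ, boundaryTerm F Γ (Fin.last e) := fun i => by
    let g : Relabeling (v + 1) (e + 1) := (1, Equiv.swap i (Fin.last e), fun _ => false)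
    rw [← Equiv.sum_comp (Equiv.ofBijective _ (relabel_bijective g))
      fun Γ => boundaryTerm F Γ (Fin.last e)]
    refine Finset.sum_congr rfl fun Γ _ => ?_
    rw [← boundaryTerm_eq hF (relabelIso g Γ)]
    simp [relabelIso, g]
  refine (Finset.sum_congr rfl fun i _ => h1 i).trans ?_
  rw [Finset.sum_const, Finset.card_fin]
  exact Finset.smul_sum

/-- `Γ` is obtained from `Δ` by expanding the last vertex to an edge, which is the last one and
joins the last two vertices. -/
structure IsExpansion {w : ℕ} (Δ : OrGraph (w + 1) e) (Γ : OrGraph (w + 2) (e + 1)) : Prop where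
  source : Γ.ends (Fin.last e) false = (Fin.last w).castSucc
  target : Γ.ends (Fin.last e) true = Fin.last (w + 1)
  ends_eq : ∀ j s, (Δ.ends j s).castSucc =
    if Γ.ends j.castSucc s = Fin.last (w + 1) then (Fin.last w).castSucc else Γ.ends j.castSucc s

theorem exists_perm_two {n : ℕ} {a b c d : Fin n} (hab : a ≠ b) (hcd : c ≠ d) :
    ∃ ρ : Equiv.Perm (Fin n), ρ a = c ∧ ρ b = d := by
  have h : (Equiv.swap a c) b ≠ c := fun h =>
    hab ((Equiv.swap a c).injective (by rw [Equiv.swap_apply_left, h]))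
  refine ⟨(Equiv.swap a c).trans (Equiv.swap ((Equiv.swap a c) b) d), ?_, by simp⟩
  rw [Equiv.trans_apply, Equiv.swap_apply_left, Equiv.swap_apply_of_ne_of_ne h.symm hcd]

open Classical in
-- Each such graph expands exactly one `Δ`, namely its contraction. The contraction sign is `1`
-- since the target is already the last vertex, so the coefficient of `Δ` is the sum in `hF`.
theorem sum_boundaryTerm_expansion {w : ℕ} {F : OrGraph (w + 2) (e + 1) → k}
    (hF : ∀ Δ : OrGraph (w + 1) e, ∑ Γ with IsExpansion Δ Γ, F Γ = 0) :
    ∑ Γ with Γ.ends (Fin.last e) false = (Fin.last w).castSucc ∧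
      Γ.ends (Fin.last e) true = Fin.last (w + 1), boundaryTerm F Γ (Fin.last e) = 0 := by
  have h0 : ∀ Γ : OrGraph (w + 2) (e + 1), (Γ.ends (Fin.last e) false = (Fin.last w).castSucc ∧
      Γ.ends (Fin.last e) true = Fin.last (w + 1)) →
      ∃ Δ : OrGraph (w + 1) e, IsExpansion Δ Γ ∧
        boundaryTerm F Γ (Fin.last e) = F Γ • graphClass Δ := fun Γ h => by
    have hi : Γ.ends (Fin.last e) false ≠ Γ.ends (Fin.last e) true := by
      rw [h.1, h.2]
      exact (Fin.castSucc_lt_last _).ne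
    refine ⟨Γ.contract _ hi, ⟨h.1, h.2, fun j s => ?_⟩, ?_⟩
    · have h1 := succAbove_collapse _ _ hi (Γ.ends ((Fin.last e).succAbove j) s)
      simp only [h.1, h.2, Fin.succAbove_last_apply] at h1
      simp only [contract, h.1, h.2, Fin.succAbove_last_apply]
      exact h1
    · rw [boundaryTerm, dif_pos hi, contractSign, h.2]
      simp
  have huniq : ∀ (Γ : OrGraph (w + 2) (e + 1)) (Δ Δ' : OrGraph (w + 1) e), IsExpansion Δ Γ →
      IsExpansion Δ' Γ → Δ = Δ' := fun Γ Δ Δ' h h' => by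
    ext j s : 3
    exact Fin.castSucc_injective _ ((h.ends_eq j s).trans (h'.ends_eq j s).symm)
  have h1 : ∀ Γ ∈ Finset.univ.filter fun Γ : OrGraph (w + 2) (e + 1) =>
      Γ.ends (Fin.last e) false = (Fin.last w).castSucc ∧
        Γ.ends (Fin.last e) true = Fin.last (w + 1),
      boundaryTerm F Γ (Fin.last e) =
        ∑ Δ : OrGraph (w + 1) e, if IsExpansion Δ Γ then F Γ • graphClass Δ else 0 := fun Γ h => by
    obtain ⟨Δ, hΔ, h2⟩ := h0 Γ (Finset.mem_filter.1 h).2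
    rw [h2, Finset.sum_eq_single Δ (fun Δ' _ hne => if_neg fun h' => hne (huniq Γ _ _ h' hΔ))
      (fun h => absurd (Finset.mem_univ _) h), if_pos hΔ]
  rw [Finset.sum_congr rfl h1, Finset.sum_comm]
  refine Finset.sum_eq_zero fun Δ _ => ?_
  have h2 : (Finset.univ.filter fun Γ => IsExpansion Δ Γ) =
      ((Finset.univ.filter fun Γ : OrGraph (w + 2) (e + 1) =>
        Γ.ends (Fin.last e) false = (Fin.last w).castSucc ∧
        Γ.ends (Fin.last e) true = Fin.last (w + 1)).filter fun Γ => IsExpansion Δ Γ) := by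
    ext Γ
    simp only [Finset.mem_filter, Finset.mem_univ, true_and]
    exact ⟨fun h => ⟨⟨h.source, h.target⟩, h⟩, fun h => h.2⟩
  rw [← Finset.sum_filter, ← h2, ← Finset.sum_smul, hF, zero_smul]

open Classical in
/-- A criterion for the chain of a function on graphs to be a cycle. -/
theorem graphBoundary_graphChain_eq_zero [CharZero k] {w : ℕ} {F : OrGraph (w + 2) (e + 1) → k}
    (hF : IsOrientationEquivariant F)
    (hF' : ∀ Δ : OrGraph (w + 1) e, ∑ Γ with IsExpansion Δ Γ, F Γ = 0) :
    graphBoundary k (w + 1) e (graphChain F) = 0 := by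
  have hcard : (Fintype.card (Relabeling (w + 2) (e + 1)) : k) ≠ 0 :=
    Nat.cast_ne_zero.2 Fintype.card_ne_zero
  refine (smul_eq_zero.1 ?_).resolve_left hcard
  rw [smul_graphBoundary_graphChain hF]
  refine smul_eq_zero_of_right _ ?_
  -- The graphs are grouped by the ends `(s, t)` of the last edge. Loops contribute nothing, and for
  -- `s ≠ t` a renumbering of the vertices moves the ends to the last two positions.
  rw [← Finset.sum_fiberwise_of_maps_to (t := Finset.univ)
    (g := fun Γ : OrGraph (w + 2) (e + 1) => (Γ.ends (Fin.last e) false, Γ.ends (Fin.last e) true))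
    fun _ _ => Finset.mem_univ _]
  refine Finset.sum_eq_zero fun x _ => ?_
  obtain ⟨s, t⟩ := x
  rcases eq_or_ne s t with rfl | hst
  · refine Finset.sum_eq_zero fun Γ h => ?_
    have h := (Finset.mem_filter.1 h).2
    rw [Prod.mk.injEq] at h
    rw [boundaryTerm, dif_neg (not_not.2 (h.1.trans h.2.symm)), smul_zero]
  · obtain ⟨ρ, hs, ht⟩ := exists_perm_two hst (Fin.castSucc_lt_last (Fin.last w)).ne
    let g : Relabeling (w + 2) (e + 1) := (ρ, Equiv.refl _, fun _ => false)
    rw [← sum_boundaryTerm_expansion hF']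
    refine Finset.sum_equiv (Equiv.ofBijective _ (relabel_bijective g)) (fun Γ => ?_) fun Γ _ => ?_
    · simp [relabel, g, ← hs, ← ht]
    · rw [← boundaryTerm_eq hF (relabelIso g Γ)]
      rfl

theorem graphBoundary_eq_zero_of_one_vertex (x : GraphComplex k 1 (e + 1)) :
    graphBoundary k 0 e x = 0 := by
  have h : graphBoundary k 0 e = 0 := by
    ext Γ
    change graphBoundary k 0 e (graphClass Γ) = 0
    rw [graphBoundary_graphClass, graphBoundaryGen]
    exact Finset.sum_eq_zero fun i _ => dif_neg (not_not.2 (Subsingleton.elim (α := Fin 1) _ _))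
  rw [h]
  rfl

end GraphSums

/-! ### Connectedness under isomorphism and expansion -/

noncomputable section ConnectedGraphs

open OrGraph

variable {k : Type*} [Field k] {v e : ℕ}

/-- Adjacent vertices need only go to reachable ones: contraction may collapse an edge, and
expansion may replace one by a path through the new edge. -/
theorem SimpleGraph.Reachable.map_of_adj {V W : Type*} {G : SimpleGraph V} {H : SimpleGraph W}
    (f : V → W) (hf : ∀ x y, G.Adj x y → H.Reachable (f x) (f y)) {x y : V}
    (h : G.Reachable x y) : H.Reachable (f x) (f y) := by
  obtain ⟨p⟩ := h
  induction p with
  | nil => exact SimpleGraph.Reachable.refl _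
  | cons hadj _ ih => exact (hf _ _ hadj).trans ih

namespace OrGraph

/-- The simple graph whose connectedness is that of an oriented graph. -/
def underlying (Γ : OrGraph v e) : SimpleGraph (Fin v) :=
  SimpleGraph.fromRel fun x y => ∃ j, Γ.ends j false = x ∧ Γ.ends j true = y

theorem reachable_ends (Γ : OrGraph v e) (j : Fin e) :
    Γ.underlying.Reachable (Γ.ends j false) (Γ.ends j true) := by
  by_cases h : Γ.ends j false = Γ.ends j true
  · rw [h]
  · exact SimpleGraph.Adj.reachable ⟨h, Or.inl ⟨j, rfl, rfl⟩⟩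

theorem reachable_map {v' e' : ℕ} {Γ : OrGraph v e} {Γ' : OrGraph v' e'} (f : Fin v → Fin v')
    (hf : ∀ j, Γ'.underlying.Reachable (f (Γ.ends j false)) (f (Γ.ends j true))) {x y : Fin v}
    (h : Γ.underlying.Reachable x y) : Γ'.underlying.Reachable (f x) (f y) := by
  refine h.map_of_adj f fun x y hxy => ?_
  rcases hxy.2 with ⟨j, rfl, rfl⟩ | ⟨j, rfl, rfl⟩
  · exact hf j
  · exact (hf j).symm

theorem Iso.connected {Γ Γ' : OrGraph v e} (f : Iso Γ Γ') (h : Γ.Connected) : Γ'.Connected := by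
  obtain ⟨hp, hn⟩ := (SimpleGraph.connected_iff _).1 h
  refine (SimpleGraph.connected_iff _).2 ⟨fun x y => ?_, hn⟩
  have h1 := reachable_map (Γ' := Γ') f.vertex (fun j => ?_)
    (hp (f.vertex.symm x) (f.vertex.symm y))
  · rw [Equiv.apply_symm_apply, Equiv.apply_symm_apply] at h1
    exact h1
  · rw [← f.ends_eq, ← f.ends_eq]
    have h2 := Γ'.reachable_ends (f.edge j)
    cases f.flip j
    · exact h2
    · exact h2.symm

theorem Iso.connected_iff {Γ Γ' : OrGraph v e} (f : Iso Γ Γ') : Γ'.Connected ↔ Γ.Connected := by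
  obtain ⟨f'⟩ := (isoSetoid v e).iseqv.symm ⟨f⟩
  exact ⟨f'.connected, f.connected⟩

end OrGraph

theorem IsExpansion.connected_iff {w : ℕ} {Δ : OrGraph (w + 1) e} {Γ : OrGraph (w + 2) (e + 1)}
    (h : IsExpansion Δ Γ) : Γ.Connected ↔ Δ.Connected := by
  have hends : ∀ j s, Γ.underlying.Reachable (Δ.ends j s).castSucc (Γ.ends j.castSucc s) :=
    fun j s => by
      rw [h.ends_eq]
      split_ifs with h1
      · rw [h1, ← h.source, ← h.target]
        exact Γ.reachable_ends _
      · exact SimpleGraph.Reachable.refl _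
  constructor
  · intro hΓ
    obtain ⟨hp, -⟩ := (SimpleGraph.connected_iff _).1 hΓ
    refine (SimpleGraph.connected_iff _).2 ⟨fun x y => ?_, inferInstance⟩
    -- `π` merges the last vertex into its predecessor. It maps paths of `Γ` to paths of `Δ`, and
    -- `Fin.castSucc` is a section of it.
    let π : Fin (w + 2) → Fin (w + 1) := Fin.lastCases (Fin.last w) id
    have hπ : ∀ x : Fin (w + 1), π x.castSucc = x := fun x => by simp [π]
    have hπ' : π (Fin.last (w + 1)) = Fin.last w := by simp [π]
    have hπe : ∀ j s, π (Γ.ends j.castSucc s) = Δ.ends j s := fun j s => by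
      have h1 := h.ends_eq j s
      split_ifs at h1 with h2
      · rw [h2, hπ', ← Fin.castSucc_injective _ h1]
      · rw [← h1, hπ]
    have h1 := reachable_map (Γ' := Δ) π (fun j => ?_) (hp x.castSucc y.castSucc)
    · rw [hπ, hπ] at h1
      exact h1
    · refine Fin.lastCases ?_ (fun j => ?_) j
      · rw [h.source, h.target, hπ, hπ']
      · rw [hπe, hπe]
        exact Δ.reachable_ends j
  · intro hΔ
    obtain ⟨hp, -⟩ := (SimpleGraph.connected_iff _).1 hΔ
    have h1 : ∀ x y : Fin (w + 1), Γ.underlying.Reachable x.castSucc y.castSucc := fun x y =>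
      reachable_map Fin.castSucc (fun j => ((hends j false).trans (Γ.reachable_ends _)).trans
        (hends j true).symm) (hp x y)
    have h2 : ∀ x : Fin (w + 2), Γ.underlying.Reachable (Fin.last w).castSucc x := fun x => by
      refine Fin.lastCases ?_ (fun x => h1 _ x) x
      rw [← h.source, ← h.target]
      exact Γ.reachable_ends _
    exact (SimpleGraph.connected_iff _).2 ⟨fun x y => (h2 x).symm.trans (h2 y), inferInstance⟩

theorem IsOrientationEquivariant.connectedPart {F : OrGraph v e → k}
    (hF : IsOrientationEquivariant F) : IsOrientationEquivariant (connectedPart F) := by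
  intro Γ Γ' f
  by_cases h : Γ.Connected
  · rw [_root_.connectedPart, _root_.connectedPart, if_pos h, if_pos (f.connected_iff.2 h), hF _ _ f]
  · rw [_root_.connectedPart, _root_.connectedPart, if_neg h, if_neg (mt f.connected_iff.1 h),
      mul_zero]

open Classical in
theorem sum_connectedPart_expansion {w : ℕ} {F : OrGraph (w + 2) (e + 1) → k}
    (hF : ∀ Δ : OrGraph (w + 1) e, ∑ Γ with IsExpansion Δ Γ, F Γ = 0) (Δ : OrGraph (w + 1) e) :
    ∑ Γ with IsExpansion Δ Γ, connectedPart F Γ = 0 := by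
  by_cases h : Δ.Connected
  · rw [← hF Δ]
    refine Finset.sum_congr rfl fun Γ hΓ => ?_
    rw [connectedPart, if_pos ((Finset.mem_filter.1 hΓ).2.connected_iff.2 h)]
  · refine Finset.sum_eq_zero fun Γ hΓ => ?_
    rw [connectedPart, if_neg (mt (Finset.mem_filter.1 hΓ).2.connected_iff.1 h)]

end ConnectedGraphs

/-! ### Koszul signs of graph isomorphisms -/

noncomputable section Equivariance

open OrGraph

namespace OrGraph

variable {v e : ℕ}

/-- The vertex of a half-edge. -/
def endAt (Γ : OrGraph v e) (p : HalfEdge e) : Fin v := Γ.ends (ofLex p).1 (ofLex p).2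

theorem mem_endsAt_iff {Γ : OrGraph v e} {y : Fin v} {p : HalfEdge e} :
    p ∈ endsAt Γ.ends y ↔ Γ.endAt p = y := mem_endsAt

theorem Iso.endAt_eq {Γ Γ' : OrGraph v e} (f : Iso Γ Γ') (p : HalfEdge e) :
    Γ'.endAt (halfEdgeEquiv f.edge f.flip p) = f.vertex (Γ.endAt p) := f.ends_eq _ _

/-- The edge permutation acts on two copies of the edges, hence evenly; each reversed arrow is a
transposition of half-edges. -/
theorem sign_halfEdgeEquiv (ε : Equiv.Perm (Fin e)) (fl : Fin e → Bool) :
    Equiv.Perm.sign (halfEdgeEquiv ε fl) = ∏ j, if fl j then -1 else 1 := by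
  have h : halfEdgeEquiv ε fl = (toLex : Fin e × Bool ≃ HalfEdge e).permCongr
      ((Equiv.prodCongrLeft fun _ : Bool => ε) *
        Equiv.prodCongrRight fun j => if fl j then Equiv.boolNot else 1) := by
    ext1 p
    obtain ⟨⟨j, s⟩, rfl⟩ := toLex.surjective p
    rcases h : fl j <;> simp [halfEdgeEquiv, Equiv.permCongr_apply, h]
  rw [h, Equiv.Perm.sign_permCongr, Equiv.Perm.sign_mul, Equiv.Perm.sign_prodCongrLeft,
    Equiv.Perm.sign_prodCongrRight, Fintype.prod_bool, Int.units_mul_self, one_mul]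
  refine Finset.prod_congr rfl fun j _ => ?_
  cases fl j
  · simp
  · simp only [if_true]; decide

theorem contractionSign_eq_prod (Γ : OrGraph v e) :
    contractionSign Γ = ∏ p ∈ ltPairs (HalfEdge e), if Γ.endAt p.2 < Γ.endAt p.1 then -1 else 1 := by
  rw [contractionSign, ← Finset.prod_filter, Finset.prod_const, ltPairs, Finset.filter_filter]
  rfl

/-- `1` if a permutation preserves the order of two elements, `-1` otherwise. -/
def orderSign (ρ : Equiv.Perm (Fin v)) (y z : Fin v) : ℤˣ := if y < z ↔ ρ y < ρ z then 1 else -1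

theorem orderSign_comm (ρ : Equiv.Perm (Fin v)) (y z : Fin v) :
    orderSign ρ y z = orderSign ρ z y := by
  rcases eq_or_ne y z with rfl | h
  · rfl
  · have h' : ρ y ≠ ρ z := fun H => h (ρ.injective H)
    have h1 := lt_or_gt_of_ne h
    have h2 := lt_or_gt_of_ne h'
    unfold orderSign
    rcases h1 with h1 | h1 <;> rcases h2 with h2 | h2 <;> simp [h1, h2, h1.not_gt, h2.not_gt]

/-- The parity of the number of inversions of an isomorphism among the half-edges at a vertex. -/
def Iso.vertexSign {Γ Γ' : OrGraph v e} (f : Iso Γ Γ') (y : Fin v) : ℤˣ :=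
  ∏ p ∈ ltPairs (HalfEdge e) with p.1 ∈ endsAt Γ.ends y ∧ p.2 ∈ endsAt Γ.ends y,
    if halfEdgeEquiv f.edge f.flip p.1 < halfEdgeEquiv f.edge f.flip p.2 then 1 else -1

/-- The contraction sign counts pairs of half-edges ordered oppositely by the edges and by the
vertices. A pair changes its status when exactly one of these orders is reversed: the reversals in
the edge order multiply to the sign of the half-edge bijection, those in the vertex order to a
product of `orderSign`. Pairs at a common vertex never count, and `vertexSign` corrects for them. -/
theorem Iso.contractionSign_eq {Γ Γ' : OrGraph v e} (f : Iso Γ Γ') :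
    contractionSign Γ' = contractionSign Γ * (∏ j, if f.flip j then -1 else 1) *
      ((∏ y, f.vertexSign y) * ∏ y ∈ ltPairs (Fin v),
        orderSign f.vertex y.1 y.2 ^ (Γ.valence y.1 * Γ.valence y.2)) := by
  set σ := halfEdgeEquiv f.edge f.flip with hσ
  -- This is the summand of the contraction sign made symmetric in `p` and `q`, so that it can be
  -- transported along `σ`.
  let s : HalfEdge e → HalfEdge e → ℤˣ := fun p q =>
    if (p < q ∧ Γ'.endAt q < Γ'.endAt p) ∨ (q < p ∧ Γ'.endAt p < Γ'.endAt q) then -1 else 1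
  have h1 : contractionSign Γ' = ∏ p ∈ ltPairs (HalfEdge e), s p.1 p.2 := by
    rw [contractionSign_eq_prod]
    refine Finset.prod_congr rfl fun p hp => ?_
    rw [mem_ltPairs] at hp
    simp [s, hp, hp.not_gt]
  let β : HalfEdge e → HalfEdge e → ℤˣ := fun p q => if σ p < σ q then 1 else -1
  let t : HalfEdge e → HalfEdge e → ℤˣ := fun p q =>
    if Γ.endAt p = Γ.endAt q then β p q else orderSign f.vertex (Γ.endAt p) (Γ.endAt q)
  have h2 : ∀ p ∈ ltPairs (HalfEdge e), s (σ p.1) (σ p.2) =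
      (if Γ.endAt p.2 < Γ.endAt p.1 then -1 else 1) * β p.1 p.2 * t p.1 p.2 := by
    rintro ⟨p, q⟩ hp
    rw [mem_ltPairs] at hp
    have hne : σ p ≠ σ q := fun H => hp.ne (σ.injective H)
    simp only [s, t, β, hσ, f.endAt_eq]
    rw [← hσ]
    by_cases hE : Γ.endAt p = Γ.endAt q
    · simp only [hE, lt_self_iff_false, and_false, or_self, if_false, if_true, one_mul]
      exact (Int.units_mul_self _).symm
    · have hE' : f.vertex (Γ.endAt p) ≠ f.vertex (Γ.endAt q) := fun H => hE (f.vertex.injective H)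
      rw [if_neg hE, orderSign]
      rcases lt_or_gt_of_ne hne with h1 | h1 <;> rcases lt_or_gt_of_ne hE with h2 | h2 <;>
        rcases lt_or_gt_of_ne hE' with h3 | h3 <;>
        simp [h1, h2, h3, h1.not_gt, h2.not_gt, h3.not_gt]
  rw [h1, ← prod_ltPairs_comp σ s fun p q => by simp only [s, or_comm], Finset.prod_congr rfl h2,
    Finset.prod_mul_distrib, Finset.prod_mul_distrib, ← contractionSign_eq_prod,
    ← sign_halfEdgeEquiv f.edge f.flip, ← hσ, ← Equiv.Perm.sign_eq_prod_ltPairs σ,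
    prod_ltPairs_eq_fiberwise Γ.endAt t]
  congr 2
  · refine Finset.prod_congr rfl fun y _ => ?_
    rw [Iso.vertexSign]
    refine Finset.prod_congr ?_ fun p hp => ?_
    · ext p
      simp only [Finset.mem_filter, mem_endsAt_iff]
    · simp only [Finset.mem_filter, mem_endsAt_iff] at hp
      simp only [t]
      rw [if_pos (hp.2.1.trans hp.2.2.symm)]
  · have h3 := prod_ltPairs_ne_fibers Γ.endAt (orderSign f.vertex) (orderSign_comm f.vertex)
    refine Eq.trans ?_ h3
    refine Finset.prod_congr rfl fun p hp => ?_
    simp only [t]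
    rw [if_neg (Finset.mem_filter.1 hp).2]

/-- For `z ≠ x` the factor is the product of the signs recording `z < x` and `ρ z < ρ x`; these
conditions hold for `x` and `ρ x` indices, respectively. -/
theorem prod_orderSign_fixed (ρ : Equiv.Perm (Fin v)) (x : Fin v) :
    ∏ z, orderSign ρ x z = (-1) ^ ((x : ℕ) + (ρ x : ℕ)) := by
  have h1 : ∀ y : Fin v, ∏ z : Fin v, (if z < y then -1 else 1 : ℤˣ) = (-1) ^ (y : ℕ) := fun y => by
    rw [← Finset.prod_filter, Finset.prod_const]
    have : (Finset.univ.filter fun a => a < y) = Finset.Iio y := by ext; simp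
    rw [this, Fin.card_Iio]
  rw [pow_add, ← h1, ← h1, ← Equiv.prod_comp ρ fun z => if z < ρ x then -1 else 1,
    ← Finset.prod_mul_distrib]
  refine Finset.prod_congr rfl fun z _ => ?_
  unfold orderSign
  rcases eq_or_ne x z with rfl | h
  · simp
  · have h' : ρ x ≠ ρ z := fun H => h (ρ.injective H)
    rcases lt_or_gt_of_ne h with h1 | h1 <;> rcases lt_or_gt_of_ne h' with h2 | h2 <;>
      simp [h1, h2, h1.not_gt, h2.not_gt]

theorem prod_orderSign (ρ : Equiv.Perm (Fin v)) :
    ∏ p ∈ ltPairs (Fin v), orderSign ρ p.1 p.2 = Equiv.Perm.sign ρ := by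
  rw [Equiv.Perm.sign_eq_prod_ltPairs_fin]
  refine Finset.prod_congr rfl fun p hp => ?_
  rw [mem_ltPairs] at hp
  simp [orderSign, hp]

/-- The Koszul sign of a permutation of tensors that are odd, except for one of parity `n + 1`. -/
theorem prod_orderSign_pow (ρ : Equiv.Perm (Fin v)) (x : Fin v) {n : ℕ} {N : Fin v → ℕ}
    (hx : N x = n + 1) (hN : ∀ y, y ≠ x → N y = 3) :
    ∏ p ∈ ltPairs (Fin v), orderSign ρ p.1 p.2 ^ (N p.1 * N p.2) =
      Equiv.Perm.sign ρ * (-1) ^ (n * ((x : ℕ) + (ρ x : ℕ))) := by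
  have hsq : ∀ y z, orderSign ρ y z ^ 2 = 1 := fun y z => Int.units_sq _
  -- Modulo `2` the exponent is `1` for two trivalent vertices and `n + 1` for a pair containing
  -- `x`, so the excess over `1` is concentrated at `x`.
  have h1 : ∀ p ∈ ltPairs (Fin v), orderSign ρ p.1 p.2 ^ (N p.1 * N p.2) =
      orderSign ρ p.1 p.2 * ((if p.1 = x then orderSign ρ p.1 p.2 ^ n else 1) *
        if p.2 = x then orderSign ρ p.1 p.2 ^ n else 1) := by
    rintro ⟨y, z⟩ hp
    rw [mem_ltPairs] at hp
    dsimp only at hp ⊢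
    have e3 : orderSign ρ y z ^ 3 = orderSign ρ y z := by rw [pow_succ, hsq, one_mul]
    by_cases hy : y = x
    · have hz : z ≠ x := fun h => hp.ne (hy.trans h.symm)
      rw [if_pos hy, if_neg hz, hN z hz, hy, hx, mul_comm, pow_mul, ← hy, e3, pow_succ', mul_one]
    · by_cases hz : z = x
      · rw [if_pos hz, if_neg hy, hN y hy, hz, hx, pow_mul, ← hz, e3, pow_succ', one_mul]
      · rw [if_neg hz, if_neg hy, hN y hy, hN z hz, pow_mul, e3, e3, mul_one, mul_one]
  rw [Finset.prod_congr rfl h1, Finset.prod_mul_distrib, prod_orderSign, mul_comm n, pow_mul,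
    ← prod_orderSign_fixed, ← Finset.prod_pow]
  congr 1
  rw [Finset.prod_mul_distrib, ltPairs, Finset.prod_filter, Finset.prod_filter,
    Fintype.prod_prod_type, Fintype.prod_prod_type_right]
  have h2 : ∏ y, ∏ z, (if y < z then if y = x then orderSign ρ y z ^ n else 1 else 1) =
      ∏ z, if x < z then orderSign ρ x z ^ n else 1 :=
    (Finset.prod_eq_single x (fun y _ hy => by simp [hy]) (by simp)).trans (by simp)
  have h3 : ∏ z, ∏ y, (if y < z then if z = x then orderSign ρ y z ^ n else 1 else 1) =
      ∏ y, if y < x then orderSign ρ y x ^ n else 1 :=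
    (Finset.prod_eq_single x (fun y _ hy => by simp [hy]) (by simp)).trans (by simp)
  refine (congrArg₂ _ h2 h3).trans ?_
  rw [← Finset.prod_mul_distrib]
  refine Finset.prod_congr rfl fun z _ => ?_
  rcases lt_trichotomy x z with h | rfl | h
  · simp [h, h.not_gt]
  · simp [orderSign]
  · simp [h, h.not_gt, orderSign_comm ρ z x]

end OrGraph

end Equivariance

/-! ### The function `Z`: orientation, valences and independence of the basis -/

noncomputable section AmplitudeProperties

open OrGraph

variable {k : Type*} [Field k] {L : Type*} [LieRing L] [LieAlgebra k L]
variable {ι : Type*} [Fintype ι] [DecidableEq ι] {v e : ℕ}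

theorem graphContraction_eq (h : LinearMap.BilinForm k L) (b : Module.Basis ι k L)
    (Γ : OrGraph v e) (T : Fin v → CochainFamily k L) :
    graphContraction h b Γ T = ((contractionSign Γ : ℤ) : k) * ∑ a : HalfEdge e → ι,
      (∏ y, vertexTensor h (T y) _ (sortedTuple (endsAt Γ.ends y) fun p => b (a p))) *
      ∏ j : Fin e, (LinearMap.BilinForm.toMatrix b h)⁻¹ (a (toLex (j, false)))
        (a (toLex (j, true))) := rfl

theorem inv_toMatrix_comm {h : LinearMap.BilinForm k L} (hsymm : h.IsSymm)
    (b : Module.Basis ι k L) (i j : ι) :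
    (LinearMap.BilinForm.toMatrix b h)⁻¹ i j = (LinearMap.BilinForm.toMatrix b h)⁻¹ j i := by
  have h1 : (LinearMap.BilinForm.toMatrix b h).transpose = LinearMap.BilinForm.toMatrix b h := by
    ext i j
    simp [LinearMap.BilinForm.toMatrix_apply, hsymm.eq (b j) (b i)]
  conv_lhs => rw [← h1, ← Matrix.transpose_nonsing_inv]
  rfl

/-- The behaviour of a graded contraction under isomorphisms of graphs. -/
theorem graphContraction_iso {h : LinearMap.BilinForm k L} (hsymm : h.IsSymm)
    (b : Module.Basis ι k L) {Γ Γ' : OrGraph v e} (f : Iso Γ Γ') {T T' : Fin v → CochainFamily k L}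
    (hT : ∀ y, TensorAntisymm (vertexTensor h (T y))) (hT' : ∀ y, T' (f.vertex y) = T y) :
    graphContraction h b Γ' T' =
      ((((∏ j, if f.flip j then -1 else 1) * ∏ y ∈ ltPairs (Fin v),
        orderSign f.vertex y.1 y.2 ^ (Γ.valence y.1 * Γ.valence y.2) : ℤˣ) : ℤ) : k) *
          graphContraction h b Γ T := by
  set σ := halfEdgeEquiv f.edge f.flip with hσ
  have h1 : ∀ a : HalfEdge e → ι,
      (∏ y, vertexTensor h (T' y) _ (sortedTuple (endsAt Γ'.ends y) fun p => b (a (σ.symm p)))) =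
      (((∏ y, f.vertexSign y : ℤˣ) : ℤ) : k) *
        ∏ y, vertexTensor h (T y) _ (sortedTuple (endsAt Γ.ends y) fun p => b (a p)) := fun a => by
    rw [← Equiv.prod_comp f.vertex]
    push_cast
    rw [← Finset.prod_mul_distrib]
    refine Finset.prod_congr rfl fun y _ => ?_
    rw [hT', (hT y).eval_sortedTuple σ (endsAt Γ.ends y) _ (f.halfEdgeEquiv_mem y)]
    congr 3
    funext p
    simp
  have h2 : ∀ a : HalfEdge e → ι, (∏ j : Fin e, (LinearMap.BilinForm.toMatrix b h)⁻¹
        (a (σ.symm (toLex (j, false)))) (a (σ.symm (toLex (j, true))))) =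
      ∏ j : Fin e, (LinearMap.BilinForm.toMatrix b h)⁻¹ (a (toLex (j, false)))
        (a (toLex (j, true))) := fun a => by
    rw [← Equiv.prod_comp f.edge]
    refine Finset.prod_congr rfl fun j _ => ?_
    have h3 : ∀ s, σ.symm (toLex (f.edge j, s)) = toLex (j, xor (f.flip j) s) := fun s => by
      rw [Equiv.symm_apply_eq, hσ, halfEdgeEquiv_apply, ← Bool.xor_assoc, Bool.xor_self,
        Bool.false_xor]
    rw [h3, h3]
    cases f.flip j
    · rfl
    · exact inv_toMatrix_comm hsymm b _ _
  rw [graphContraction_eq, graphContraction_eq,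
    ← Equiv.sum_comp (Equiv.arrowCongr σ (Equiv.refl ι))]
  change _ * ∑ a : HalfEdge e → ι,
    (∏ y, vertexTensor h (T' y) _ (sortedTuple (endsAt Γ'.ends y) fun p => b (a (σ.symm p)))) *
    (∏ j : Fin e, (LinearMap.BilinForm.toMatrix b h)⁻¹
      (a (σ.symm (toLex (j, false)))) (a (σ.symm (toLex (j, true))))) = _
  simp only [h1, h2, mul_assoc, ← Finset.mul_sum]
  rw [f.contractionSign_eq]
  -- The inversions inside the vertices occur twice, in the contraction sign and through the
  -- antisymmetry of the tensors, and so cancel.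
  have h4 := int_units_cast_mul_self (k := k) (∏ y, f.vertexSign y)
  push_cast at h4 ⊢
  rw [← mul_assoc, ← mul_assoc, ← mul_assoc]
  congr 1
  linear_combination ((contractionSign Γ : ℤ) : k) *
    (∏ j, ((if f.flip j then (-1 : ℤˣ) else 1 : ℤˣ) : ℤ) : k) *
    (∏ y ∈ ltPairs (Fin v), (((orderSign f.vertex y.1 y.2 : ℤˣ) : ℤ) : k) ^
      (Γ.valence y.1 * Γ.valence y.2)) * h4

theorem vertexTensor_single_eq_zero (h : LinearMap.BilinForm k L) {n N : ℕ}
    (φ : L [⋀^Fin n]→ₗ[k] L) (hN : N ≠ n + 1) (x : Fin N → L) :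
    vertexTensor h (Pi.single n φ) N x = 0 := by
  cases N with
  | zero => rfl
  | succ m => rw [vertexTensor, single_apply_of_ne φ (by omega)]; simp

/-- The families of cochains of a deformation of first order whose new term sits at `x`. -/
def vertexFamilies {n : ℕ} (φ : L [⋀^Fin n]→ₗ[k] L) (x : Fin v) : Fin v → CochainFamily k L :=
  Function.update (fun _ => lieFamily k L) x (Pi.single n φ)

theorem vertexFamilies_self {n : ℕ} (φ : L [⋀^Fin n]→ₗ[k] L) (x : Fin v) :
    vertexFamilies φ x x = Pi.single n φ := Function.update_self ..

theorem vertexFamilies_of_ne {n : ℕ} (φ : L [⋀^Fin n]→ₗ[k] L) {x y : Fin v} (hy : y ≠ x) :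
    vertexFamilies φ x y = lieFamily k L := Function.update_of_ne hy ..

theorem cocycleAmplitude_eq {n : ℕ} (φ : L [⋀^Fin n]→ₗ[k] L) (h : LinearMap.BilinForm k L)
    (b : Module.Basis ι k L) (Γ : OrGraph v e) :
    cocycleAmplitude φ h b Γ =
      ∑ x : Fin v, (-1) ^ (n * (x : ℕ)) * graphContraction h b Γ (vertexFamilies φ x) := rfl

theorem valence_of_graphContraction_ne_zero {n : ℕ} {φ : L [⋀^Fin n]→ₗ[k] L}
    {h : LinearMap.BilinForm k L} {b : Module.Basis ι k L} {Γ : OrGraph v e} {x : Fin v}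
    (hne : graphContraction h b Γ (vertexFamilies φ x) ≠ 0) :
    Γ.valence x = n + 1 ∧ ∀ y, y ≠ x → Γ.valence y = 3 := by
  have h1 : ∀ y, (∀ w, vertexTensor h (vertexFamilies φ x y) (Γ.valence y) w = 0) → False :=
    fun y hy => hne (by
      rw [graphContraction_eq]
      refine mul_eq_zero_of_right _ (Finset.sum_eq_zero fun a _ => mul_eq_zero_of_left ?_ _)
      exact Finset.prod_eq_zero (Finset.mem_univ y) (hy _))
  constructor
  · by_contra hN
    refine h1 x fun w => ?_
    rw [vertexFamilies_self]
    exact vertexTensor_single_eq_zero h φ hN w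
  · intro y hy
    by_contra hN
    refine h1 y fun w => ?_
    rw [vertexFamilies_of_ne φ hy]
    exact vertexTensor_single_eq_zero h _ hN w

theorem exists_valence_of_cocycleAmplitude_ne_zero {n : ℕ} {φ : L [⋀^Fin n]→ₗ[k] L}
    {h : LinearMap.BilinForm k L} {b : Module.Basis ι k L} {Γ : OrGraph v e}
    (hne : cocycleAmplitude φ h b Γ ≠ 0) :
    ∃ x, Γ.valence x = n + 1 ∧ ∀ y, y ≠ x → Γ.valence y = 3 := by
  rw [cocycleAmplitude_eq] at hne
  obtain ⟨x, -, hx⟩ := Finset.exists_ne_zero_of_sum_ne_zero hne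
  exact ⟨x, valence_of_graphContraction_ne_zero (right_ne_zero_of_mul hx)⟩

theorem tensorAntisymm_vertexFamilies {h : LinearMap.BilinForm k L} (hsymm : h.IsSymm)
    (hinv : h.lieInvariant L) {n : ℕ} {φ : L [⋀^Fin n]→ₗ[k] L} (hcyc : IsCyclicCochain h φ)
    (x y : Fin v) : TensorAntisymm (vertexTensor h (vertexFamilies φ x y)) := by
  by_cases hy : y = x
  · rw [hy, vertexFamilies_self]
    exact tensorAntisymm_vertexTensor hsymm (isCyclicCochain_single hcyc)
  · rw [vertexFamilies_of_ne φ hy]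
    exact tensorAntisymm_vertexTensor hsymm (isCyclicCochain_lieFamily hinv)

/-- The function `Z` changes sign with the orientation. -/
theorem cocycleAmplitude_isOrientationEquivariant {h : LinearMap.BilinForm k L} (hsymm : h.IsSymm)
    (hinv : h.lieInvariant L) {n : ℕ} {φ : L [⋀^Fin n]→ₗ[k] L} (hcyc : IsCyclicCochain h φ)
    (b : Module.Basis ι k L) :
    IsOrientationEquivariant fun Γ : OrGraph v e => cocycleAmplitude φ h b Γ := by
  intro Γ Γ' f
  dsimp only
  rw [cocycleAmplitude_eq, cocycleAmplitude_eq, ← Equiv.sum_comp f.vertex, Finset.mul_sum]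
  refine Finset.sum_congr rfl fun x _ => ?_
  rw [graphContraction_iso hsymm b f (T := vertexFamilies φ x)
    (tensorAntisymm_vertexFamilies hsymm hinv hcyc x) fun y => by
      by_cases hy : y = x
      · rw [hy, vertexFamilies_self, vertexFamilies_self]
      · rw [vertexFamilies_of_ne φ hy, vertexFamilies_of_ne φ (f.vertex.injective.ne hy)]]
  by_cases h0 : graphContraction h b Γ (vertexFamilies φ x) = 0
  · rw [h0]; simp
  · obtain ⟨hx, hy⟩ := valence_of_graphContraction_ne_zero h0
    rw [prod_orderSign_pow f.vertex x hx hy, Iso.sign]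
    -- The surplus Koszul sign at the special vertex is exactly the change in the cost of moving `t`
    -- to the left, from position `x` to `f.vertex x`.
    have h2 : ((-1 : k) ^ (n * (f.vertex x : ℕ))) * (-1) ^ (n * ((x : ℕ) + (f.vertex x : ℕ))) =
        (-1) ^ (n * (x : ℕ)) := by
      have h3 : n * (f.vertex x : ℕ) + n * ((x : ℕ) + (f.vertex x : ℕ)) =
          n * (x : ℕ) + 2 * (n * (f.vertex x : ℕ)) := by ring
      rw [← pow_add, h3, pow_add, pow_mul (-1 : k) 2]
      simp
    push_cast
    linear_combination (((Equiv.Perm.sign f.vertex : ℤˣ) : ℤ) : k) *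
      (∏ j, ((if f.flip j then (-1 : ℤˣ) else 1 : ℤˣ) : ℤ) : k) *
      graphContraction h b Γ (vertexFamilies φ x) * h2

/-- The inverse Gram matrix is a contravariant tensor. -/
theorem inv_toMatrix_basis_change {ι' : Type*} [Fintype ι'] [DecidableEq ι']
    {h : LinearMap.BilinForm k L} (hnondeg : h.Nondegenerate) (b : Module.Basis ι k L)
    (b' : Module.Basis ι' k L) :
    b.toMatrix b' * (LinearMap.BilinForm.toMatrix b' h)⁻¹ * (b.toMatrix b').transpose =
      (LinearMap.BilinForm.toMatrix b h)⁻¹ := by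
  symm
  apply Matrix.inv_eq_right_inv
  have hdet : IsUnit (LinearMap.BilinForm.toMatrix b' h).det :=
    isUnit_iff_ne_zero.2 ((LinearMap.BilinForm.nondegenerate_iff_det_ne_zero b').1 hnondeg)
  have hPQ : b.toMatrix b' * b'.toMatrix b = 1 := b.toMatrix_mul_toMatrix_flip b'
  have hQP : b'.toMatrix b * b.toMatrix b' = 1 := b'.toMatrix_mul_toMatrix_flip b
  rw [← LinearMap.BilinForm.toMatrix_mul_basis_toMatrix (b := b') b h]
  calc _ = (b'.toMatrix b).transpose * (LinearMap.BilinForm.toMatrix b' h *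
        (b'.toMatrix b * b.toMatrix b') * (LinearMap.BilinForm.toMatrix b' h)⁻¹) *
          (b.toMatrix b').transpose := by simp only [Matrix.mul_assoc]
    _ = 1 := by
      rw [hQP, Matrix.mul_one, Matrix.mul_nonsing_inv _ hdet, Matrix.mul_one,
        ← Matrix.transpose_mul, hPQ, Matrix.transpose_one]

/-- Labellings of the half-edges, as pairs of labels on the edges. -/
def halfEdgeLabelEquiv (e : ℕ) (ι : Type*) : (HalfEdge e → ι) ≃ (Fin e → ι × ι) where
  toFun a j := (a (toLex (j, false)), a (toLex (j, true)))
  invFun c p := bif (ofLex p).2 then (c (ofLex p).1).2 else (c (ofLex p).1).1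
  left_inv a := by
    funext p
    obtain ⟨⟨j, s⟩, rfl⟩ := toLex.surjective p
    cases s <;> rfl
  right_inv _ := rfl

theorem sum_prod_halfEdge {ι : Type*} [Fintype ι] (G : Fin e → ι → ι → k) :
    ∑ a : HalfEdge e → ι, ∏ j, G j (a (toLex (j, false))) (a (toLex (j, true))) =
      ∏ j, ∑ x, ∑ y, G j x y := by
  simp only [← Fintype.sum_prod_type']
  rw [Finset.prod_univ_sum, Fintype.piFinset_univ, ← Equiv.sum_comp (halfEdgeLabelEquiv e ι)]
  rfl

theorem prod_halfEdge {M : Type*} [CommMonoid M] (g : HalfEdge e → M) :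
    ∏ p, g p = ∏ j, g (toLex (j, false)) * g (toLex (j, true)) := by
  rw [← Equiv.prod_comp toLex, Fintype.prod_prod_type]
  simp only [Fintype.prod_bool, mul_comm]

/-- The contraction of a multilinear form with the inverse of the Gram matrix does not depend on
the basis. -/
theorem sum_multilinear_basis_change {ι' : Type*} [Fintype ι'] [DecidableEq ι']
    {h : LinearMap.BilinForm k L} (hnondeg : h.Nondegenerate) (b : Module.Basis ι k L)
    (b' : Module.Basis ι' k L) (G : MultilinearMap k (fun _ : HalfEdge e => L) k) :
    ∑ a : HalfEdge e → ι', (G fun p => b' (a p)) * ∏ j : Fin e,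
      (LinearMap.BilinForm.toMatrix b' h)⁻¹ (a (toLex (j, false))) (a (toLex (j, true))) =
    ∑ a : HalfEdge e → ι, (G fun p => b (a p)) * ∏ j : Fin e,
      (LinearMap.BilinForm.toMatrix b h)⁻¹ (a (toLex (j, false))) (a (toLex (j, true))) := by
  -- Each `b'` vector is expanded in `b`. The transition coefficients are then regrouped edge by
  -- edge, two for each entry of the inverse Gram matrix.
  have h1 : ∀ a' : HalfEdge e → ι', (G fun p => b' (a' p)) =
      ∑ a : HalfEdge e → ι, (∏ p, b.toMatrix b' (a p) (a' p)) * G fun p => b (a p) := fun a' => by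
    have h2 : (fun p => b' (a' p)) = fun p => ∑ i, b.toMatrix b' i (a' p) • b i := by
      funext p
      rw [b.sum_toMatrix_smul_self]
    rw [h2, G.map_sum]
    exact Finset.sum_congr rfl fun a _ => G.map_smul_univ _ _
  simp only [h1, Finset.sum_mul]
  rw [Finset.sum_comm]
  refine Finset.sum_congr rfl fun a _ => ?_
  rw [← inv_toMatrix_basis_change hnondeg b b']
  have h3 : ∀ i j, (b.toMatrix b' * (LinearMap.BilinForm.toMatrix b' h)⁻¹ *
      (b.toMatrix b').transpose) i j = ∑ x, ∑ y, b.toMatrix b' i x * b.toMatrix b' j y *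
        (LinearMap.BilinForm.toMatrix b' h)⁻¹ x y := fun i j => by
    simp only [Matrix.mul_apply, Finset.sum_mul, Matrix.transpose_apply]
    rw [Finset.sum_comm]
    exact Finset.sum_congr rfl fun x _ => Finset.sum_congr rfl fun y _ => by ring
  simp only [h3]
  rw [← sum_prod_halfEdge, Finset.mul_sum]
  refine Finset.sum_congr rfl fun a' _ => ?_
  rw [prod_halfEdge, mul_right_comm, ← Finset.prod_mul_distrib, mul_comm]

/-- The vertex tensor as a multilinear map. -/
def vertexMultilinear (h : LinearMap.BilinForm k L) (c : CochainFamily k L) :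
    (N : ℕ) → MultilinearMap k (fun _ : Fin N => L) k
  | 0 => 0
  | m + 1 => (h.compMultilinearMap (c m).toMultilinearMap).uncurryRight

theorem vertexMultilinear_apply (h : LinearMap.BilinForm k L) (c : CochainFamily k L) (N : ℕ)
    (x : Fin N → L) : vertexMultilinear h c N x = vertexTensor h c N x := by
  cases N <;> rfl

theorem sortedTuple_update {E M : Type*} [LinearOrder E] (S : Finset E) (x : E → M)
    (i : Fin S.card) (u : M) :
    sortedTuple S (Function.update x (S.orderEmbOfFin rfl i) u) =
      Function.update (sortedTuple S x) i u :=
  Function.update_comp_eq_of_injective x (S.orderEmbOfFin rfl).injective i u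

/-- A half-edge lies at exactly one vertex, so its vector enters a single factor of the product, in
a single argument. -/
theorem exists_prod_vertexTensor_update (h : LinearMap.BilinForm k L) (Γ : OrGraph v e)
    (T : Fin v → CochainFamily k L) (x : HalfEdge e → L) (p : HalfEdge e) :
    ∃ l : L →ₗ[k] k, ∀ u, l u = ∏ y, vertexTensor h (T y) _
      (sortedTuple (endsAt Γ.ends y) (Function.update x p u)) := by
  have hp : p ∈ endsAt Γ.ends (Γ.endAt p) := mem_endsAt_iff.2 rfl
  obtain ⟨i, hi⟩ : p ∈ Set.range ((endsAt Γ.ends (Γ.endAt p)).orderEmbOfFin rfl) := by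
    rw [Finset.range_orderEmbOfFin]; exact hp
  refine ⟨(∏ y ∈ Finset.univ.erase (Γ.endAt p), vertexTensor h (T y) _
      (sortedTuple (endsAt Γ.ends y) x)) • (vertexMultilinear h (T (Γ.endAt p)) _).toLinearMap
        (sortedTuple (endsAt Γ.ends (Γ.endAt p)) x) i, fun u => ?_⟩
  rw [← Finset.prod_erase_mul _ _ (Finset.mem_univ (Γ.endAt p)), LinearMap.smul_apply, smul_eq_mul]
  congr 1
  · refine Finset.prod_congr rfl fun y hy => ?_
    refine eval_sortedTuple_congr (vertexTensor h (T y)) _ fun q hq => ?_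
    rw [Function.update_of_ne]
    rintro rfl
    exact (Finset.mem_erase.1 hy).1 (mem_endsAt_iff.1 hq).symm
  · rw [MultilinearMap.toLinearMap_apply, vertexMultilinear_apply, ← sortedTuple_update, hi]

/-- The product of the vertex tensors of a graph as a multilinear form. -/
def vertexProduct (h : LinearMap.BilinForm k L) (Γ : OrGraph v e) (T : Fin v → CochainFamily k L) :
    MultilinearMap k (fun _ : HalfEdge e => L) k :=
  MultilinearMap.mk' (fun x => ∏ y, vertexTensor h (T y) _ (sortedTuple (endsAt Γ.ends y) x))
    (fun x p u w => by
      obtain ⟨l, hl⟩ := exists_prod_vertexTensor_update h Γ T x p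
      rw [← hl, ← hl, ← hl, map_add])
    (fun x p r u => by
      obtain ⟨l, hl⟩ := exists_prod_vertexTensor_update h Γ T x p
      rw [← hl, ← hl, map_smul])

theorem cocycleAmplitude_basis_change {ι' : Type*} [Fintype ι'] [DecidableEq ι']
    {h : LinearMap.BilinForm k L} (hnondeg : h.Nondegenerate) (b : Module.Basis ι k L)
    (b' : Module.Basis ι' k L) {n : ℕ} (φ : L [⋀^Fin n]→ₗ[k] L) (Γ : OrGraph v e) :
    cocycleAmplitude φ h b' Γ = cocycleAmplitude φ h b Γ := by
  rw [cocycleAmplitude_eq, cocycleAmplitude_eq]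
  refine Finset.sum_congr rfl fun x _ => congrArg _ ?_
  rw [graphContraction_eq, graphContraction_eq]
  exact congrArg _ (sum_multilinear_basis_change hnondeg b b'
    (vertexProduct h Γ (vertexFamilies φ x)))

end AmplitudeProperties

/-! ### Expansions of a graph at its last vertex -/

noncomputable section Expansions

open OrGraph

variable {k : Type*} [Field k] {L : Type*} [LieRing L] [LieAlgebra k L]

section SplittingSums

variable {E : Type*} [LinearOrder E]

/-- The subsets `B` of `S` such that `B` and its complement have at least two elements. -/
def stableSubsets (S : Finset E) : Finset (Finset E) :=
  S.powerset.filter fun B => 2 ≤ B.card ∧ 2 ≤ (S \ B).card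

/-- Graphs realize only splittings with at least two elements on each side. Nonzero terms have `|B|
= 2`, which makes `(-1)^|B|` harmless, and `|A| = n`, so nothing is lost when `2 ≤ n`. -/
theorem IsLieCocycle.sum_stable_splitTerm {h : LinearMap.BilinForm k L} (hsymm : h.IsSymm)
    (hinv : h.lieInvariant L) {n : ℕ} (hn : 1 ≤ n) {φ : L [⋀^Fin n]→ₗ[k] L}
    (hcyc : IsCyclicCochain h φ) (hcoc : IsLieCocycle φ) (S : Finset E) (x : E → L) :
    ∑ B ∈ stableSubsets S,
      (-1) ^ B.card * splitTerm h (Pi.single n φ) (lieFamily k L) x (S \ B) B = 0 := by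
  have h1 : ∀ B, (-1 : k) ^ B.card * splitTerm h (Pi.single n φ) (lieFamily k L) x (S \ B) B =
      splitTerm h (Pi.single n φ) (lieFamily k L) x (S \ B) B := fun B => by
    by_cases h0 : splitTerm h (Pi.single n φ) (lieFamily k L) x (S \ B) B = 0
    · rw [h0, mul_zero]
    · rw [(card_of_splitTerm_ne_zero h0).2]
      simp
  simp only [h1]
  rcases hn.eq_or_lt with rfl | hn'
  -- For `n = 1` the side carrying `φ` would have one element, so no stable splitting contributes at
  -- all.
  · refine Finset.sum_eq_zero fun B hB => ?_
    by_contra h0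
    have h2 := (Finset.mem_filter.1 hB).2.2
    rw [(card_of_splitTerm_ne_zero h0).1] at h2
    omega
  · rw [← hcoc.sum_splitTerm hsymm hinv hn hcyc S x]
    refine Finset.sum_subset (Finset.filter_subset _ _) fun B hB hB' => ?_
    by_contra h0
    have h2 := card_of_splitTerm_ne_zero h0
    exact hB' (Finset.mem_filter.2 ⟨hB, h2.2.ge, by omega⟩)

/-- Stability is symmetric in the two parts, and exchanging them changes the sum only by the overall
sign `(-1)^n`, as one part has two elements. -/
theorem IsLieCocycle.sum_stable_splitTerm_swap {h : LinearMap.BilinForm k L} (hsymm : h.IsSymm)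
    (hinv : h.lieInvariant L) {n : ℕ} (hn : 1 ≤ n) {φ : L [⋀^Fin n]→ₗ[k] L}
    (hcyc : IsCyclicCochain h φ) (hcoc : IsLieCocycle φ) (S : Finset E) (x : E → L) :
    ∑ B ∈ stableSubsets S,
      (-1) ^ B.card * splitTerm h (lieFamily k L) (Pi.single n φ) x (S \ B) B = 0 := by
  have h1 : ∑ B ∈ stableSubsets S,
      (-1) ^ B.card * splitTerm h (lieFamily k L) (Pi.single n φ) x (S \ B) B =
      ∑ B ∈ stableSubsets S, (-1) ^ n *
        ((-1) ^ B.card * splitTerm h (Pi.single n φ) (lieFamily k L) x (S \ B) B) := by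
    have hsub : ∀ B ∈ stableSubsets S, S \ (S \ B) = B := fun B hB =>
      Finset.sdiff_sdiff_eq_self (Finset.mem_powerset.1 (Finset.mem_filter.1 hB).1)
    have hmem : ∀ B ∈ stableSubsets S, S \ B ∈ stableSubsets S := fun B hB => by
      refine Finset.mem_filter.2 ⟨Finset.mem_powerset.2 Finset.sdiff_subset, ?_⟩
      rw [hsub B hB]
      exact (Finset.mem_filter.1 hB).2.symm
    refine Finset.sum_bij' (fun B _ => S \ B) (fun B _ => S \ B) hmem hmem hsub hsub fun B hB => ?_
    rw [hsub B hB, splitTerm_swap hsymm _ _ x B (S \ B) Finset.disjoint_sdiff]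
    by_cases h0 : splitTerm h (Pi.single n φ) (lieFamily k L) x B (S \ B) = 0
    · simp [h0]
    · rw [(card_of_splitTerm_ne_zero h0).1, (card_of_splitTerm_ne_zero h0).2, pow_mul']
      simp
  rw [h1, ← Finset.mul_sum, hcoc.sum_stable_splitTerm hsymm hinv hn hcyc, mul_zero]

end SplittingSums

variable {e w : ℕ}

/-- The inclusion of the half-edges of all edges but the last one. -/
def liftHalfEdge (e : ℕ) : HalfEdge e ↪o HalfEdge (e + 1) :=
  OrderEmbedding.ofStrictMono (fun p => toLex ((ofLex p).1.castSucc, (ofLex p).2)) fun p q hpq => by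
    rw [Prod.Lex.lt_iff] at hpq ⊢
    simpa using hpq

theorem liftHalfEdge_apply (p : HalfEdge e) :
    liftHalfEdge e p = toLex ((ofLex p).1.castSucc, (ofLex p).2) := rfl

/-- The two half-edges of the last edge. -/
def lastHalfEdge (e : ℕ) (s : Bool) : HalfEdge (e + 1) := toLex (Fin.last e, s)

theorem liftHalfEdge_lt_last (p : HalfEdge e) (s : Bool) : liftHalfEdge e p < lastHalfEdge e s := by
  rw [Prod.Lex.lt_iff]
  exact Or.inl (Fin.castSucc_lt_last _)

theorem lastHalfEdge_lt : lastHalfEdge e false < lastHalfEdge e true := by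
  rw [Prod.Lex.lt_iff]
  exact Or.inr ⟨rfl, (by decide : false < true)⟩

theorem halfEdge_cases (p : HalfEdge (e + 1)) :
    (∃ q, p = liftHalfEdge e q) ∨ ∃ s, p = lastHalfEdge e s := by
  obtain ⟨⟨j, s⟩, rfl⟩ := toLex.surjective p
  refine Fin.lastCases (Or.inr ⟨s, rfl⟩) (fun j => Or.inl ⟨toLex (j, s), rfl⟩) j

theorem prod_halfEdge_succ {M : Type*} [CommMonoid M] (g : HalfEdge (e + 1) → M) :
    ∏ p, g p = (∏ p, g (liftHalfEdge e p)) * (g (lastHalfEdge e false) * g (lastHalfEdge e true)) := by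
  rw [prod_halfEdge, Fin.prod_univ_castSucc, prod_halfEdge]
  rfl

/-- The half-edges at the last vertex of an expansion, other than that of the last edge. -/
def movedHalfEdges (Γ : OrGraph (w + 2) (e + 1)) : Finset (HalfEdge e) :=
  Finset.univ.filter fun p => Γ.endAt (liftHalfEdge e p) = Fin.last (w + 1)

theorem mem_movedHalfEdges {Γ : OrGraph (w + 2) (e + 1)} {p : HalfEdge e} :
    p ∈ movedHalfEdges Γ ↔ Γ.endAt (liftHalfEdge e p) = Fin.last (w + 1) := by
  simp [movedHalfEdges]

namespace IsExpansion

variable {Δ : OrGraph (w + 1) e} {Γ : OrGraph (w + 2) (e + 1)}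

theorem endAt_last_false (hΓ : IsExpansion Δ Γ) :
    Γ.endAt (lastHalfEdge e false) = (Fin.last w).castSucc := hΓ.source

theorem endAt_last_true (hΓ : IsExpansion Δ Γ) :
    Γ.endAt (lastHalfEdge e true) = Fin.last (w + 1) := hΓ.target

theorem endAt_castSucc (hΓ : IsExpansion Δ Γ) (p : HalfEdge e) : (Δ.endAt p).castSucc =
    if p ∈ movedHalfEdges Γ then (Fin.last w).castSucc else Γ.endAt (liftHalfEdge e p) := by
  simp only [mem_movedHalfEdges]
  exact hΓ.ends_eq _ _

theorem endAt_lift (hΓ : IsExpansion Δ Γ) (p : HalfEdge e) : Γ.endAt (liftHalfEdge e p) =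
    if p ∈ movedHalfEdges Γ then Fin.last (w + 1) else (Δ.endAt p).castSucc := by
  split_ifs with hp
  · exact mem_movedHalfEdges.1 hp
  · rw [hΓ.endAt_castSucc, if_neg hp]

theorem movedHalfEdges_subset (hΓ : IsExpansion Δ Γ) :
    movedHalfEdges Γ ⊆ endsAt Δ.ends (Fin.last w) := fun p hp => by
  rw [mem_endsAt_iff]
  have h1 := hΓ.endAt_castSucc p
  rw [if_pos hp] at h1
  exact Fin.castSucc_injective _ h1

theorem endsAt_castSucc_castSucc (hΓ : IsExpansion Δ Γ) (y : Fin w) :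
    endsAt Γ.ends y.castSucc.castSucc =
      (endsAt Δ.ends y.castSucc).map (liftHalfEdge e).toEmbedding := by
  ext p
  rw [mem_endsAt_iff]
  rcases halfEdge_cases p with ⟨q, rfl⟩ | ⟨s, rfl⟩
  · rw [hΓ.endAt_lift]
    simp only [Finset.mem_map, mem_endsAt_iff, RelEmbedding.coe_toEmbedding,
      EmbeddingLike.apply_eq_iff_eq, exists_eq_right]
    split_ifs with hq
    · have h1 := mem_endsAt_iff.1 (hΓ.movedHalfEdges_subset hq)
      rw [h1]
      exact iff_of_false (Fin.castSucc_lt_last _).ne' (Fin.castSucc_lt_last _).ne'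
    · exact (Fin.castSucc_injective _).eq_iff
  · refine iff_of_false ?_ ?_
    · cases s
      · rw [hΓ.endAt_last_false]
        exact fun H => (Fin.castSucc_lt_last y).ne' (Fin.castSucc_injective _ H)
      · rw [hΓ.endAt_last_true]
        exact (Fin.castSucc_lt_last _).ne'
    · simp only [Finset.mem_map, RelEmbedding.coe_toEmbedding, not_exists, not_and]
      exact fun q _ H => (liftHalfEdge_lt_last q s).ne H

theorem endsAt_source (hΓ : IsExpansion Δ Γ) :
    endsAt Γ.ends (Fin.last w).castSucc = insert (lastHalfEdge e false)
      ((endsAt Δ.ends (Fin.last w) \ movedHalfEdges Γ).map (liftHalfEdge e).toEmbedding) := by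
  ext p
  rw [mem_endsAt_iff]
  rcases halfEdge_cases p with ⟨q, rfl⟩ | ⟨s, rfl⟩
  · rw [hΓ.endAt_lift]
    simp only [Finset.mem_insert, (liftHalfEdge_lt_last q false).ne, false_or, Finset.mem_map,
      RelEmbedding.coe_toEmbedding, EmbeddingLike.apply_eq_iff_eq, exists_eq_right,
      Finset.mem_sdiff, mem_endsAt_iff]
    split_ifs with hq
    · exact iff_of_false (Fin.castSucc_lt_last _).ne' (by simp [hq])
    · simp [hq]
  · have h1 : lastHalfEdge e s ∉
        (endsAt Δ.ends (Fin.last w) \ movedHalfEdges Γ).map (liftHalfEdge e).toEmbedding := by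
      simp only [Finset.mem_map, RelEmbedding.coe_toEmbedding, not_exists, not_and]
      exact fun q _ H => (liftHalfEdge_lt_last q s).ne H
    simp only [Finset.mem_insert, h1, or_false]
    cases s
    · simp [hΓ.endAt_last_false]
    · rw [hΓ.endAt_last_true]
      exact iff_of_false (Fin.castSucc_lt_last _).ne' lastHalfEdge_lt.ne'

theorem endsAt_target (hΓ : IsExpansion Δ Γ) :
    endsAt Γ.ends (Fin.last (w + 1)) = insert (lastHalfEdge e true)
      ((movedHalfEdges Γ).map (liftHalfEdge e).toEmbedding) := by
  ext p
  rw [mem_endsAt_iff]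
  rcases halfEdge_cases p with ⟨q, rfl⟩ | ⟨s, rfl⟩
  · simp only [Finset.mem_insert, (liftHalfEdge_lt_last q true).ne, false_or, Finset.mem_map,
      RelEmbedding.coe_toEmbedding, EmbeddingLike.apply_eq_iff_eq, exists_eq_right,
      mem_movedHalfEdges]
  · have h1 : lastHalfEdge e s ∉ (movedHalfEdges Γ).map (liftHalfEdge e).toEmbedding := by
      simp only [Finset.mem_map, RelEmbedding.coe_toEmbedding, not_exists, not_and]
      exact fun q _ H => (liftHalfEdge_lt_last q s).ne H
    simp only [Finset.mem_insert, h1, or_false]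
    cases s
    · rw [hΓ.endAt_last_false]
      exact iff_of_false (Fin.castSucc_lt_last _).ne lastHalfEdge_lt.ne
    · simp [hΓ.endAt_last_true]

/-- The sign of the graded contraction along an expansion. -/
theorem contractionSign_eq (hΓ : IsExpansion Δ Γ) : contractionSign Γ = contractionSign Δ *
    (splitSign (endsAt Δ.ends (Fin.last w) \ movedHalfEdges Γ) (movedHalfEdges Γ) *
      (-1) ^ (movedHalfEdges Γ).card) := by
  set B := movedHalfEdges Γ with hB
  set S := endsAt Δ.ends (Fin.last w) with hS
  have hlast : ∀ y : Fin (w + 2), ¬ Fin.last (w + 1) < y := fun y => (Fin.le_last y).not_gt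
  rw [contractionSign_eq_prod, ltPairs, Finset.prod_filter, Fintype.prod_prod_type,
    prod_halfEdge_succ]
  simp only [prod_halfEdge_succ, OrderEmbedding.lt_iff_lt, liftHalfEdge_lt_last, if_true,
    (liftHalfEdge_lt_last _ _).not_gt, if_false, lt_irrefl, lastHalfEdge_lt, lastHalfEdge_lt.not_gt,
    hΓ.endAt_last_true, hΓ.endAt_last_false, hlast, Finset.prod_const_one, mul_one]
  -- Against the source half-edge of the new edge, exactly the moved half-edges form inversions:
  -- they precede it but sit at a later vertex. This yields `(-1)^|B|`.
  have h1 : ∀ p, (if (Fin.last w).castSucc < Γ.endAt (liftHalfEdge e p) then -1 else 1 : ℤˣ) =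
      if p ∈ B then -1 else 1 := fun p => by
    rw [hΓ.endAt_lift]
    by_cases hp : p ∈ B
    · rw [if_pos hp, if_pos hp, if_pos (Fin.castSucc_lt_last _)]
    · rw [if_neg hp, if_neg hp, if_neg]
      rw [Fin.castSucc_lt_castSucc_iff]
      exact (Fin.le_last _).not_gt
  -- Among the old half-edges the only new inversions have `p` moved, `q` left behind at the split
  -- vertex, and `p < q`; they make up the shuffle sign.
  have h2 : ∀ p q, (if p < q then
        if Γ.endAt (liftHalfEdge e q) < Γ.endAt (liftHalfEdge e p) then -1 else 1 else 1 : ℤˣ) =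
      (if p < q then if Δ.endAt q < Δ.endAt p then -1 else 1 else 1) *
        if q ∈ S \ B then if p ∈ B then if p < q then -1 else 1 else 1 else 1 := fun p q => by
    by_cases hpq : p < q
    · simp only [if_pos hpq]
      have hmS : q ∈ S \ B ↔ Δ.endAt q = Fin.last w ∧ q ∉ B := by
        rw [Finset.mem_sdiff, hS, mem_endsAt_iff]
      rw [hΓ.endAt_lift, hΓ.endAt_lift, ← hB]
      simp only [hmS]
      have hend : ∀ p, p ∈ B → Δ.endAt p = Fin.last w := fun p hp =>
        mem_endsAt_iff.1 (hΓ.movedHalfEdges_subset hp)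
      have hlt : ∀ y : Fin (w + 1), y < Fin.last w ↔ ¬ y = Fin.last w := fun y =>
        Fin.lt_last_iff_ne_last
      have hlast' : ∀ y : Fin (w + 1), ¬ Fin.last w < y := fun y => (Fin.le_last y).not_gt
      by_cases hp : p ∈ B <;> by_cases hq : q ∈ B
      · simp [hp, hq, hend]
      · by_cases hqS : Δ.endAt q = Fin.last w <;>
          simp [hp, hq, hend p hp, hqS, Fin.castSucc_lt_last, hlt]
      · simp [hp, hq, hend q hq, hlast, hlast']
      · simp [hp, hq]
    · simp [hpq]
  simp only [h1, h2, Finset.prod_mul_distrib]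
  rw [mul_assoc]
  congr 1
  · rw [contractionSign_eq_prod, ltPairs, Finset.prod_filter, Fintype.prod_prod_type]
  congr 1
  · rw [Finset.prod_comm, splitSign]
    simp only [Finset.prod_ite_irrel, Finset.prod_const_one, Finset.prod_ite_mem, Finset.univ_inter]
  · rw [← Finset.prod_const, Finset.prod_ite_mem, Finset.univ_inter]

end IsExpansion

end Expansions

/-! ### Gluing along the new edge, and vanishing of the sum over expansions -/

noncomputable section CycleProof

open OrGraph

variable {k : Type*} [Field k] {L : Type*} [LieRing L] [LieAlgebra k L]
variable {ι : Type*} [Fintype ι] [DecidableEq ι] {e w : ℕ}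

/-- The inverse of the Gram matrix contracts two arguments of the bilinear form to one. -/
theorem sum_inv_toMatrix {h : LinearMap.BilinForm k L} (hsymm : h.IsSymm)
    (hnondeg : h.Nondegenerate) (b : Module.Basis ι k L) (u u' : L) :
    ∑ i, ∑ i', h u (b i) * h u' (b i') * (LinearMap.BilinForm.toMatrix b h)⁻¹ i i' = h u u' := by
  have hdet : IsUnit (LinearMap.BilinForm.toMatrix b h).det :=
    isUnit_iff_ne_zero.2 ((LinearMap.BilinForm.nondegenerate_iff_det_ne_zero b).1 hnondeg)
  have h1 : ∀ i', ∑ i, h u (b i) * (LinearMap.BilinForm.toMatrix b h)⁻¹ i i' = b.repr u i' := by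
    intro i'
    have h2 : ∀ i, h u (b i) = ∑ l, b.repr u l * LinearMap.BilinForm.toMatrix b h l i := fun i => by
      conv_lhs => rw [← b.sum_repr u]
      simp only [map_sum, map_smul, LinearMap.coe_sum, Finset.sum_apply, LinearMap.smul_apply,
        smul_eq_mul, LinearMap.BilinForm.toMatrix_apply]
    simp only [h2, Finset.sum_mul, mul_assoc]
    rw [Finset.sum_comm]
    simp only [← Finset.mul_sum, ← Matrix.mul_apply, Matrix.mul_nonsing_inv _ hdet, Matrix.one_apply]
    simp
  rw [Finset.sum_comm]
  calc _ = ∑ i', h u' (b i') * ∑ i, h u (b i) * (LinearMap.BilinForm.toMatrix b h)⁻¹ i i' := by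
        refine Finset.sum_congr rfl fun i' _ => ?_
        rw [Finset.mul_sum]
        exact Finset.sum_congr rfl fun i _ => by ring
    _ = h u' (∑ i', b.repr u i' • b i') := by
        simp only [h1, map_sum, map_smul, smul_eq_mul, mul_comm]
    _ = h u u' := by rw [b.sum_repr, hsymm.eq]

/-- Labellings of the half-edges, split into those of the last edge and the others. -/
def splitLabelEquiv (e : ℕ) (ι : Type*) : (HalfEdge (e + 1) → ι) ≃ (HalfEdge e → ι) × ι × ι where
  toFun a := (fun p => a (liftHalfEdge e p), a (lastHalfEdge e false), a (lastHalfEdge e true))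
  invFun c p := Fin.lastCases (bif (ofLex p).2 then c.2.2 else c.2.1)
    (fun j => c.1 (toLex (j, (ofLex p).2))) (ofLex p).1
  left_inv a := by
    funext p
    rcases halfEdge_cases p with ⟨q, rfl⟩ | ⟨s, rfl⟩
    · simp [liftHalfEdge_apply]
    · cases s <;> simp [lastHalfEdge]
  right_inv c := by
    obtain ⟨a, i, i'⟩ := c
    simp [liftHalfEdge_apply, lastHalfEdge]

/-- The half-edges of the last edge are the largest, so at both of its ends the new edge occupies
the leg outside the cochain, ready to be glued. -/
theorem vertexTensor_insert_last {E F : Type*} [LinearOrder E] [LinearOrder F]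
    (h : LinearMap.BilinForm k L) (c : CochainFamily k L) (o : E ↪o F) (S : Finset E) (q : F)
    (hq : ∀ p, o p < q) (x : F → L) :
    vertexTensor h c _ (sortedTuple (insert q (S.map o.toEmbedding)) x) =
      h (c _ (sortedTuple S (x ∘ o))) (x q) := by
  have hq' : q ∉ S.map o.toEmbedding := by
    simp only [Finset.mem_map, RelEmbedding.coe_toEmbedding, not_exists, not_and]
    exact fun p _ H => (hq p).ne H
  have hcard : (insert q (S.map o.toEmbedding)).card = S.card + 1 := by
    rw [Finset.card_insert_of_notMem hq', Finset.card_map]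
  rw [eval_sortedTuple_eq_of_strictMono (vertexTensor h c) _ x hcard
    (Fin.snoc (α := fun _ => F) (fun i => o (S.orderEmbOfFin rfl i)) q) ?_ ?_]
  · simp only [vertexTensor, Fin.snoc_castSucc, Fin.snoc_last]
    rfl
  · intro i j hij
    induction j using Fin.lastCases with
    | last =>
      obtain ⟨i, rfl⟩ := Fin.exists_castSucc_eq.2 hij.ne
      rw [Fin.snoc_castSucc, Fin.snoc_last]
      exact hq _
    | cast j =>
      obtain ⟨i, rfl⟩ := Fin.exists_castSucc_eq.2 (hij.trans (Fin.castSucc_lt_last j)).ne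
      rw [Fin.snoc_castSucc, Fin.snoc_castSucc]
      simpa using hij
  · intro i
    induction i using Fin.lastCases with
    | last => simp
    | cast i =>
      rw [Fin.snoc_castSucc]
      exact Finset.mem_insert_of_mem (Finset.mem_map_of_mem _ (Finset.orderEmbOfFin_mem _ _ _))

theorem vertexTensor_map {E F : Type*} [LinearOrder E] [LinearOrder F]
    (h : LinearMap.BilinForm k L) (c : CochainFamily k L) (o : E ↪o F) (S : Finset E) (x : F → L) :
    vertexTensor h c _ (sortedTuple (S.map o.toEmbedding) x) =
      vertexTensor h c _ (sortedTuple S (x ∘ o)) :=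
  eval_sortedTuple_eq_of_strictMono (vertexTensor h c) _ x (Finset.card_map _)
    (fun i => o (S.orderEmbOfFin rfl i)) (o.strictMono.comp (OrderEmbedding.strictMono _))
    fun i => by simp [Finset.orderEmbOfFin_mem]

/-- The contraction along `Δ` of vertex tensors at all vertices but the last one, where the term of
a quadratic relation is placed. -/
def expandedContraction (h : LinearMap.BilinForm k L) (b : Module.Basis ι k L)
    (Δ : OrGraph (w + 1) e) (T : Fin w → CochainFamily k L) (c c' : CochainFamily k L)
    (B : Finset (HalfEdge e)) : k :=
  ((contractionSign Δ : ℤ) : k) * ∑ a : HalfEdge e → ι,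
    (∏ y : Fin w, vertexTensor h (T y) _
      (sortedTuple (endsAt Δ.ends y.castSucc) fun p => b (a p))) *
    (∏ j : Fin e, (LinearMap.BilinForm.toMatrix b h)⁻¹ (a (toLex (j, false)))
      (a (toLex (j, true)))) *
    ((-1) ^ B.card *
      splitTerm h c c' (fun p => b (a p)) (endsAt Δ.ends (Fin.last w) \ B) B)

/-- Summing over the two labels of the new edge replaces the tensors at its ends by `h (c …) (c'
…)`; together with the signs created by the expansion this is `(-1)^|B|` times a `splitTerm`. -/
theorem IsExpansion.graphContraction_eq {h : LinearMap.BilinForm k L} (hsymm : h.IsSymm)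
    (hnondeg : h.Nondegenerate) (b : Module.Basis ι k L) {Δ : OrGraph (w + 1) e}
    {Γ : OrGraph (w + 2) (e + 1)} (hΓ : IsExpansion Δ Γ) (T : Fin (w + 2) → CochainFamily k L) :
    graphContraction h b Γ T = expandedContraction h b Δ (fun y => T y.castSucc.castSucc)
      (T (Fin.last w).castSucc) (T (Fin.last (w + 1))) (movedHalfEdges Γ) := by
  rw [_root_.graphContraction_eq, expandedContraction, hΓ.contractionSign_eq]
  push_cast
  rw [mul_assoc]
  congr 1
  rw [Finset.mul_sum, ← Equiv.sum_comp (splitLabelEquiv e ι).symm, Fintype.sum_prod_type]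
  refine Finset.sum_congr rfl fun a _ => ?_
  rw [← Finset.mul_sum]
  have h1 : ∀ (i i' : ι) (p : HalfEdge e), (splitLabelEquiv e ι).symm (a, i, i')
      (liftHalfEdge e p) = a p := fun i i' p =>
    congrFun (congrArg Prod.fst ((splitLabelEquiv e ι).apply_symm_apply (a, i, i'))) p
  have h2 : ∀ (i i' : ι), (splitLabelEquiv e ι).symm (a, i, i') (lastHalfEdge e false) = i :=
    fun i i' => congrArg (fun x => x.2.1) ((splitLabelEquiv e ι).apply_symm_apply (a, i, i'))
  have h3 : ∀ (i i' : ι), (splitLabelEquiv e ι).symm (a, i, i') (lastHalfEdge e true) = i' :=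
    fun i i' => congrArg (fun x => x.2.2) ((splitLabelEquiv e ι).apply_symm_apply (a, i, i'))
  have h4 : ∀ i i' : ι, (∏ y, vertexTensor h (T y) _ (sortedTuple (endsAt Γ.ends y) fun p =>
      b ((splitLabelEquiv e ι).symm (a, i, i') p))) =
      (∏ y : Fin w, vertexTensor h (T y.castSucc.castSucc) _
        (sortedTuple (endsAt Δ.ends y.castSucc) fun p => b (a p))) *
      (h (T (Fin.last w).castSucc _ (sortedTuple (endsAt Δ.ends (Fin.last w) \ movedHalfEdges Γ)
          fun p => b (a p))) (b i) *
        h (T (Fin.last (w + 1)) _ (sortedTuple (movedHalfEdges Γ) fun p => b (a p))) (b i')) :=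
    fun i i' => by
      have e1 : (fun p => b ((splitLabelEquiv e ι).symm (a, i, i') p)) ∘ liftHalfEdge e =
          fun p => b (a p) := funext fun p => by simp only [Function.comp, h1]
      rw [Fin.prod_univ_castSucc, Fin.prod_univ_castSucc, mul_assoc, hΓ.endsAt_source,
        hΓ.endsAt_target, vertexTensor_insert_last h _ _ _ _ fun p => liftHalfEdge_lt_last p _,
        vertexTensor_insert_last h _ _ _ _ fun p => liftHalfEdge_lt_last p _, h2, h3, e1]
      congr 1
      refine Finset.prod_congr rfl fun y _ => ?_
      rw [hΓ.endsAt_castSucc_castSucc, vertexTensor_map, e1]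
  have h5 : ∀ i i' : ι, (∏ j : Fin (e + 1), (LinearMap.BilinForm.toMatrix b h)⁻¹
      ((splitLabelEquiv e ι).symm (a, i, i') (toLex (j, false)))
      ((splitLabelEquiv e ι).symm (a, i, i') (toLex (j, true)))) =
      (∏ j : Fin e, (LinearMap.BilinForm.toMatrix b h)⁻¹ (a (toLex (j, false)))
        (a (toLex (j, true)))) * (LinearMap.BilinForm.toMatrix b h)⁻¹ i i' := fun i i' => by
    rw [Fin.prod_univ_castSucc]
    refine congrArg₂ _ (Finset.prod_congr rfl fun j _ => ?_) (congrArg₂ _ (h2 i i') (h3 i i'))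
    exact congrArg₂ _ (h1 i i' (toLex (j, false))) (h1 i i' (toLex (j, true)))
  simp only [h4, h5]
  rw [Fintype.sum_prod_type, splitTerm, ← sum_inv_toMatrix hsymm hnondeg b]
  simp only [Finset.mul_sum]
  refine Finset.sum_congr rfl fun i _ => Finset.sum_congr rfl fun i' _ => ?_
  ring

/-- Both ends of the new edge are at least trivalent, and one half-edge at each belongs to the new
edge. -/
theorem IsExpansion.movedHalfEdges_mem {Δ : OrGraph (w + 1) e} {Γ : OrGraph (w + 2) (e + 1)}
    (hΓ : IsExpansion Δ Γ) :
    movedHalfEdges Γ ∈ stableSubsets (endsAt Δ.ends (Fin.last w)) := by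
  refine Finset.mem_filter.2 ⟨Finset.mem_powerset.2 hΓ.movedHalfEdges_subset, ?_⟩
  have h1 := Γ.three_le (Fin.last (w + 1))
  have h2 := Γ.three_le (Fin.last w).castSucc
  have h3 := Finset.card_insert_le (lastHalfEdge e true)
    ((movedHalfEdges Γ).map (liftHalfEdge e).toEmbedding)
  have h4 := Finset.card_insert_le (lastHalfEdge e false)
    ((endsAt Δ.ends (Fin.last w) \ movedHalfEdges Γ).map (liftHalfEdge e).toEmbedding)
  rw [hΓ.endsAt_target] at h1
  rw [hΓ.endsAt_source] at h2
  rw [Finset.card_map] at h3 h4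
  omega

/-- The endpoint map of the expansion of a graph. -/
def expansionEnds (Δ : OrGraph (w + 1) e) (B : Finset (HalfEdge e)) (j : Fin (e + 1)) (s : Bool) :
    Fin (w + 2) :=
  Fin.lastCases (bif s then Fin.last (w + 1) else (Fin.last w).castSucc)
    (fun j => if toLex (j, s) ∈ B then Fin.last (w + 1) else (Δ.ends j s).castSucc) j

theorem exists_expansion (Δ : OrGraph (w + 1) e) {B : Finset (HalfEdge e)}
    (hB : B ∈ stableSubsets (endsAt Δ.ends (Fin.last w))) :
    ∃ Γ : OrGraph (w + 2) (e + 1), IsExpansion Δ Γ ∧ movedHalfEdges Γ = B := by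
  obtain ⟨hBS, hB2, hA2⟩ := Finset.mem_filter.1 hB
  rw [Finset.mem_powerset] at hBS
  have hcast : ∀ (j : Fin e) (s : Bool), expansionEnds Δ B j.castSucc s =
      if toLex (j, s) ∈ B then Fin.last (w + 1) else (Δ.ends j s).castSucc := fun j s => by
    simp [expansionEnds]
  have hcast' : ∀ p : HalfEdge e, expansionEnds Δ B (ofLex p).1.castSucc (ofLex p).2 =
      if p ∈ B then Fin.last (w + 1) else (Δ.ends (ofLex p).1 (ofLex p).2).castSucc :=
    fun p => hcast _ _
  have hlast : ∀ s : Bool, expansionEnds Δ B (Fin.last e) s =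
      bif s then Fin.last (w + 1) else (Fin.last w).castSucc := fun s => by simp [expansionEnds]
  have hle : ∀ (y : Fin (w + 2)) (A : Finset (HalfEdge e)), (∀ p ∈ A,
      expansionEnds Δ B (ofLex p).1.castSucc (ofLex p).2 = y) →
      A.map (liftHalfEdge e).toEmbedding ⊆ endsAt (expansionEnds Δ B) y := fun y A hA p hp => by
    obtain ⟨q, hq, rfl⟩ := Finset.mem_map.1 hp
    exact mem_endsAt.2 (hA q hq)
  have hle' : ∀ (y : Fin (w + 2)) (s : Bool) (A : Finset (HalfEdge e)), 2 ≤ A.card → (∀ p ∈ A,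
      expansionEnds Δ B (ofLex p).1.castSucc (ofLex p).2 = y) →
      expansionEnds Δ B (Fin.last e) s = y → 3 ≤ (endsAt (expansionEnds Δ B) y).card :=
    fun y s A hA2 hA hs => by
      have h1 : lastHalfEdge e s ∉ A.map (liftHalfEdge e).toEmbedding := by
        simp only [Finset.mem_map, RelEmbedding.coe_toEmbedding, not_exists, not_and]
        exact fun q _ H => (liftHalfEdge_lt_last q s).ne H
      have h2 := Finset.card_le_card (Finset.insert_subset
        (mem_endsAt.2 hs : lastHalfEdge e s ∈ endsAt (expansionEnds Δ B) y) (hle y A hA))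
      rw [Finset.card_insert_of_notMem h1, Finset.card_map] at h2
      omega
  let Γ : OrGraph (w + 2) (e + 1) :=
    { ends := expansionEnds Δ B
      three_le := fun y => by
        induction y using Fin.lastCases with
        | last => exact hle' _ true B hB2 (fun p hp => by rw [hcast', if_pos hp]) (hlast true)
        | cast y =>
          induction y using Fin.lastCases with
          | last =>
            refine hle' _ false _ hA2 (fun p hp => ?_) (hlast false)
            rw [Finset.mem_sdiff, mem_endsAt] at hp
            rw [hcast', if_neg hp.2, hp.1]
          | cast y =>
            refine (Δ.three_le y.castSucc).trans ?_
            rw [← Finset.card_map (liftHalfEdge e).toEmbedding]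
            refine Finset.card_le_card (hle _ _ fun p hp => ?_)
            rw [mem_endsAt] at hp
            rw [hcast', if_neg, hp]
            intro hpB
            have h1 := mem_endsAt.1 (hBS hpB)
            rw [hp] at h1
            exact (Fin.castSucc_lt_last y).ne h1 }
  have hmoved : movedHalfEdges Γ = B := by
    ext p
    rw [mem_movedHalfEdges]
    change expansionEnds Δ B (ofLex p).1.castSucc (ofLex p).2 = _ ↔ p ∈ B
    rw [hcast']
    by_cases hp : p ∈ B
    · exact iff_of_true (if_pos hp) hp
    · refine iff_of_false ?_ hp
      rw [if_neg hp]
      exact (Fin.castSucc_lt_last _).ne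
  refine ⟨Γ, ⟨hlast false, hlast true, fun j s => ?_⟩, hmoved⟩
  change _ = if expansionEnds Δ B j.castSucc s = _ then _ else expansionEnds Δ B j.castSucc s
  rw [hcast]
  by_cases hp : toLex (j, s) ∈ B
  · rw [if_pos hp, if_pos rfl]
    exact congrArg _ (mem_endsAt.1 (hBS hp))
  · rw [if_neg hp, if_neg (Fin.castSucc_lt_last _).ne]

theorem IsExpansion.eq_of_movedHalfEdges_eq {Δ : OrGraph (w + 1) e} {Γ Γ' : OrGraph (w + 2) (e + 1)}
    (hΓ : IsExpansion Δ Γ) (hΓ' : IsExpansion Δ Γ') (h : movedHalfEdges Γ = movedHalfEdges Γ') :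
    Γ = Γ' := by
  ext j s : 3
  refine Fin.lastCases ?_ (fun j => ?_) j
  · cases s
    · rw [hΓ.source, hΓ'.source]
    · rw [hΓ.target, hΓ'.target]
  · have h1 := hΓ.endAt_lift (toLex (j, s))
    rw [h, ← hΓ'.endAt_lift] at h1
    exact h1

open Classical in
/-- A sum over the expansions of a graph, as a sum over the splittings of its last vertex. -/
theorem sum_expansions (Δ : OrGraph (w + 1) e) (g : Finset (HalfEdge e) → k) :
    ∑ Γ with IsExpansion Δ Γ, g (movedHalfEdges Γ) =
      ∑ B ∈ stableSubsets (endsAt Δ.ends (Fin.last w)), g B := by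
  refine Finset.sum_bij (fun Γ _ => movedHalfEdges Γ) (fun Γ hΓ => ?_) (fun Γ hΓ Γ' hΓ' h => ?_)
    (fun B hB => ?_) fun _ _ => rfl
  · exact (Finset.mem_filter.1 hΓ).2.movedHalfEdges_mem
  · exact (Finset.mem_filter.1 hΓ).2.eq_of_movedHalfEdges_eq (Finset.mem_filter.1 hΓ').2 h
  · obtain ⟨Γ, hΓ, h⟩ := exists_expansion Δ hB
    exact ⟨Γ, Finset.mem_filter.2 ⟨Finset.mem_univ _, hΓ⟩, h⟩

open Classical in
-- Only the term at the last vertex depends on the splitting, so the quadratic relation can be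
-- applied for each labelling of the old half-edges.
theorem sum_graphContraction_expansions {h : LinearMap.BilinForm k L} (hsymm : h.IsSymm)
    (hnondeg : h.Nondegenerate) (b : Module.Basis ι k L) (Δ : OrGraph (w + 1) e)
    (T : Fin (w + 2) → CochainFamily k L)
    (hT : ∀ x : HalfEdge e → L, ∑ B ∈ stableSubsets (endsAt Δ.ends (Fin.last w)),
      (-1) ^ B.card * splitTerm h (T (Fin.last w).castSucc) (T (Fin.last (w + 1))) x
        (endsAt Δ.ends (Fin.last w) \ B) B = 0) :
    ∑ Γ with IsExpansion Δ Γ, graphContraction h b Γ T = 0 := by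
  rw [Finset.sum_congr rfl fun Γ hΓ =>
    (Finset.mem_filter.1 hΓ).2.graphContraction_eq hsymm hnondeg b T, sum_expansions Δ
      (expandedContraction h b Δ (fun y => T y.castSucc.castSucc)
      (T (Fin.last w).castSucc) (T (Fin.last (w + 1))))]
  unfold expandedContraction
  rw [← Finset.mul_sum, Finset.sum_comm]
  refine mul_eq_zero_of_right _ (Finset.sum_eq_zero fun a _ => ?_)
  rw [← Finset.mul_sum, hT, mul_zero]

open Classical in
/-- The sum of the amplitudes of all expansions of a graph at its last vertex vanishes. -/
theorem sum_cocycleAmplitude_expansions {h : LinearMap.BilinForm k L} (hsymm : h.IsSymm)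
    (hnondeg : h.Nondegenerate) (hinv : h.lieInvariant L) (b : Module.Basis ι k L) {n : ℕ}
    (hn : 1 ≤ n) {φ : L [⋀^Fin n]→ₗ[k] L} (hcyc : IsCyclicCochain h φ) (hcoc : IsLieCocycle φ)
    (Δ : OrGraph (w + 1) e) : ∑ Γ with IsExpansion Δ Γ, cocycleAmplitude φ h b Γ = 0 := by
  simp only [cocycleAmplitude_eq]
  rw [Finset.sum_comm]
  refine Finset.sum_eq_zero fun x _ => ?_
  -- The sign depends only on the position `x` of `t φ`, not on the expansion. The relation needed
  -- depends on whether `x` is the source of the new edge, its target, or another vertex.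
  rw [← Finset.mul_sum]
  refine mul_eq_zero_of_right _ (sum_graphContraction_expansions hsymm hnondeg b Δ _ fun u => ?_)
  have hne : (Fin.last w).castSucc ≠ Fin.last (w + 1) := (Fin.castSucc_lt_last _).ne
  by_cases hs : (Fin.last w).castSucc = x
  · subst hs
    rw [vertexFamilies_self, vertexFamilies_of_ne φ hne.symm]
    exact hcoc.sum_stable_splitTerm hsymm hinv hn hcyc _ u
  · rw [vertexFamilies_of_ne φ hs]
    by_cases ht : Fin.last (w + 1) = x
    · subst ht
      rw [vertexFamilies_self]
      exact hcoc.sum_stable_splitTerm_swap hsymm hinv hn hcyc _ u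
    · rw [vertexFamilies_of_ne φ ht]
      -- Both ends carry the bracket: this is the Jacobi identity, treated as the cocycle relation
      -- for the bracket, with `n = 2`.
      have hl : IsCyclicCochain h (lieBracketCochain k L) := by
        have h1 := isCyclicCochain_lieFamily hinv 2
        rwa [lieFamily, Pi.single_eq_same] at h1
      exact isLieCocycle_lieBracketCochain.sum_stable_splitTerm hsymm hinv (by norm_num) hl _ u

end CycleProof

/-! ### The main theorem -/

theorem mainTheorem5 {k : Type*} [Field k] [CharZero k]
    {L : Type*} [LieRing L] [LieAlgebra k L] [FiniteDimensional k L]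
    (h : LinearMap.BilinForm k L) (hsymm : h.IsSymm) (hnondeg : h.Nondegenerate)
    (hinv : h.lieInvariant L)
    (n : ℕ) (hn : 1 ≤ n) (φ : L [⋀^Fin n]→ₗ[k] L)
    (hcyc : IsCyclicCochain h φ) (hcoc : IsLieCocycle φ)
    {ι : Type*} [Fintype ι] [DecidableEq ι] (b : Module.Basis ι k L) :
    -- `l + t φ` is an infinitesimal deformation into an `L∞` algebra with invariant inner product
    (IsInfinitesimalDeformation n (lieFamily k L) (Pi.single n φ) ∧
      ∀ m, IsCyclicCochain h (lieFamily k L m) ∧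
        IsCyclicCochain h ((Pi.single n φ : CochainFamily k L) m)) ∧
    -- the function `Z` changes sign with the orientation and does not depend on the basis
    (∀ (v e : ℕ) (Γ Γ' : OrGraph v e) (f : OrGraph.Iso Γ Γ'),
      cocycleAmplitude φ h b Γ' = ((f.sign : ℤ) : k) * cocycleAmplitude φ h b Γ) ∧
    (∀ {ι' : Type*} [Fintype ι'] [DecidableEq ι'] (b' : Module.Basis ι' k L) (v e : ℕ)
      (Γ : OrGraph v e), cocycleAmplitude φ h b' Γ = cocycleAmplitude φ h b Γ) ∧
    -- the chain `∑ Z(Γ)/|Aut Γ| · Γ` is a cycle, and so is its part on connected graphs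
    (∀ v e : ℕ, graphBoundary k v e
      (graphChain fun Γ : OrGraph (v + 1) (e + 1) => cocycleAmplitude φ h b Γ) = 0) ∧
    (∀ v e : ℕ, graphBoundary k v e
      (graphChain (connectedPart fun Γ : OrGraph (v + 1) (e + 1) => cocycleAmplitude φ h b Γ)) =
        0) ∧
    -- all vertices are trivalent, except for one, which is `(n + 1)`-valent
    (∀ (v e : ℕ) (Γ : OrGraph v e), cocycleAmplitude φ h b Γ ≠ 0 →
      ∃ x, Γ.valence x = n + 1 ∧ ∀ y, y ≠ x → Γ.valence y = 3) := by
  have hZ : ∀ v e : ℕ, IsOrientationEquivariant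
      fun Γ : OrGraph v e => cocycleAmplitude φ h b Γ := fun v e =>
    cocycleAmplitude_isOrientationEquivariant hsymm hinv hcyc b
  refine ⟨⟨hcoc.isInfinitesimalDeformation hn, fun m =>
    ⟨isCyclicCochain_lieFamily hinv m, isCyclicCochain_single hcyc m⟩⟩, fun v e => hZ v e,
    fun b' v e Γ => cocycleAmplitude_basis_change hnondeg b b' φ Γ, fun v e => ?_, fun v e => ?_,
    fun v e Γ => exists_valence_of_cocycleAmplitude_ne_zero⟩
  -- A graph with one vertex has only loops and hence zero boundary; the expansion argument needs
  -- two vertices.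
  · cases v with
    | zero => exact graphBoundary_eq_zero_of_one_vertex _
    | succ w =>
      exact graphBoundary_graphChain_eq_zero (hZ _ _)
        (sum_cocycleAmplitude_expansions hsymm hnondeg hinv b hn hcyc hcoc)
  · cases v with
    | zero => exact graphBoundary_eq_zero_of_one_vertex _
    | succ w =>
      exact graphBoundary_graphChain_eq_zero (hZ _ _).connectedPart
        (sum_connectedPart_expansion
          (sum_cocycleAmplitude_expansions hsymm hnondeg hinv b hn hcyc hcoc))
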